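/- Let $q\ge 1$ be an integer and $\mathbb T^q=(\mathbb R/2\pi\mathbb Z)^q$, identified with $[-\pi,\pi]^q$. Let $\|f\|_{r}$ be the $L^r$ norm over $\mathbb T^q$ with respect to Lebesgue measure, $\hat f(\mathbf k)=(2\pi)^{-q}\int_{\mathbb T^q} f(\mathbf x)e^{-i\mathbf k\cdot\mathbf x}\,d\mathbf x$ for $\mathbf k\in\mathbb Z^q$, $\|\mathbf k\|$ the Euclidean norm of $\mathbf k$, and $d(\mathbf x,\mathbf y)=\min_{\mathbf l\in\mathbb Z^q}\|\mathbf x-\mathbf y+2\pi \mathbf l\|$ the Euclidean distance on $\mathbb T^q$. Let $1\le p\le\infty$, $1/p+1/p'=1$, and $s>q/p$. Let $Q>(q+1)/2$ be an integer and let $h:[0,\infty)\to[0,\infty)$ be a fixed nonincreasing, $Q-1$ times continuously differentiable function with $h^{(Q-1)}$ absolutely continuous, $h(t)=1$ for $0\le t\le 1/2$ and $h(t)=0$ for $t\ge 1$. For $t>0$ and $f\in L^1(\mathbb T^q)$ put $$\Psi_t(h,\mathbf x)=\sum_{\mathbf k\in\mathbb Z^q}h(\|\mathbf k\|/t)e^{i\mathbf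 k\cdot\mathbf x},\qquad \sigma_t(h,f)(\mathbf x)=\frac1{(2\pi)^q}\int_{\mathbb T^q}f(\mathbf y)\Psi_t(h,\mathbf x-\mathbf y)\,d\mathbf y .$$ **Theorem 4.4.** There is a function $K_s\in L^{p'}(\mathbb T^q)$ with $\hat K_s(\mathbf k)=(\|\mathbf k\|^2+1)^{-s/2}$ for all $\mathbf k\in\mathbb Z^q$. Moreover, there are constants $c_1,c_2,c>0$, depending only on $q,p,s,Q,h$, such that for every integer $m\ge1$ there is an integer $N^*$ with $c_1m\le N^*\le c_2m$ and the following property. Let $\mathbf y_1,\dots,\mathbf y_M\in\mathbb T^q$ satisfy $d(\mathbf y_j,\mathbf y_k)\ge 1/m$ whenever $\mathbf y_j\ne\mathbf y_k$, let $a_1,\dots,a_M\in\mathbb R$, and let $G=\sum_{j=1}^M a_jK_s(\cdot-\mathbf y_j)$, where $K_s$ is any integrable function with the above Fourier coefficients. Then $G\in L^{p'}(\mathbb T^q)$ and $$\|G-\sigma_{N^*}(h,G)\|_{p'}\le\tfrac12\|G\|_{p'}.$$ If, in addition, the points $\mathbf y_1,\dots,\mathbf y_M$ are pairwise distinct, then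 $$\|\mathbf a\|_{\ell^{p'}}\le c\,m^{s-q/p}\,\|G\|_{p'}.$$ -/

import Mathlib

open MeasureTheory
open scoped ENNReal

instance fact_zero_lt_two_pi : Fact (0 < 2 * Real.pi) := ⟨Real.two_pi_pos⟩

/-- The `q`-dimensional torus `(ℝ / 2πℤ)^q`. Functions on it are the `2π`-periodic functions on
`ℝ^q`; its `volume` is the image of Lebesgue measure on `[-π, π]^q`, of total mass `(2π)^q`. -/
abbrev Torus (q : ℕ) : Type := Fin q → AddCircle (2 * Real.pi)

namespace Torus

/-- The Euclidean norm of a multi-index. -/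
noncomputable def freqNorm {q : ℕ} (k : Fin q → ℤ) : ℝ := √(∑ i, (k i : ℝ) ^ 2)

/-- The Euclidean distance on the torus, i.e. the minimum of the Euclidean distance `‖x - y + 2πl‖`
over `l ∈ ℤ^q`. (The norm on `AddCircle (2 * π)` is the distance to the nearest multiple
of `2π`.) -/
noncomputable def euclDist {q : ℕ} (x y : Torus q) : ℝ := √(∑ i, ‖x i - y i‖ ^ 2)

/-- The character `x ↦ exp (i k · x)`. -/
noncomputable def character {q : ℕ} (k : Fin q → ℤ) (x : Torus q) : ℂ :=
  ∏ i, fourier (k i) (x i)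

theorem character_coe {q : ℕ} (k : Fin q → ℤ) (θ : Fin q → ℝ) :
    character k (fun i => (θ i : AddCircle (2 * Real.pi))) =
      Complex.exp (Complex.I * ∑ i, (k i : ℂ) * (θ i : ℂ)) := by
  unfold character
  rw [Finset.mul_sum, Complex.exp_sum]
  refine Finset.prod_congr rfl fun i _ => ?_
  rw [fourier_coe_apply]
  congr 1
  have hpi : (Real.pi : ℂ) ≠ 0 := by exact_mod_cast Real.pi_ne_zero
  push_cast
  field_simp

/-- The Fourier coefficient `(2π)^{-q} ∫ f(x) exp (-i k · x) dx`. -/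
noncomputable def fourierCoefficient {q : ℕ} (f : Torus q → ℂ) (k : Fin q → ℤ) : ℂ :=
  ((2 * Real.pi : ℝ) : ℂ)⁻¹ ^ q * ∫ x : Torus q, f x * character (-k) x

/-- `K` is (a representative of) the Sobolev kernel of order `s`: the integrable function whose
Fourier coefficients are `(‖k‖² + 1)^{-s/2}`. -/
structure IsSobolevKernel {q : ℕ} (s : ℝ) (K : Torus q → ℂ) : Prop where
  integrable : Integrable K
  fourierCoefficient_eq : ∀ k : Fin q → ℤ,
    fourierCoefficient K k = (((freqNorm k ^ 2 + 1) ^ (-s / 2) : ℝ) : ℂ)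

open Classical in
/-- The kernel `Ψ_t(h, x) = ∑_{k ∈ ℤ^q} h(‖k‖ / t) exp (i k · x)` for `t > 0`, with the conventions
`Ψ_0 = 1` and `Ψ_t = 0` for `t < 0`. (For `h` vanishing on `[1, ∞)` the sum is finite.) -/
noncomputable def filterKernel {q : ℕ} (h : ℝ → ℝ) (t : ℝ) (x : Torus q) : ℂ :=
  if 0 < t then ∑' k : Fin q → ℤ, (h (freqNorm k / t) : ℂ) * character k x
  else if t = 0 then 1 else 0

/-- The operator `σ_t(h, f, x) = (2π)^{-q} ∫ f(y) Ψ_t(h, x - y) dy`. -/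
noncomputable def filterOp {q : ℕ} (h : ℝ → ℝ) (t : ℝ) (f : Torus q → ℂ) (x : Torus q) : ℂ :=
  ((2 * Real.pi : ℝ) : ℂ)⁻¹ ^ q * ∫ y : Torus q, f y * filterKernel h t (x - y)

end Torus

/-- `h : [0, ∞) → [0, ∞)` is a low-pass filter of order `Q`: it is `Q - 1` times continuously
differentiable, with `h^{(Q-1)}` (locally) absolutely continuous, nonincreasing, equal to `1` on
`[0, 1/2]` and to `0` on `[1, ∞)`. Only the values of `h` on `[0, ∞)` matter. -/
structure IsLowPassFilter (Q : ℕ) (h : ℝ → ℝ) : Prop where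
  contDiffOn : ContDiffOn ℝ ((Q - 1 : ℕ) : ℕ∞) h (Set.Ici 0)
  absolutelyContinuous : ∀ b : ℝ, 0 < b →
    AbsolutelyContinuousOnInterval (iteratedDerivWithin (Q - 1) h (Set.Ici 0)) 0 b
  nonneg : ∀ t : ℝ, 0 ≤ t → 0 ≤ h t
  antitoneOn : AntitoneOn h (Set.Ici 0)
  eq_one : ∀ t : ℝ, 0 ≤ t → t ≤ 1 / 2 → h t = 1
  eq_zero : ∀ t : ℝ, 1 ≤ t → h t = 0

/-- The linear combination of translates `G(x) = ∑_j a_j K(x - y_j)`. -/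
noncomputable def translateSum {q M : ℕ} (K : Torus q → ℂ) (a : Fin M → ℝ) (y : Fin M → Torus q)
    (x : Torus q) : ℂ :=
  ∑ j, (a j : ℂ) * K (x - y j)

/-! Write r = p', θ = 1/r, and e = s − q/p = s − q(1 − θ) > 0. Distinct nodes are at sup-norm
distance at least δ = 1/(mq). After repeated nodes are merged, two opposite estimates carry the
theorem, both valid once 2^n is a large enough multiple of 1/δ: (a) ‖G − σ_{2^(n+1)} G‖_r ≤ C₂
2^(−ne) ‖a‖_r; (b) ‖a‖_r ≤ C₁ 2^(ne) ‖G‖_r. With 2^n comparable to m, (b) is the bound on the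
coefficients. Using (a) at level n + l together with (b) at level n leaves the factor C₁C₂ 2^(−le),
which is at most 1/2 for a fixed large l; then N* = 2^(n+l+1).

For (a), the kernel is split into smooth dyadic frequency bands. A band at frequency N = 2^j is
bounded by C N^(q−s) (1 + N‖x‖)^(−(q+1)) (`exists_norm_trig_bandCoeff_le`). Its L¹ norm is thus
O(N^(−s)), and the sum of its values at separated nodes is O(N^(q−s)) for N ≥ 1/δ. Schur's test
(`MeasureTheory.eLpNorm_le_of_schur`) interpolates these to the operator norm O(N^(−e)) from ℓ^r to
L^r, and the bands above 2^n sum to O(2^(−ne)) (`exists_eLpNorm_translateSum_sub_le`). The filter at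
2^(n+1) reproduces the remaining low frequencies exactly and is bounded on L^r, so only this tail
contributes to the error.

For (b), G is convolved with the truncated inverse multiplier (‖k‖² + 1)^(s/2), which turns each
translate of the kernel into a translate of a smooth approximate identity Φ. Sampling at the nodes
gives the matrix Φ(y_i − y_j). Its diagonal is of order 2^(nq), and its off-diagonal row and column
sums are at most half of that when δ 2^n is large; so it can be inverted in ℓ^r
(`exists_eLpNorm_coefficients_le`).

The boundedness of the filter is the delicate point, because h has only Q − 1 derivatives, the last
one of bounded variation. The L¹ norm of its kernel is estimated on dyadic annuli by Cauchy–Schwarz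
and Parseval, applied to differences of order Q of the coefficients with step adapted to the annulus
(`exists_lintegral_trig_radialCoeff_le`). Bounded variation is worth half a derivative in ℓ², which
is why Q > (q + 1)/2 suffices. -/

namespace Torus

variable {q : ℕ}

/-! ### Characters and trigonometric polynomials on the torus -/

theorem continuous_character (k : Fin q → ℤ) : Continuous (character k) := by
  unfold character
  fun_prop

theorem norm_character (k : Fin q → ℤ) (x : Torus q) : ‖character k x‖ = 1 := by
  rw [character, norm_prod]
  exact Finset.prod_eq_one fun i _ => Circle.norm_coe _

theorem character_zero (x : Torus q) : character 0 x = 1 := by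
  simp [character]

theorem character_at_zero (k : Fin q → ℤ) : character k (0 : Torus q) = 1 := by
  simp [character]

theorem character_add (k l : Fin q → ℤ) (x : Torus q) :
    character (k + l) x = character k x * character l x := by
  simp only [character, Pi.add_apply, fourier_add, Finset.prod_mul_distrib]

theorem character_add_right (k : Fin q → ℤ) (x y : Torus q) :
    character k (x + y) = character k x * character k y := by
  simp only [character, Pi.add_apply, fourier_apply, ← Finset.prod_mul_distrib, smul_add,
    AddCircle.toCircle_add, Circle.coe_mul]

theorem character_neg (k : Fin q → ℤ) (x : Torus q) :
    character (-k) x = (starRingEnd ℂ) (character k x) := by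
  simp only [character, Pi.neg_apply, fourier_neg, map_prod]

theorem character_neg_right (k : Fin q → ℤ) (x : Torus q) :
    character k (-x) = character (-k) x := by
  simp [character, fourier_apply]

theorem character_sub_right (k : Fin q → ℤ) (x y : Torus q) :
    character k (x - y) = character k x * character (-k) y := by
  rw [sub_eq_add_neg, character_add_right, character_neg_right]

theorem character_single (i : Fin q) (n : ℤ) (x : Torus q) :
    character (Pi.single i n) x = fourier n (x i) := by
  unfold character
  rw [Finset.prod_eq_single i]
  · simp
  · intro j _ hj; simp [hj]
  · simp

theorem volume_univ : (volume : Measure (Torus q)) Set.univ = ENNReal.ofReal (2 * Real.pi) ^ q := by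
  rw [volume_pi, Measure.pi_univ]
  simp

theorem volume_real_univ : (volume : Measure (Torus q)).real Set.univ = (2 * Real.pi) ^ q := by
  rw [Measure.real, volume_univ, ENNReal.toReal_pow, ENNReal.toReal_ofReal Real.two_pi_pos.le]

theorem integral_character_of_ne {k : Fin q → ℤ} (hk : k ≠ 0) :
    ∫ x : Torus q, character k x = 0 := by
  obtain ⟨i, hi⟩ := Function.ne_iff.mp hk
  -- Translation by half a wavelength in coordinate i multiplies the character by −1, so the
  -- integral equals its own negative.
  let z : Torus q := Pi.single i ((2 * Real.pi / 2 / (k i) : ℝ) : AddCircle (2 * Real.pi))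
  have hz : character k z = -1 := by
    unfold character
    rw [Finset.prod_eq_single i]
    · have := fourier_add_half_inv_index hi Real.two_pi_pos (0 : AddCircle (2 * Real.pi))
      simpa [z, fourier_eval_zero] using this
    · intro j _ hj; simp [z, hj]
    · simp
  have h1 : ∫ x : Torus q, character k (x + z) = ∫ x : Torus q, character k x :=
    integral_add_right_eq_self (character k) z
  simp_rw [character_add_right, hz] at h1
  rw [integral_mul_const] at h1
  have : (2 : ℂ) * ∫ x : Torus q, character k x = 0 := by linear_combination -h1
  simpa using this

theorem integral_character (k : Fin q → ℤ) :
    ∫ x : Torus q, character k x = if k = 0 then ((2 * Real.pi : ℝ) : ℂ) ^ q else 0 := by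
  split_ifs with h
  · subst h
    simp_rw [character_zero]
    rw [integral_const, volume_real_univ]
    simp
  · exact integral_character_of_ne h

theorem integrable_mul_character {f : Torus q → ℂ} (hf : Integrable f) (k : Fin q → ℤ) :
    Integrable fun x => f x * character k x :=
  hf.mul_bdd (c := 1) (continuous_character k).aestronglyMeasurable
    (Filter.Eventually.of_forall fun x => (norm_character k x).le)

/-- The trigonometric series with coefficients `c`; it is used for finitely supported `c`. -/
noncomputable def trig (c : (Fin q → ℤ) → ℂ) (x : Torus q) : ℂ := ∑' k, c k * character k x

theorem trig_eq_sum {c : (Fin q → ℤ) → ℂ} {S : Finset (Fin q → ℤ)} (hS : ∀ k ∉ S, c k = 0)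
    (x : Torus q) : trig c x = ∑ k ∈ S, c k * character k x :=
  tsum_eq_sum fun k hk => by simp [hS k hk]

theorem trig_eq_sum_toFinset {c : (Fin q → ℤ) → ℂ} (hc : c.support.Finite) (x : Torus q) :
    trig c x = ∑ k ∈ hc.toFinset, c k * character k x :=
  trig_eq_sum (fun k hk => by simpa using hk) x

theorem summable_trig {c : (Fin q → ℤ) → ℂ} (hc : c.support.Finite) (x : Torus q) :
    Summable fun k => c k * character k x :=
  summable_of_hasFiniteSupport (hc.subset fun k hk => by
    simp only [Function.mem_support] at hk ⊢; exact left_ne_zero_of_mul hk)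

theorem continuous_trig {c : (Fin q → ℤ) → ℂ} (hc : c.support.Finite) : Continuous (trig c) := by
  have : trig c = fun x => ∑ k ∈ hc.toFinset, c k * character k x :=
    funext (trig_eq_sum_toFinset hc)
  rw [this]
  exact continuous_finsetSum _ fun k _ => continuous_const.mul (continuous_character k)

theorem integrable_trig {c : (Fin q → ℤ) → ℂ} (hc : c.support.Finite) : Integrable (trig c) :=
  (continuous_trig hc).integrable_of_hasCompactSupport (HasCompactSupport.of_compactSpace _)

theorem trig_sub {c d : (Fin q → ℤ) → ℂ} (hc : c.support.Finite) (hd : d.support.Finite)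
    (x : Torus q) : trig (fun k => c k - d k) x = trig c x - trig d x := by
  unfold trig
  rw [← (summable_trig hc x).tsum_sub (summable_trig hd x)]
  simp_rw [sub_mul]

theorem trig_const_mul (a : ℂ) (c : (Fin q → ℤ) → ℂ) (x : Torus q) :
    trig (fun k => a * c k) x = a * trig c x := by
  unfold trig
  rw [← tsum_mul_left]
  simp_rw [mul_assoc]

theorem norm_trig_le {c : (Fin q → ℤ) → ℂ} {S : Finset (Fin q → ℤ)} (hS : ∀ k ∉ S, c k = 0)
    (x : Torus q) : ‖trig c x‖ ≤ ∑ k ∈ S, ‖c k‖ := by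
  rw [trig_eq_sum hS]
  refine (norm_sum_le _ _).trans (Finset.sum_le_sum fun k _ => ?_)
  rw [norm_mul, norm_character, mul_one]

theorem support_comp_add_finite {c : (Fin q → ℤ) → ℂ} (hc : c.support.Finite) (v : Fin q → ℤ) :
    (Function.support fun k => c (k + v)).Finite :=
  hc.preimage (add_left_injective v).injOn

theorem support_fwdDiff_finite {c : (Fin q → ℤ) → ℂ} (hc : c.support.Finite) (v : Fin q → ℤ) :
    (Function.support (fwdDiff v c)).Finite :=
  ((support_comp_add_finite hc v).union hc).subset fun k hk => by
    by_contra h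
    simp only [Set.mem_union, Function.mem_support, not_or, not_not] at h
    exact hk (by simp [fwdDiff, h.1, h.2])

theorem support_fwdDiff_iter_finite {c : (Fin q → ℤ) → ℂ} (hc : c.support.Finite)
    (v : Fin q → ℤ) (n : ℕ) : (Function.support ((fwdDiff v)^[n] c)).Finite := by
  induction n with
  | zero => exact hc
  | succ n ih => rw [Function.iterate_succ_apply']; exact support_fwdDiff_finite ih v

/-- Shifting the coefficients multiplies the sum by a character. This is the discrete integration by
parts from which all decay away from the origin is obtained. -/
theorem trig_fwdDiff {c : (Fin q → ℤ) → ℂ} (hc : c.support.Finite) (v : Fin q → ℤ)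
    (x : Torus q) : trig (fwdDiff v c) x = (character (-v) x - 1) * trig c x := by
  have h1 : trig (fun k => c (k + v)) x = character (-v) x * trig c x := by
    unfold trig
    rw [← tsum_mul_left, ← (Equiv.addRight v).tsum_eq (fun k => character (-v) x * _)]
    refine tsum_congr fun k => ?_
    have : character k x = character (-v) x * character (k + v) x := by
      rw [← character_add]; congr 1; abel
    simp only [Equiv.coe_addRight]
    rw [this]; ring
  have : fwdDiff v c = fun k => c (k + v) - c k := rfl
  rw [this, trig_sub (support_comp_add_finite hc v) hc, h1]; ring

theorem trig_fwdDiff_iter {c : (Fin q → ℤ) → ℂ} (hc : c.support.Finite) (v : Fin q → ℤ)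
    (n : ℕ) (x : Torus q) :
    trig ((fwdDiff v)^[n] c) x = (character (-v) x - 1) ^ n * trig c x := by
  induction n with
  | zero => simp
  | succ n ih =>
    rw [Function.iterate_succ_apply', trig_fwdDiff (support_fwdDiff_iter_finite hc v n), ih]; ring

theorem fourierCoefficient_trig {c : (Fin q → ℤ) → ℂ} (hc : c.support.Finite) (k : Fin q → ℤ) :
    fourierCoefficient (trig c) k = c k := by
  unfold fourierCoefficient
  have hpi : ((2 * Real.pi : ℝ) : ℂ) ≠ 0 := by exact_mod_cast Real.two_pi_pos.ne'
  have : ∀ x : Torus q, trig c x * character (-k) x =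
      ∑ l ∈ hc.toFinset, c l * character (l - k) x := by
    intro x
    rw [trig_eq_sum_toFinset hc, Finset.sum_mul]
    refine Finset.sum_congr rfl fun l _ => ?_
    rw [mul_assoc, ← character_add, sub_eq_add_neg]
  simp_rw [this]
  rw [integral_finsetSum]
  · simp_rw [integral_const_mul, integral_character, sub_eq_zero]
    simp only [mul_ite, mul_zero, Finset.sum_ite_eq', Set.Finite.mem_toFinset,
      Function.mem_support]
    split_ifs with h
    · rw [mul_left_comm, ← mul_pow, inv_mul_cancel₀ hpi, one_pow, mul_one]
    · simp only [ne_eq, not_not] at h; simp [h]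
  · intro l _
    exact ((continuous_const.mul (continuous_character _))).integrable_of_hasCompactSupport
      (HasCompactSupport.of_compactSpace _)

/-- Convolution with a trigonometric polynomial multiplies the Fourier coefficients. -/
theorem integral_mul_trig_sub {f : Torus q → ℂ} (hf : Integrable f) {c : (Fin q → ℤ) → ℂ}
    (hc : c.support.Finite) (x : Torus q) :
    ∫ y, f y * trig c (x - y) =
      ((2 * Real.pi : ℝ) : ℂ) ^ q * trig (fun k => c k * fourierCoefficient f k) x := by
  have hpi : ((2 * Real.pi : ℝ) : ℂ) ≠ 0 := by exact_mod_cast Real.two_pi_pos.ne'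
  have h0 : ∀ y : Torus q, f y * trig c (x - y) =
      ∑ k ∈ hc.toFinset, c k * character k x * (f y * character (-k) y) := by
    intro y
    rw [trig_eq_sum_toFinset hc, Finset.mul_sum]
    refine Finset.sum_congr rfl fun k _ => ?_
    rw [character_sub_right]; ring
  simp_rw [h0]
  rw [integral_finsetSum _ fun k _ => (integrable_mul_character hf _).const_mul _]
  rw [trig_eq_sum (S := hc.toFinset) (fun k hk => by
    have : c k = 0 := by simpa using hk
    simp [this]), Finset.mul_sum]
  refine Finset.sum_congr rfl fun k _ => ?_
  rw [integral_const_mul]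
  have h1 : ((2 * Real.pi : ℝ) : ℂ) ^ q * ((2 * Real.pi : ℝ) : ℂ)⁻¹ ^ q = 1 := by
    rw [← mul_pow, mul_inv_cancel₀ hpi, one_pow]
  unfold fourierCoefficient
  linear_combination (-(c k * character k x * ∫ a : Torus q, f a * character (-k) a)) * h1

/-- Parseval's identity, in extended nonnegative form so that it bounds integrals over subsets of
the torus by monotonicity. -/
theorem lintegral_trig_sq {c : (Fin q → ℤ) → ℂ} (hc : c.support.Finite) :
    ∫⁻ x : Torus q, ‖trig c x‖ₑ ^ 2 =
      ENNReal.ofReal (2 * Real.pi) ^ q * ∑' k, ‖c k‖ₑ ^ 2 := by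
  have hpi : ((2 * Real.pi : ℝ) : ℂ) ≠ 0 := by exact_mod_cast Real.two_pi_pos.ne'
  have hint : Integrable fun x : Torus q => ‖trig c x‖ ^ 2 :=
    ((continuous_trig hc).norm.pow 2).integrable_of_hasCompactSupport
      (HasCompactSupport.of_compactSpace _)
  have key : ∫ x : Torus q, ‖trig c x‖ ^ 2 =
      (2 * Real.pi) ^ q * ∑ k ∈ hc.toFinset, ‖c k‖ ^ 2 := by
    have h1 : ∀ x : Torus q, ((‖trig c x‖ ^ 2 : ℝ) : ℂ) =
        ∑ k ∈ hc.toFinset, (starRingEnd ℂ) (c k) * (trig c x * character (-k) x) := by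
      intro x
      rw [← Complex.normSq_eq_norm_sq, ← Complex.mul_conj]
      nth_rw 2 [trig_eq_sum_toFinset hc]
      rw [map_sum, Finset.mul_sum]
      refine Finset.sum_congr rfl fun k _ => ?_
      rw [map_mul, character_neg]; ring
    have h2 : ((∫ x : Torus q, ‖trig c x‖ ^ 2 : ℝ) : ℂ) =
        (((2 * Real.pi) ^ q * ∑ k ∈ hc.toFinset, ‖c k‖ ^ 2 : ℝ) : ℂ) := by
      rw [← integral_complex_ofReal]
      simp_rw [h1]
      rw [integral_finsetSum _ fun k _ =>
        (integrable_mul_character (integrable_trig hc) _).const_mul _]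
      push_cast
      rw [Finset.mul_sum]
      refine Finset.sum_congr rfl fun k _ => ?_
      rw [integral_const_mul]
      have h3 := fourierCoefficient_trig hc k
      unfold fourierCoefficient at h3
      rw [inv_pow, inv_mul_eq_iff_eq_mul₀ (pow_ne_zero _ hpi)] at h3
      rw [h3, ← Complex.ofReal_pow ‖c k‖, ← Complex.normSq_eq_norm_sq, ← Complex.mul_conj]
      push_cast; ring
    exact_mod_cast h2
  have e1 : ∀ z : ℂ, ‖z‖ₑ ^ 2 = ENNReal.ofReal (‖z‖ ^ 2) := fun z => by
    rw [ENNReal.ofReal_pow (norm_nonneg _), ofReal_norm]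
  simp_rw [e1]
  rw [← ofReal_integral_eq_lintegral_ofReal hint (Filter.Eventually.of_forall fun x => by positivity),
    key, ENNReal.ofReal_mul (by positivity), ENNReal.ofReal_pow Real.two_pi_pos.le,
    ENNReal.ofReal_sum_of_nonneg (fun _ _ => by positivity)]
  congr 1
  refine (tsum_eq_sum fun k hk => ?_).symm
  have : c k = 0 := by simpa using hk
  simp [this]

/-! ### Uniqueness of Fourier coefficients -/

/-- The star subalgebra of `C(Torus q, ℂ)` generated by the characters. -/
noncomputable def characterSubalgebra (q : ℕ) : StarSubalgebra ℂ C(Torus q, ℂ) where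
  toSubalgebra := Algebra.adjoin ℂ
    (Set.range fun k : Fin q → ℤ => (⟨character k, continuous_character k⟩ : C(Torus q, ℂ)))
  star_mem' := by
    change Algebra.adjoin ℂ _ ≤ star (Algebra.adjoin ℂ _)
    refine Algebra.adjoin_le ?_
    rintro _ ⟨k, rfl⟩
    refine Algebra.subset_adjoin ⟨-k, ?_⟩
    ext1 x
    simp [character_neg]

theorem characterSubalgebra_separatesPoints : (characterSubalgebra q).SeparatesPoints := by
  intro x y hxy
  rw [Ne, funext_iff, not_forall] at hxy
  obtain ⟨i, hi⟩ := hxy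
  refine ⟨_, ⟨⟨character (Pi.single i 1), continuous_character _⟩,
    Algebra.subset_adjoin ⟨Pi.single i 1, rfl⟩, rfl⟩, ?_⟩
  simp only [ContinuousMap.coe_mk]
  rw [character_single, character_single, fourier_one, fourier_one, Ne, Circle.coe_inj]
  contrapose hi
  exact AddCircle.injective_toCircle Real.two_pi_pos.ne' hi

/-- Integration against f is a bounded functional on the continuous functions. It kills the
characters, whose span is dense by Stone–Weierstrass. -/
theorem integral_mul_eq_zero_of_fourierCoefficient_eq_zero {f : Torus q → ℂ} (hf : Integrable f)
    (h : ∀ k, fourierCoefficient f k = 0) (φ : C(Torus q, ℂ)) : ∫ x, f x * φ x = 0 := by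
  have hint : ∀ φ : C(Torus q, ℂ), Integrable fun x => f x * φ x := fun φ =>
    hf.mul_bdd (c := ‖φ‖) φ.continuous.aestronglyMeasurable
      (Filter.Eventually.of_forall fun x => φ.norm_coe_le_norm x)
  have hpi : ((2 * Real.pi : ℝ) : ℂ) ≠ 0 := by exact_mod_cast Real.two_pi_pos.ne'
  let L : C(Torus q, ℂ) →ₗ[ℂ] ℂ :=
    { toFun := fun φ => ∫ x, f x * φ x
      map_add' := fun φ ψ => by
        simp only [ContinuousMap.add_apply, mul_add]
        exact integral_add (hint φ) (hint ψ)
      map_smul' := fun a φ => by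
        simp only [ContinuousMap.smul_apply, smul_eq_mul, RingHom.id_apply]
        rw [← integral_const_mul]
        congr 1; ext x; ring }
  have hL : ∀ φ, ‖L φ‖ ≤ (∫ x, ‖f x‖) * ‖φ‖ := fun φ => by
    rw [← integral_mul_const]
    refine norm_integral_le_of_norm_le (hf.norm.mul_const _)
      (Filter.Eventually.of_forall fun x => ?_)
    rw [norm_mul]
    gcongr
    exact φ.norm_coe_le_norm x
  let L' := L.mkContinuous _ hL
  have hclosed : IsClosed {φ | L' φ = 0} := isClosed_eq L'.continuous continuous_const
  have hsub : ((characterSubalgebra q : StarSubalgebra ℂ C(Torus q, ℂ)) : Set C(Torus q, ℂ)) ⊆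
      {φ | L' φ = 0} := by
    intro φ hφ
    -- Products of characters are characters, so the algebra they generate is merely their linear
    -- span.
    have hspan : φ ∈ Submodule.span ℂ (Set.range fun k : Fin q → ℤ =>
        (⟨character k, continuous_character k⟩ : C(Torus q, ℂ))) := by
      rw [← Algebra.adjoin_eq_span_of_subset]
      · exact hφ
      · refine Set.Subset.trans (fun x hx => ?_) Submodule.subset_span
        refine Submonoid.closure_induction (fun _ => id) ⟨0, ?_⟩ ?_ hx
        · ext z; simp [character_zero]
        · rintro _ _ _ _ ⟨m, rfl⟩ ⟨n, rfl⟩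
          exact ⟨m + n, by ext z; simp [character_add]⟩
    refine Submodule.span_induction (p := fun φ _ => L' φ = 0) ?_ (map_zero _)
      (fun x y _ _ hx hy => by rw [map_add, hx, hy, add_zero])
      (fun a x _ hx => by rw [map_smul, hx, smul_zero]) hspan
    rintro _ ⟨k, rfl⟩
    have := h (-k)
    unfold fourierCoefficient at this
    rw [neg_neg] at this
    exact (mul_eq_zero.mp this).resolve_left (pow_ne_zero _ (inv_ne_zero hpi))
  have htop : (characterSubalgebra q).topologicalClosure = ⊤ :=
    ContinuousMap.starSubalgebra_topologicalClosure_eq_top_of_separatesPoints _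
      characterSubalgebra_separatesPoints
  have hmem : φ ∈ closure ((characterSubalgebra q : StarSubalgebra ℂ C(Torus q, ℂ)) :
      Set C(Torus q, ℂ)) := by
    rw [← StarSubalgebra.topologicalClosure_coe, htop]; trivial
  exact hclosed.closure_subset_iff.mpr hsub hmem

/-- The indicator of a closed set is a bounded limit of continuous functions, so f integrates to
zero over every closed set. This allows an arbitrary kernel with the prescribed coefficients to be
replaced by an explicit series. -/
theorem ae_eq_zero_of_fourierCoefficient_eq_zero {f : Torus q → ℂ} (hf : Integrable f)
    (h : ∀ k, fourierCoefficient f k = 0) : f =ᵐ[volume] 0 := by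
  refine ae_eq_zero_of_forall_setIntegral_isClosed_eq_zero hf fun s hs => ?_
  have hδ : ∀ n : ℕ, (0 : ℝ) < 1 / ((n : ℝ) + 1) := fun n => by positivity
  have hlim : Filter.Tendsto (fun n : ℕ =>
      ∫ x, f x * (((thickenedIndicator (hδ n) s x : NNReal) : ℝ) : ℂ)) Filter.atTop
      (nhds (∫ x, s.indicator f x)) := by
    refine tendsto_integral_of_dominated_convergence (fun x => ‖f x‖) (fun n => ?_) hf.norm
      (fun n => Filter.Eventually.of_forall fun x => ?_)
      (Filter.Eventually.of_forall fun x => ?_)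
    · refine hf.aestronglyMeasurable.mul (Continuous.aestronglyMeasurable ?_)
      exact Complex.continuous_ofReal.comp
        (NNReal.continuous_coe.comp (thickenedIndicator (hδ n) s).continuous)
    · rw [norm_mul, Complex.norm_real, Real.norm_of_nonneg (NNReal.coe_nonneg _)]
      refine mul_le_of_le_one_right (norm_nonneg _) ?_
      exact_mod_cast thickenedIndicator_le_one (hδ n) s x
    · have h1 := thickenedIndicator_tendsto_indicator_closure hδ
        tendsto_one_div_add_atTop_nhds_zero_nat s
      rw [tendsto_pi_nhds] at h1
      have h2 := (Complex.continuous_ofReal.tendsto _).comp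
        ((NNReal.continuous_coe.tendsto _).comp (h1 x))
      have h3 := h2.const_mul (f x)
      rw [hs.closure_eq] at h3
      have h4 : s.indicator f x =
          f x * (((s.indicator (fun _ => (1 : NNReal)) x : NNReal) : ℝ) : ℂ) := by
        by_cases hx : x ∈ s <;> simp [hx]
      rw [h4]
      exact h3
  rw [← integral_indicator hs.measurableSet]
  refine tendsto_nhds_unique hlim ?_
  have : ∀ n : ℕ, ∫ x, f x * (((thickenedIndicator (hδ n) s x : NNReal) : ℝ) : ℂ) = 0 := fun n =>
    integral_mul_eq_zero_of_fourierCoefficient_eq_zero hf h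
      ⟨fun x => (((thickenedIndicator (hδ n) s x : NNReal) : ℝ) : ℂ),
        Complex.continuous_ofReal.comp
        (NNReal.continuous_coe.comp (thickenedIndicator (hδ n) s).continuous)⟩
  simp_rw [this]
  exact tendsto_const_nhds

end Torus

/-! ### Functions whose highest derivative has bounded variation -/

/-- The increments of `f` are dominated by those of a monotone function with values in `[0, V]`;
in particular the total variation of `f` is at most `V`. -/
def VariationLE (V : ℝ) (f : ℝ → ℝ) : Prop :=
  ∃ μ : ℝ → ℝ, Monotone μ ∧ (∀ x, 0 ≤ μ x ∧ μ x ≤ V) ∧ ∀ x y, x ≤ y → |f y - f x| ≤ μ y - μ x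

namespace VariationLE

variable {V W A B : ℝ} {f g : ℝ → ℝ}

theorem mono (h : VariationLE V f) (hVW : V ≤ W) : VariationLE W f := by
  obtain ⟨μ, h1, h2, h3⟩ := h
  exact ⟨μ, h1, fun x => ⟨(h2 x).1, (h2 x).2.trans hVW⟩, h3⟩

theorem nonneg (h : VariationLE V f) : 0 ≤ V := by
  obtain ⟨μ, -, h2, -⟩ := h
  exact (h2 0).1.trans (h2 0).2

theorem add (hf : VariationLE V f) (hg : VariationLE W g) :
    VariationLE (V + W) (fun x => f x + g x) := by
  obtain ⟨μ, m1, m2, m3⟩ := hf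
  obtain ⟨ν, n1, n2, n3⟩ := hg
  refine ⟨fun x => μ x + ν x, m1.add n1, fun x => ⟨add_nonneg (m2 x).1 (n2 x).1,
    add_le_add (m2 x).2 (n2 x).2⟩, fun x y hxy => ?_⟩
  calc |f y + g y - (f x + g x)| = |(f y - f x) + (g y - g x)| := by ring_nf
    _ ≤ |f y - f x| + |g y - g x| := abs_add_le _ _
    _ ≤ _ := by linarith [m3 x y hxy, n3 x y hxy]

theorem mul (hf : VariationLE A f) (hg : VariationLE B g) (hfA : ∀ x, |f x| ≤ A)
    (hgB : ∀ x, |g x| ≤ B) : VariationLE (2 * A * B) (fun x => f x * g x) := by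
  have hA := hf.nonneg
  have hB := hg.nonneg
  obtain ⟨μ, m1, m2, m3⟩ := hf
  obtain ⟨ν, n1, n2, n3⟩ := hg
  refine ⟨fun x => B * μ x + A * ν x, (m1.const_mul hB).add (n1.const_mul hA), fun x =>
    ⟨add_nonneg (mul_nonneg hB (m2 x).1) (mul_nonneg hA (n2 x).1), ?_⟩, fun x y hxy => ?_⟩
  · nlinarith [mul_le_mul_of_nonneg_left (m2 x).2 hB, mul_le_mul_of_nonneg_left (n2 x).2 hA]
  · calc |f y * g y - f x * g x| = |(f y - f x) * g y + f x * (g y - g x)| := by ring_nf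
      _ ≤ |(f y - f x) * g y| + |f x * (g y - g x)| := abs_add_le _ _
      _ = |f y - f x| * |g y| + |f x| * |g y - g x| := by rw [abs_mul, abs_mul]
      _ ≤ (μ y - μ x) * B + A * (ν y - ν x) := by
          gcongr
          · exact (abs_nonneg _).trans (m3 x y hxy)
          · exact m3 x y hxy
          · exact hgB y
          · exact hfA x
          · exact n3 x y hxy
      _ = _ := by ring

theorem comp_monotone (hf : VariationLE V f) {θ : ℝ → ℝ} (hθ : Monotone θ) :
    VariationLE V (fun x => f (θ x)) := by
  obtain ⟨μ, m1, m2, m3⟩ := hf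
  exact ⟨fun x => μ (θ x), m1.comp hθ, fun x => m2 _, fun x y hxy => m3 _ _ (hθ hxy)⟩

/-- The map x ↦ c + x² is monotone on each half-line, so the variation at most doubles. The majorant
is the increment of μ reflected on the negative side and lifted by V, so that it stays in [0, 2V].
-/
theorem comp_const_add_sq (hf : VariationLE V f) (c : ℝ) :
    VariationLE (2 * V) (fun x => f (c + x ^ 2)) := by
  have hV := hf.nonneg
  obtain ⟨μ, m1, m2, m3⟩ := hf
  set M : ℝ → ℝ := fun x => if 0 ≤ x then V + (μ (c + x ^ 2) - μ c)
    else V - (μ (c + x ^ 2) - μ c) with hM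
  have hinc : ∀ x, μ c ≤ μ (c + x ^ 2) := fun x => m1 (by nlinarith [sq_nonneg x])
  have key : ∀ x y, x ≤ y → |f (c + y ^ 2) - f (c + x ^ 2)| ≤ M y - M x := by
    intro x y hxy
    simp only [hM]
    by_cases hx : 0 ≤ x
    · rw [if_pos hx, if_pos (hx.trans hxy)]
      have := m3 (c + x ^ 2) (c + y ^ 2) (by nlinarith)
      linarith
    · push Not at hx
      rw [if_neg hx.not_ge]
      by_cases hy : 0 ≤ y
      · rw [if_pos hy]
        have h1 := m3 c (c + x ^ 2) (by nlinarith [sq_nonneg x])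
        have h2 := m3 c (c + y ^ 2) (by nlinarith [sq_nonneg y])
        have h3 : |f (c + y ^ 2) - f (c + x ^ 2)| ≤
            |f (c + y ^ 2) - f c| + |f (c + x ^ 2) - f c| := by
          rw [abs_sub_comm (f (c + x ^ 2)) (f c)]
          exact abs_sub_le _ _ _
        linarith
      · push Not at hy
        rw [if_neg hy.not_ge]
        have := m3 (c + y ^ 2) (c + x ^ 2) (by nlinarith)
        rw [abs_sub_comm] at this
        linarith
  refine ⟨M, fun x y hxy => by linarith [key x y hxy, abs_nonneg (f (c + y ^ 2) - f (c + x ^ 2))],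
    fun x => ?_, key⟩
  simp only [hM]
  have := m2 c
  have := m2 (c + x ^ 2)
  have := hinc x
  split_ifs <;> constructor <;> linarith

/-- Outside [−L, L] the function is constant, so it factors through the clamping map p onto this
interval; the Lipschitz bound there makes A (p + L) a majorant. -/
theorem of_hasDerivAt {f' : ℝ → ℝ} {L : ℝ} (hL : 0 ≤ L) (hd : ∀ x, HasDerivAt f (f' x) x)
    (hA : ∀ x, |f' x| ≤ A) (hsupp : ∀ x, L ≤ |x| → f' x = 0) : VariationLE (2 * L * A) f := by
  have hA0 : 0 ≤ A := (abs_nonneg _).trans (hA 0)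
  have hlip : ∀ x y, |f y - f x| ≤ A * |y - x| := fun x y => by
    have := Convex.norm_image_sub_le_of_norm_hasDerivWithin_le (f := f) (f' := f') (C := A)
      (s := Set.univ) (x := x) (y := y) (fun x _ => (hd x).hasDerivWithinAt) (fun x _ => hA x)
      convex_univ trivial trivial
    simpa [Real.norm_eq_abs] using this
  set p : ℝ → ℝ := fun x => max (-L) (min x L) with hp
  have hconst : ∀ x, f x = f (p x) := by
    intro x
    by_cases h1 : L ≤ x
    · have : p x = L := by simp [hp, h1]; linarith
      rw [this]
      have := Convex.norm_image_sub_le_of_norm_hasDerivWithin_le (f := f) (f' := f') (C := 0)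
        (s := Set.Ici L) (x := L) (y := x) (fun x _ => (hd x).hasDerivWithinAt)
        (fun x hx => by rw [hsupp x (hx.trans (le_abs_self x))]; simp) (convex_Ici L)
        Set.self_mem_Ici h1
      simpa [sub_eq_zero] using this
    · by_cases h2 : x ≤ -L
      · have : p x = -L := by
          simp only [hp, max_eq_left_iff, min_le_iff]; exact Or.inl h2
        rw [this]
        have := Convex.norm_image_sub_le_of_norm_hasDerivWithin_le (f := f) (f' := f') (C := 0)
          (s := Set.Iic (-L)) (x := -L) (y := x) (fun x _ => (hd x).hasDerivWithinAt)
          (fun x hx => by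
            rw [hsupp x ((le_neg.mpr hx).trans (neg_le_abs x))]; simp) (convex_Iic _)
          Set.self_mem_Iic h2
        simpa [sub_eq_zero] using this
      · push Not at h1 h2
        have : p x = x := by
          simp only [hp]; rw [min_eq_left h1.le, max_eq_right h2.le]
        rw [this]
  have hpm : Monotone p := fun x y hxy => max_le_max le_rfl (min_le_min hxy le_rfl)
  have hp1 : ∀ x, -L ≤ p x := fun x => le_max_left _ _
  have hp2 : ∀ x, p x ≤ L := fun x => max_le (by linarith) (min_le_right _ _)
  refine ⟨fun x => A * (p x + L), fun x y hxy => ?_, fun x => ⟨?_, ?_⟩, fun x y hxy => ?_⟩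
  · have := hpm hxy
    simp only
    gcongr
  · exact mul_nonneg hA0 (by linarith [hp1 x])
  · nlinarith [hp2 x]
  · rw [hconst x, hconst y]
    have := hlip (p x) (p y)
    rw [abs_of_nonneg (sub_nonneg.mpr (hpm hxy))] at this
    linarith

theorem of_eVariationOn (h : eVariationOn f Set.univ ≠ ∞) :
    VariationLE (eVariationOn f Set.univ).toReal f := by
  have hfin : ∀ s, eVariationOn f s ≠ ∞ := fun s =>
    ne_top_of_le_ne_top h (eVariationOn.mono f (Set.subset_univ s))
  have hmono : Monotone fun x => (eVariationOn f (Set.Iic x)).toReal := fun x y hxy =>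
    ENNReal.toReal_mono (hfin _) (eVariationOn.mono f (Set.Iic_subset_Iic.mpr hxy))
  refine ⟨fun x => (eVariationOn f (Set.Iic x)).toReal, hmono,
    fun x => ⟨ENNReal.toReal_nonneg, ENNReal.toReal_mono h (eVariationOn.mono f
      (Set.subset_univ _))⟩, fun x y hxy => ?_⟩
  have h1 : eVariationOn f (Set.Iic x) + eVariationOn f (Set.Icc x y) =
      eVariationOn f (Set.Iic y) := by
    rw [← eVariationOn.union f (x := x) isGreatest_Iic (isLeast_Icc hxy),
      Set.Iic_union_Icc_eq_Iic hxy]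
  have h2 : edist (f y) (f x) ≤ eVariationOn f (Set.Icc x y) :=
    eVariationOn.edist_le f (Set.right_mem_Icc.mpr hxy) (Set.left_mem_Icc.mpr hxy)
  have h3 : |f y - f x| ≤ (eVariationOn f (Set.Icc x y)).toReal := by
    rw [← Real.dist_eq, dist_edist]
    exact ENNReal.toReal_mono (hfin _) h2
  simp only
  rw [← h1, ENNReal.toReal_add (hfin _) (hfin _)]
  linarith

end VariationLE

/-- `f` is `n` times differentiable, `f` and its derivatives up to order `n` are bounded by `A`
and have variation at most `A`. -/
def SmoothBV : ℕ → ℝ → (ℝ → ℝ) → Prop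
  | 0, A, f => (∀ x, |f x| ≤ A) ∧ VariationLE A f
  | n + 1, A, f => ((∀ x, |f x| ≤ A) ∧ VariationLE A f) ∧
      ∃ f' : ℝ → ℝ, (∀ x, HasDerivAt f (f' x) x) ∧ SmoothBV n A f'

namespace SmoothBV

variable {n : ℕ} {A B : ℝ} {f g : ℝ → ℝ}

theorem base (h : SmoothBV n A f) : (∀ x, |f x| ≤ A) ∧ VariationLE A f := by
  cases n with
  | zero => exact h
  | succ n => exact h.1

theorem abs_le (h : SmoothBV n A f) (x : ℝ) : |f x| ≤ A := h.base.1 x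

theorem nonneg (h : SmoothBV n A f) : 0 ≤ A := (abs_nonneg _).trans (h.abs_le 0)

theorem mono (h : SmoothBV n A f) (hAB : A ≤ B) : SmoothBV n B f := by
  induction n generalizing f with
  | zero => exact ⟨fun x => (h.1 x).trans hAB, h.2.mono hAB⟩
  | succ n ih =>
    obtain ⟨h1, f', h2, h3⟩ := h
    exact ⟨⟨fun x => (h1.1 x).trans hAB, h1.2.mono hAB⟩, f', h2, ih h3⟩

theorem of_succ (h : SmoothBV (n + 1) A f) : SmoothBV n A f := by
  induction n generalizing f with
  | zero => exact h.1
  | succ n ih =>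
    obtain ⟨h1, f', h2, h3⟩ := h
    exact ⟨h1, f', h2, ih h3⟩

theorem add (hf : SmoothBV n A f) (hg : SmoothBV n B g) :
    SmoothBV n (A + B) (fun x => f x + g x) := by
  induction n generalizing f g with
  | zero => exact ⟨fun x => (abs_add_le _ _).trans (add_le_add (hf.1 x) (hg.1 x)), hf.2.add hg.2⟩
  | succ n ih =>
    obtain ⟨h1, f', h2, h3⟩ := hf
    obtain ⟨k1, g', k2, k3⟩ := hg
    exact ⟨⟨fun x => (abs_add_le _ _).trans (add_le_add (h1.1 x) (k1.1 x)), h1.2.add k1.2⟩,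
      fun x => f' x + g' x, fun x => (h2 x).add (k2 x), ih h3 k3⟩

/-- The variation of a product costs a factor 2, and each derivative doubles the number of Leibniz
terms. -/
theorem mul (hf : SmoothBV n A f) (hg : SmoothBV n B g) :
    SmoothBV n (2 ^ (n + 1) * (A * B)) (fun x => f x * g x) := by
  have hA := hf.nonneg
  have hB := hg.nonneg
  have hAB := mul_nonneg hA hB
  have hbase : ∀ m : ℕ, (∀ x, |f x * g x| ≤ 2 ^ (m + 1) * (A * B)) ∧
      VariationLE (2 ^ (m + 1) * (A * B)) (fun x => f x * g x) := by
    intro m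
    have h2 : (2 : ℝ) ≤ 2 ^ (m + 1) := by
      rw [pow_succ]; linarith [one_le_pow₀ (M₀ := ℝ) (n := m) one_le_two]
    refine ⟨fun x => ?_, (hf.base.2.mul hg.base.2 hf.abs_le hg.abs_le).mono (by nlinarith)⟩
    rw [abs_mul]
    have := mul_le_mul (hf.abs_le x) (hg.abs_le x) (abs_nonneg _) hA
    nlinarith
  induction n generalizing f g with
  | zero => exact hbase 0
  | succ n ih =>
    refine ⟨hbase (n + 1), ?_⟩
    have hf0 := hf.of_succ
    have hg0 := hg.of_succ
    obtain ⟨h1, f', h2, h3⟩ := hf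
    obtain ⟨k1, g', k2, k3⟩ := hg
    refine ⟨fun x => f' x * g x + f x * g' x, fun x => (h2 x).mul (k2 x), ?_⟩
    have key : ∀ {u v : ℝ → ℝ}, SmoothBV n A u → SmoothBV n B v →
        SmoothBV n (2 ^ (n + 1) * (A * B)) (fun x => u x * v x) := by
      intro u v hu hv
      refine ih hu hv fun m => ?_
      have h2 : (2 : ℝ) ≤ 2 ^ (m + 1) := by
        rw [pow_succ]; linarith [one_le_pow₀ (M₀ := ℝ) (n := m) one_le_two]
      refine ⟨fun x => ?_, (hu.base.2.mul hv.base.2 hu.abs_le hv.abs_le).mono (by nlinarith)⟩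
      rw [abs_mul]
      have := mul_le_mul (hu.abs_le x) (hv.abs_le x) (abs_nonneg _) hA
      nlinarith
    have := (key h3 hg0).add (key hf0 k3)
    convert this using 1
    ring

theorem comp_add_const (hf : SmoothBV n A f) (a : ℝ) : SmoothBV n A (fun x => f (x + a)) := by
  have hm : Monotone fun x : ℝ => x + a := fun x y h => by simpa using h
  induction n generalizing f with
  | zero => exact ⟨fun x => hf.1 _, hf.2.comp_monotone hm⟩
  | succ n ih =>
    obtain ⟨h1, f', h2, h3⟩ := hf
    exact ⟨⟨fun x => h1.1 _, h1.2.comp_monotone hm⟩, fun x => f' (x + a),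
      fun x => (h2 (x + a)).comp_add_const x a, ih h3⟩

/-- Composition with a family of maps `θ c`, whose derivatives agree with `κ` wherever this matters
for the class of functions `P`. -/
theorem exists_comp {ι : Type*} {θ : ι → ℝ → ℝ} {κ : ℝ → ℝ} {P : (ℝ → ℝ) → Prop}
    (hP : ∀ φ φ' : ℝ → ℝ, P φ → (∀ x, HasDerivAt φ (φ' x) x) → P φ')
    (hκ : ∀ n, ∃ K, SmoothBV n K κ)
    (hV : ∀ c V φ, VariationLE V φ → VariationLE (2 * V) (fun x => φ (θ c x)))
    (hd : ∀ c (φ φ' : ℝ → ℝ), P φ → (∀ x, HasDerivAt φ (φ' x) x) →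
      ∀ x, HasDerivAt (fun x => φ (θ c x)) (φ' (θ c x) * κ x) x) (n : ℕ) (A : ℝ) :
    ∃ B, ∀ c φ, P φ → SmoothBV n A φ → SmoothBV n B (fun x => φ (θ c x)) := by
  have hbase : ∀ n c φ, SmoothBV n A φ → (∀ x, |φ (θ c x)| ≤ 2 * A) ∧
      VariationLE (2 * A) (fun x => φ (θ c x)) := fun n c φ h =>
    ⟨fun x => (h.abs_le _).trans (by linarith [h.nonneg]), hV c A φ h.base.2⟩
  induction n with
  | zero => exact ⟨2 * A, fun c φ _ h => hbase 0 c φ h⟩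
  | succ n ih =>
    obtain ⟨B, hB⟩ := ih
    obtain ⟨K, hK⟩ := hκ n
    -- The derivative of the composition is (φ' ∘ θ c) · κ: the first factor is covered by the
    -- induction, the second does not depend on c, so the bound is uniform in c.
    refine ⟨max (2 * A) (2 ^ (n + 1) * (B * K)), fun c φ hφ h => ?_⟩
    have h0 := hbase _ c φ h
    obtain ⟨h1, φ', h2, h3⟩ := h
    exact ⟨⟨fun x => (h0.1 x).trans (le_max_left _ _), h0.2.mono (le_max_left _ _)⟩,
      _, hd c φ φ' hφ h2, ((hB c φ' (hP φ φ' hφ h2) h3).mul hK).mono (le_max_right _ _)⟩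

end SmoothBV

/-! ### Cutoff profiles and their composition with squares and square roots -/

/-- `f` is constant on `(-∞, -L)` and vanishes on `(L, ∞)`. -/
def EventuallyConstant (L : ℝ) (f : ℝ → ℝ) : Prop :=
  (∃ a, ∀ x < -L, f x = a) ∧ ∀ x > L, f x = 0

theorem EventuallyConstant.deriv_eq_zero {L : ℝ} {f f' : ℝ → ℝ} (h : EventuallyConstant L f)
    (hd : ∀ x, HasDerivAt f (f' x) x) {x : ℝ} (hx : L < |x|) : f' x = 0 := by
  obtain ⟨⟨a, ha⟩, h0⟩ := h
  rcases lt_abs.mp hx with hx | hx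
  · refine (hd x).unique (HasDerivAt.congr_of_eventuallyEq (hasDerivAt_const x (0 : ℝ)) ?_)
    filter_upwards [lt_mem_nhds hx] with y hy using h0 y hy
  · refine (hd x).unique (HasDerivAt.congr_of_eventuallyEq (hasDerivAt_const x a) ?_)
    filter_upwards [gt_mem_nhds (show x < -L by linarith)] with y hy using ha y hy

theorem EventuallyConstant.deriv {L : ℝ} {f f' : ℝ → ℝ} (h : EventuallyConstant L f)
    (hd : ∀ x, HasDerivAt f (f' x) x) : EventuallyConstant L f' :=
  ⟨⟨0, fun _ hx => h.deriv_eq_zero hd (lt_abs.mpr (Or.inr (by linarith)))⟩,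
    fun _ hx => h.deriv_eq_zero hd (lt_abs.mpr (Or.inl hx))⟩

theorem EventuallyConstant.exists_bound {L : ℝ} {f : ℝ → ℝ} (h : EventuallyConstant L f)
    (hf : Continuous f) : ∃ A, ∀ x, |f x| ≤ A := by
  obtain ⟨⟨a, ha⟩, h0⟩ := h
  obtain ⟨C, hC⟩ := (isCompact_Icc (a := -L) (b := L)).exists_bound_of_continuousOn hf.continuousOn
  refine ⟨max C |a|, fun x => ?_⟩
  by_cases h1 : x < -L
  · rw [ha x h1]; exact le_max_right _ _
  · by_cases h2 : L < x
    · rw [h0 x h2, abs_zero]; exact (abs_nonneg a).trans (le_max_right _ _)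
    · push Not at h1 h2
      exact (hC x ⟨h1, h2⟩).trans (le_max_left _ _)

theorem EventuallyConstant.exists_bound_variation {L : ℝ} {f : ℝ → ℝ}
    (h : EventuallyConstant L f) (hf : ContDiff ℝ 1 f) :
    ∃ A, (∀ x, |f x| ≤ A) ∧ VariationLE A f := by
  obtain ⟨A, hA⟩ := h.exists_bound hf.continuous
  have hd : ∀ x, HasDerivAt f (_root_.deriv f x) x := fun x =>
    (hf.differentiable one_ne_zero x).hasDerivAt
  obtain ⟨B, hB⟩ := (h.deriv hd).exists_bound (hf.continuous_deriv le_rfl)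
  have hV := VariationLE.of_hasDerivAt (L := |L| + 1) (by positivity) hd hB
    (fun x hx => h.deriv_eq_zero hd (by linarith [le_abs_self L]))
  exact ⟨max A _, fun x => (hA x).trans (le_max_left _ _), hV.mono (le_max_right _ _)⟩

/-- Below the top order every derivative is C¹ and constant near ±∞, hence bounded and of bounded
variation for free; only the top derivative needs an assumption. -/
theorem exists_smoothBV {n : ℕ} {L V : ℝ} {f : ℝ → ℝ} (h : EventuallyConstant L f)
    (hf : ContDiff ℝ n f) (hV : VariationLE V (iteratedDeriv n f)) : ∃ A, SmoothBV n A f := by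
  induction n generalizing f with
  | zero =>
    obtain ⟨A, hA⟩ := h.exists_bound hf.continuous
    rw [iteratedDeriv_zero] at hV
    exact ⟨max A V, fun x => (hA x).trans (le_max_left _ _), hV.mono (le_max_right _ _)⟩
  | succ n ih =>
    have hf1 : ContDiff ℝ 1 f := hf.of_le (by exact_mod_cast Nat.le_add_left 1 n)
    have hd : ∀ x, HasDerivAt f (deriv f x) x := fun x =>
      (hf1.differentiable one_ne_zero x).hasDerivAt
    obtain ⟨A, hA1, hA2⟩ := h.exists_bound_variation hf1
    rw [iteratedDeriv_succ'] at hV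
    have hf' : ContDiff ℝ n (deriv f) := by
      have : ((n + 1 : ℕ) : WithTop ℕ∞) = (n : WithTop ℕ∞) + 1 := by push_cast; rfl
      rw [this] at hf
      exact (contDiff_succ_iff_deriv.mp hf).2.2
    obtain ⟨B, hB⟩ := ih (h.deriv hd) hf' hV
    exact ⟨max A B, ⟨fun x => (hA1 x).trans (le_max_left _ _), hA2.mono (le_max_left _ _)⟩,
      _, hd, hB.mono (le_max_right _ _)⟩

theorem exists_smoothBV_of_contDiff_succ {n : ℕ} {L : ℝ} {f : ℝ → ℝ}
    (h : EventuallyConstant L f) (hf : ContDiff ℝ (n + 1) f) : ∃ A, SmoothBV n A f := by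
  have hf1 : ContDiff ℝ 1 f := hf.of_le (by exact_mod_cast Nat.le_add_left 1 n)
  obtain ⟨A, hA1, hA2⟩ := h.exists_bound_variation hf1
  induction n generalizing f A with
  | zero => exact ⟨A, hA1, hA2⟩
  | succ n ih =>
    have hd : ∀ x, HasDerivAt f (deriv f x) x := fun x =>
      (hf1.differentiable one_ne_zero x).hasDerivAt
    have hf' : ContDiff ℝ (n + 1) (deriv f) := by
      have : ((n + 1 : ℕ) : WithTop ℕ∞) + 1 = ((n : WithTop ℕ∞) + 1) + 1 := by push_cast; rfl
      rw [this] at hf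
      exact (contDiff_succ_iff_deriv.mp hf).2.2
    have hf'1 : ContDiff ℝ 1 (deriv f) := hf'.of_le (by exact_mod_cast Nat.le_add_left 1 n)
    obtain ⟨A', hA1', hA2'⟩ := (h.deriv hd).exists_bound_variation hf'1
    obtain ⟨B, hB⟩ := ih (h.deriv hd) hf' hf'1 A' hA1' hA2'
    exact ⟨max A B, ⟨fun x => (hA1 x).trans (le_max_left _ _), hA2.mono (le_max_left _ _)⟩,
      _, hd, hB.mono (le_max_right _ _)⟩

/-- `f` is constant on `(-∞, 1/4)` and vanishes on `(4, ∞)`. -/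
def CutoffShape (f : ℝ → ℝ) : Prop := (∃ a, ∀ x < 1 / 4, f x = a) ∧ ∀ x > 4, f x = 0

namespace CutoffShape

variable {f f' : ℝ → ℝ}

theorem eventuallyConstant (h : CutoffShape f) : EventuallyConstant 4 f :=
  ⟨h.1.imp fun _ ha x hx => ha x (by linarith), h.2⟩

theorem deriv_eq_zero_left (h : CutoffShape f) (hd : ∀ x, HasDerivAt f (f' x) x) {x : ℝ}
    (hx : x < 1 / 4) : f' x = 0 := by
  obtain ⟨⟨a, ha⟩, -⟩ := h
  refine (hd x).unique (HasDerivAt.congr_of_eventuallyEq (hasDerivAt_const x a) ?_)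
  filter_upwards [gt_mem_nhds hx] with y hy using ha y hy

theorem deriv_eq_zero_right (h : CutoffShape f) (hd : ∀ x, HasDerivAt f (f' x) x) {x : ℝ}
    (hx : 4 < x) : f' x = 0 :=
  h.eventuallyConstant.deriv_eq_zero hd (lt_abs.mpr (Or.inl hx))

theorem deriv (h : CutoffShape f) (hd : ∀ x, HasDerivAt f (f' x) x) : CutoffShape f' :=
  ⟨⟨0, fun _ hx => h.deriv_eq_zero_left hd hx⟩, fun _ hx => h.deriv_eq_zero_right hd hx⟩

end CutoffShape

/-- Uniformity in c is essential: c will be the contribution to ‖k‖²/N² of the coordinates that are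
frozen along a line of frequencies. -/
theorem exists_smoothBV_comp_const_add_sq (n : ℕ) (A : ℝ) :
    ∃ B, ∀ (c : NNReal) φ, CutoffShape φ → SmoothBV n A φ →
      SmoothBV n B (fun x => φ ((c : ℝ) + x ^ 2)) := by
  -- The unbounded inner derivative 2x is truncated to 2x χ(x). This changes nothing, since for |x|
  -- > 2 the argument c + x² exceeds 4, where φ vanishes.
  let χ : ContDiffBump (0 : ℝ) := ⟨2, 3, by norm_num, by norm_num⟩
  have hχ1 : ∀ x : ℝ, |x| ≤ 2 → χ x = 1 := fun x hx =>
    χ.one_of_mem_closedBall (by simpa [Real.norm_eq_abs] using hx)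
  have hχ0 : ∀ x : ℝ, 3 ≤ |x| → χ x = 0 := fun x hx =>
    χ.zero_of_le_dist (by simpa [Real.norm_eq_abs] using hx)
  refine SmoothBV.exists_comp (θ := fun (c : NNReal) x => (c : ℝ) + x ^ 2)
    (κ := fun x => 2 * x * χ x) (P := CutoffShape) (fun φ φ' h hd => h.deriv hd) (fun n => ?_)
    (fun c V φ h => h.comp_const_add_sq c) (fun c φ φ' hφ hd x => ?_) n A
  · refine exists_smoothBV_of_contDiff_succ (L := 3) ⟨⟨0, fun x hx => ?_⟩, fun x hx => ?_⟩ ?_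
    · simp only [hχ0 x (le_abs.mpr (Or.inr (by linarith))), mul_zero]
    · simp only [hχ0 x (le_abs.mpr (Or.inl hx.le)), mul_zero]
    · exact (contDiff_const.mul contDiff_id).mul χ.contDiff
  · by_cases hx : |x| ≤ 2
    · have h1 : HasDerivAt (fun x : ℝ => (c : ℝ) + x ^ 2) (2 * x) x := by
        simpa using (hasDerivAt_pow 2 x).const_add (c : ℝ)
      have := (hd _).comp x h1
      rw [hχ1 x hx, mul_one]
      exact this
    · push Not at hx
      have h4 : ∀ y : ℝ, 2 < |y| → 4 < (c : ℝ) + y ^ 2 := fun y hy => by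
        have := c.coe_nonneg
        rw [← sq_abs]; nlinarith
      rw [hφ.deriv_eq_zero_right hd (h4 x hx), zero_mul]
      refine HasDerivAt.congr_of_eventuallyEq (hasDerivAt_const x (0 : ℝ)) ?_
      filter_upwards [continuous_abs.tendsto x |>.eventually (lt_mem_nhds hx)] with y hy
      exact hφ.2 _ (h4 y hy)

/-- Functions that are smooth on `(0, ∞)` can be modified off `[1/16, 16]` to be smooth and
compactly supported. -/
theorem exists_contDiff_eqOn {F : ℝ → ℝ} {n : ℕ∞} (hF : ∀ x, 0 < x → ContDiffAt ℝ n F x) :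
    ∃ κ : ℝ → ℝ, ContDiff ℝ n κ ∧ EventuallyConstant 17 κ ∧
      ∀ x, 1 / 16 ≤ x → x ≤ 16 → κ x = F x := by
  let χ : ContDiffBump (8 + 1 / 32 : ℝ) := ⟨8 - 1 / 32, 8, by norm_num, by norm_num⟩
  have hχ0 : ∀ x : ℝ, 8 ≤ |x - (8 + 1 / 32)| → χ x = 0 := fun x hx =>
    χ.zero_of_le_dist (by simpa [Real.dist_eq] using hx)
  have hχ1 : ∀ x : ℝ, 1 / 16 ≤ x → x ≤ 16 → χ x = 1 := fun x h1 h2 =>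
    χ.one_of_mem_closedBall (by
      rw [Metric.mem_closedBall, Real.dist_eq, abs_le]
      constructor
      · change -(8 - 1 / 32 : ℝ) ≤ _; linarith
      · change _ ≤ (8 - 1 / 32 : ℝ); linarith)
  refine ⟨fun x => χ x * F x, contDiff_iff_contDiffAt.mpr fun x => ?_,
    ⟨⟨0, fun x hx => ?_⟩, fun x hx => ?_⟩, fun x h1 h2 => by simp only [hχ1 x h1 h2, one_mul]⟩
  · by_cases hx : 0 < x
    · exact χ.contDiff.contDiffAt.mul (hF x hx)
    · refine (contDiffAt_const (c := (0 : ℝ))).congr_of_eventuallyEq ?_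
      filter_upwards [gt_mem_nhds (show x < 1 / 32 by linarith)] with y hy
      rw [hχ0 y (le_abs.mpr (Or.inr (by linarith))), zero_mul]
  · simp only [hχ0 x (le_abs.mpr (Or.inr (by linarith))), zero_mul]
  · simp only [hχ0 x (le_abs.mpr (Or.inl (by linarith))), zero_mul]

/-- The singularity of the square root at 0 is harmless because φ is constant below 1/4. Its
derivative matters only on [1/16, 16], the preimage of [1/4, 4], where it is replaced by a smooth
compactly supported κ. -/
theorem exists_smoothBV_comp_sqrt (n : ℕ) (A : ℝ) :
    ∃ B, ∀ φ, CutoffShape φ → SmoothBV n A φ → SmoothBV n B (fun x => φ (√x)) := by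
  obtain ⟨κ, hκ1, hκ2, hκ3⟩ := exists_contDiff_eqOn (F := fun x => 1 / (2 * √x)) (n := ⊤)
    (fun x hx => contDiffAt_const.div (contDiffAt_const.mul (Real.contDiffAt_sqrt hx.ne'))
      (by positivity))
  have hder : ∀ φ φ' : ℝ → ℝ, CutoffShape φ → (∀ x, HasDerivAt φ (φ' x) x) →
      ∀ x, HasDerivAt (fun x => φ (√x)) (φ' (√x) * κ x) x := by
    intro φ φ' hφ hd x
    have e1 : √(1 / 16 : ℝ) = 1 / 4 := by
      rw [show (1 / 16 : ℝ) = (1 / 4) ^ 2 by norm_num, Real.sqrt_sq (by norm_num)]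
    have e2 : √(16 : ℝ) = 4 := by
      rw [show (16 : ℝ) = 4 ^ 2 by norm_num, Real.sqrt_sq (by norm_num)]
    by_cases h1 : x < 1 / 16
    · have hs : ∀ y : ℝ, y < 1 / 16 → √y < 1 / 4 := fun y hy => by
        rw [← e1]; exact (Real.sqrt_lt_sqrt_iff_of_pos (by norm_num)).mpr hy
      rw [hφ.deriv_eq_zero_left hd (hs x h1), zero_mul]
      obtain ⟨a, ha⟩ := hφ.1
      refine HasDerivAt.congr_of_eventuallyEq (hasDerivAt_const x a) ?_
      filter_upwards [gt_mem_nhds h1] with y hy using ha _ (hs y hy)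
    · push Not at h1
      by_cases h2 : x ≤ 16
      · rw [hκ3 x h1 h2]
        exact (hd _).comp x (Real.hasDerivAt_sqrt (by linarith))
      · push Not at h2
        have hs : ∀ y : ℝ, 16 < y → 4 < √y := fun y hy => by
          rw [← e2]; exact Real.sqrt_lt_sqrt (by norm_num) hy
        rw [hφ.deriv_eq_zero_right hd (hs x h2), zero_mul]
        refine HasDerivAt.congr_of_eventuallyEq (hasDerivAt_const x (0 : ℝ)) ?_
        filter_upwards [lt_mem_nhds h2] with y hy using hφ.2 _ (hs y hy)
  obtain ⟨B, hB⟩ := SmoothBV.exists_comp (θ := fun (_ : Unit) x => √x)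
    (κ := κ) (P := CutoffShape) (fun φ φ' h hd => h.deriv hd)
    (fun n => exists_smoothBV_of_contDiff_succ hκ2 (hκ1.of_le (by exact_mod_cast le_top)))
    (fun c V φ h => (h.comp_monotone Real.sqrt_monotone).mono (by linarith [h.nonneg]))
    (fun _ => hder) n A
  exact ⟨B, fun φ => hB () φ⟩

/-! ### Finite differences of smooth functions -/

theorem hasDerivAt_fwdDiff_iter {f f' : ℝ → ℝ} (hd : ∀ x, HasDerivAt f (f' x) x) (δ : ℝ) (n : ℕ)
    (x : ℝ) : HasDerivAt ((fwdDiff δ)^[n] f) ((fwdDiff δ)^[n] f' x) x := by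
  induction n generalizing x with
  | zero => exact hd x
  | succ n ih =>
    rw [Function.iterate_succ_apply', Function.iterate_succ_apply']
    exact ((ih (x + δ)).comp_add_const x δ).sub (ih x)

theorem exists_fwdDiff_eq_mul {F F' : ℝ → ℝ} (hd : ∀ x, HasDerivAt F (F' x) x) {δ : ℝ}
    (hδ : 0 ≤ δ) (t : ℝ) : ∃ ξ, t ≤ ξ ∧ ξ ≤ t + δ ∧ fwdDiff δ F t = δ * F' ξ := by
  rcases hδ.eq_or_lt with rfl | hδ
  · exact ⟨t, le_rfl, by simp, by simp [fwdDiff]⟩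
  · obtain ⟨ξ, hξ, h⟩ := exists_hasDerivAt_eq_slope F F' (show t < t + δ by linarith)
      (fun x _ => (hd x).continuousAt.continuousWithinAt) (fun x _ => hd x)
    refine ⟨ξ, hξ.1.le, hξ.2.le, ?_⟩
    rw [h, fwdDiff, add_sub_cancel_left, mul_div_cancel₀ _ hδ.ne']

namespace SmoothBV

variable {n : ℕ} {A : ℝ} {f : ℝ → ℝ}

theorem abs_fwdDiff_iter_le (hf : SmoothBV n A f) {δ : ℝ} (hδ : 0 ≤ δ) (t : ℝ) :
    |(fwdDiff δ)^[n] f t| ≤ δ ^ n * A := by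
  induction n generalizing f t with
  | zero => simpa using hf.abs_le t
  | succ n ih =>
    obtain ⟨-, f', h2, h3⟩ := hf
    rw [Function.iterate_succ_apply']
    obtain ⟨ξ, -, -, h⟩ := exists_fwdDiff_eq_mul (hasDerivAt_fwdDiff_iter h2 δ n) hδ t
    rw [h, abs_mul, abs_of_nonneg hδ, pow_succ', mul_assoc]
    exact mul_le_mul_of_nonneg_left (ih h3 ξ) hδ

/-- The mean value theorem is applied n times, and the last difference is charged to a monotone
majorant of the n-th derivative. One μ serves all t and δ, so that sums over t can later telescope.
-/
theorem exists_monotone_fwdDiff_le (hf : SmoothBV n A f) :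
    ∃ μ : ℝ → ℝ, Monotone μ ∧ (∀ x, 0 ≤ μ x ∧ μ x ≤ A) ∧ ∀ δ, 0 ≤ δ → ∀ t,
      |(fwdDiff δ)^[n + 1] f t| ≤ δ ^ n * (μ (t + (n + 1) * δ) - μ t) := by
  induction n generalizing f with
  | zero =>
    obtain ⟨-, μ, m1, m2, m3⟩ := hf
    refine ⟨μ, m1, m2, fun δ hδ t => ?_⟩
    simpa [fwdDiff] using m3 t (t + δ) (by linarith)
  | succ n ih =>
    obtain ⟨-, f', h2, h3⟩ := hf
    obtain ⟨μ, m1, m2, m3⟩ := ih h3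
    refine ⟨μ, m1, m2, fun δ hδ t => ?_⟩
    rw [Function.iterate_succ_apply']
    obtain ⟨ξ, x1, x2, h⟩ := exists_fwdDiff_eq_mul (hasDerivAt_fwdDiff_iter h2 δ (n + 1)) hδ t
    rw [h, abs_mul, abs_of_nonneg hδ, pow_succ', mul_assoc]
    refine mul_le_mul_of_nonneg_left ((m3 δ hδ ξ).trans ?_) hδ
    refine mul_le_mul_of_nonneg_left ?_ (pow_nonneg hδ n)
    have e1 : μ t ≤ μ ξ := m1 x1
    have e2 : μ (ξ + (n + 1) * δ) ≤ μ (t + ((n + 1 : ℕ) + 1) * δ) := m1 (by push_cast; linarith)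
    linarith

end SmoothBV

/-! ### Localization weights and separated points -/

namespace Torus

variable {q : ℕ}

instance : (volume : Measure (Torus q)).IsNegInvariant :=
  Measure.IsAddHaarMeasure.isNegInvariant_of_regular _

/-- The chord has length 2|sin(nθ/2)| for a representative θ with |θ| = ‖x‖; Jordan's inequality
bounds the sine from below. -/
theorem norm_fourier_sub_one_ge (n : ℤ) (x : AddCircle (2 * Real.pi))
    (h : |(n : ℝ)| * ‖x‖ ≤ Real.pi) : 2 / Real.pi * (|(n : ℝ)| * ‖x‖) ≤ ‖fourier n x - 1‖ := by
  obtain ⟨θ, hθ, rfl⟩ : ∃ θ : ℝ, ‖x‖ = |θ| ∧ (θ : AddCircle (2 * Real.pi)) = x := by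
    obtain ⟨θ, hθ⟩ := QuotientAddGroup.mk_surjective x
    refine ⟨θ - round ((2 * Real.pi)⁻¹ * θ) * (2 * Real.pi), ?_, ?_⟩
    · rw [← hθ]
      exact AddCircle.norm_eq _
    · rw [← hθ, AddCircle.coe_sub]
      have : ((round ((2 * Real.pi)⁻¹ * θ) * (2 * Real.pi) : ℝ) : AddCircle (2 * Real.pi)) = 0 := by
        rw [AddCircle.coe_eq_zero_iff]
        exact ⟨round ((2 * Real.pi)⁻¹ * θ), by simp⟩
      rw [this, sub_zero]
  rw [hθ] at h ⊢
  have e : fourier n (θ : AddCircle (2 * Real.pi)) = Complex.exp (Complex.I * ((n * θ : ℝ) : ℂ)) := by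
    rw [fourier_coe_apply]
    congr 1
    have hpi : (Real.pi : ℂ) ≠ 0 := by exact_mod_cast Real.pi_ne_zero
    push_cast
    field_simp
  rw [e, Complex.norm_exp_I_mul_ofReal_sub_one, norm_mul, Real.norm_eq_abs, Real.norm_eq_abs,
    abs_of_pos (two_pos : (0 : ℝ) < 2), ← abs_mul]
  rw [← abs_mul] at h
  have := Real.mul_abs_le_abs_sin (x := n * θ / 2) (by rw [abs_div, abs_two]; linarith)
  rw [abs_div, abs_two] at this
  linarith

/-- The weight `(1 + t ‖x‖)^{-(q+1)}`. -/
noncomputable def decayWeight (t : ℝ) (x : Torus q) : ℝ := ((1 + t * ‖x‖) ^ (q + 1))⁻¹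

theorem decayWeight_nonneg {t : ℝ} (ht : 0 ≤ t) (x : Torus q) : 0 ≤ decayWeight t x := by
  unfold decayWeight; positivity

theorem continuous_decayWeight {t : ℝ} (ht : 0 ≤ t) : Continuous (decayWeight t (q := q)) := by
  unfold decayWeight
  refine Continuous.inv₀ (by fun_prop) fun x => ?_
  positivity

theorem decayWeight_neg (t : ℝ) (x : Torus q) : decayWeight t (-x) = decayWeight t x := by
  simp [decayWeight]

theorem volume_closedBall_le (x : Torus q) {r : ℝ} (hr : 0 ≤ r) :
    volume (Metric.closedBall x r) ≤ ENNReal.ofReal ((2 * r) ^ q) := by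
  rw [closedBall_pi _ hr, volume_pi_pi]
  simp_rw [AddCircle.volume_closedBall]
  rw [ENNReal.ofReal_pow (by positivity)]
  calc ∏ _i : Fin q, ENNReal.ofReal (min (2 * Real.pi) (2 * r))
      ≤ ∏ _i : Fin q, ENNReal.ofReal (2 * r) :=
        Finset.prod_le_prod' fun i _ => ENNReal.ofReal_le_ofReal (min_le_right _ _)
    _ = _ := by simp

theorem volume_closedBall_eq (x : Torus q) {r : ℝ} (hr : 0 ≤ r) (hr' : r ≤ Real.pi) :
    volume (Metric.closedBall x r) = ENNReal.ofReal ((2 * r) ^ q) := by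
  rw [closedBall_pi _ hr, volume_pi_pi]
  simp_rw [AddCircle.volume_closedBall, min_eq_right (show 2 * r ≤ 2 * Real.pi by linarith)]
  rw [ENNReal.ofReal_pow (by positivity)]
  simp

/-- Dyadic layers: a ball of radius 2^(i+1)/t carries weight 2^(−i(q+1)) and has volume at most 4^q
2^(iq) t^(−q). The exponent q + 1 leaves a geometric series with sum 2. -/
theorem lintegral_decayWeight_le {t : ℝ} (ht : 0 < t) :
    ∫⁻ x : Torus q, ENNReal.ofReal (decayWeight t x) ≤
      ENNReal.ofReal (2 * 4 ^ q * (t ^ q)⁻¹) := by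
  have hpt : ∀ x : Torus q, ENNReal.ofReal (decayWeight t x) ≤
      ∑' i : ℕ, ENNReal.ofReal (((2 : ℝ) ^ (i * (q + 1)))⁻¹) *
        (Metric.closedBall (0 : Torus q) (2 ^ (i + 1) / t)).indicator 1 x := by
    intro x
    have hex : ∃ i : ℕ, t * ‖x‖ ≤ 2 ^ (i + 1) := by
      obtain ⟨i, hi⟩ := pow_unbounded_of_one_lt (t * ‖x‖) (one_lt_two (α := ℝ))
      exact ⟨i, hi.le.trans (pow_le_pow_right₀ one_le_two (Nat.le_succ i))⟩
    classical
    set i := Nat.find hex with hi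
    have h1 : t * ‖x‖ ≤ 2 ^ (i + 1) := Nat.find_spec hex
    refine le_trans ?_ (ENNReal.le_tsum i)
    have hx : x ∈ Metric.closedBall (0 : Torus q) (2 ^ (i + 1) / t) := by
      rw [mem_closedBall_zero_iff, le_div_iff₀ ht, mul_comm]; exact h1
    rw [Set.indicator_of_mem hx, Pi.one_apply, mul_one]
    refine ENNReal.ofReal_le_ofReal ?_
    unfold decayWeight
    rw [pow_mul]
    refine inv_anti₀ (by positivity) (pow_le_pow_left₀ (by positivity) ?_ _)
    rcases Nat.eq_zero_or_pos i with h0 | h0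
    · rw [h0, pow_zero]
      have : 0 ≤ t * ‖x‖ := by positivity
      linarith
    · have := Nat.find_min hex (m := i - 1) (by omega)
      rw [Nat.sub_add_cancel h0] at this
      push Not at this
      linarith
  refine (lintegral_mono hpt).trans ?_
  rw [lintegral_tsum fun i => ((measurable_one.indicator
    Metric.isClosed_closedBall.measurableSet).const_mul _).aemeasurable]
  have hterm : ∀ i : ℕ, ∫⁻ x : Torus q, ENNReal.ofReal (((2 : ℝ) ^ (i * (q + 1)))⁻¹) *
        (Metric.closedBall (0 : Torus q) (2 ^ (i + 1) / t)).indicator 1 x ≤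
      ENNReal.ofReal (4 ^ q * (t ^ q)⁻¹ * (1 / 2) ^ i) := by
    intro i
    rw [lintegral_const_mul _ (measurable_one.indicator Metric.isClosed_closedBall.measurableSet),
      lintegral_indicator_one Metric.isClosed_closedBall.measurableSet]
    refine (mul_le_mul_right (volume_closedBall_le _ (by positivity)) _).trans ?_
    rw [← ENNReal.ofReal_mul (by positivity)]
    refine ENNReal.ofReal_le_ofReal (le_of_eq ?_)
    rw [show (4 : ℝ) = 2 * 2 by norm_num, mul_pow, mul_pow, div_pow, ← pow_mul, mul_add, mul_one,
      pow_add, add_mul, pow_add, one_mul, one_div, inv_pow]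
    have : (2 : ℝ) ^ i ≠ 0 := by positivity
    have : (2 : ℝ) ^ (i * q) ≠ 0 := by positivity
    have : t ^ q ≠ 0 := by positivity
    field_simp
  refine (ENNReal.tsum_le_tsum hterm).trans ?_
  rw [← ENNReal.ofReal_tsum_of_nonneg (fun i => by positivity)
    (summable_geometric_two.mul_left _), tsum_mul_left, tsum_geometric_two]
  refine ENNReal.ofReal_le_ofReal (le_of_eq ?_)
  ring

theorem decayWeight_anti {s t : ℝ} (hs : 0 ≤ s) (hst : s ≤ t) (x : Torus q) :
    decayWeight t x ≤ decayWeight s x := by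
  unfold decayWeight
  refine inv_anti₀ (by positivity) (pow_le_pow_left₀ (by positivity) ?_ _)
  gcongr

/-- Points at mutual distance at least `δ` see little of a kernel concentrated at scale `1 / t`. -/
theorem sum_decayWeight_le {M : ℕ} {y : Fin M → Torus q} {δ t : ℝ} (hδ : 0 < δ) (hδ1 : δ ≤ 1)
    (ht : 0 < t) (hy : ∀ j k, j ≠ k → δ ≤ ‖y j - y k‖) (x : Torus q) :
    ∑ j, decayWeight t (x - y j) ≤ 4 * 12 ^ q * (1 + (t * δ)⁻¹) ^ q := by
  -- If tδ ≤ 1, the weight at a node is within a factor 2^(q+1) of its values on the ball of radius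
  -- δ/3 about it. These balls are disjoint, so the sum is dominated by the integral. Larger t
  -- reduces to t = 1/δ, since the weight decreases in t.
  have main : ∀ t : ℝ, 0 < t → t * δ ≤ 1 →
      ∑ j, decayWeight t (x - y j) ≤ 4 * 12 ^ q * ((t * δ)⁻¹) ^ q := by
    intro t ht htδ
    have hdisj : Pairwise (Function.onFun Disjoint fun j => Metric.closedBall (y j) (δ / 3)) := by
      intro j k hjk
      refine Metric.closedBall_disjoint_closedBall ?_
      rw [dist_eq_norm]
      linarith [hy j k hjk]
    have hball : ∀ j, ENNReal.ofReal ((2 * (δ / 3)) ^ q * decayWeight t (x - y j)) ≤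
        ∫⁻ z in Metric.closedBall (y j) (δ / 3),
          ENNReal.ofReal (2 ^ (q + 1) * decayWeight t (x - z)) := by
      intro j
      rw [ENNReal.ofReal_mul (by positivity),
        ← volume_closedBall_eq (y j) (by positivity) (by linarith [Real.pi_gt_three]), mul_comm,
        ← setLIntegral_const]
      refine setLIntegral_mono' Metric.isClosed_closedBall.measurableSet fun z hz => ?_
      refine ENNReal.ofReal_le_ofReal ?_
      unfold decayWeight
      rw [← div_eq_mul_inv, inv_le_comm₀ (by positivity) (by positivity), inv_div,
        div_le_iff₀ (by positivity), ← mul_pow]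
      refine pow_le_pow_left₀ (by positivity) ?_ _
      rw [mem_closedBall_iff_norm] at hz
      have h1 : ‖x - z‖ ≤ ‖x - y j‖ + δ / 3 := by
        calc ‖x - z‖ = ‖(x - y j) - (z - y j)‖ := by congr 1; abel
          _ ≤ _ := (norm_sub_le _ _).trans (by linarith)
      have h2 : t * ‖x - z‖ ≤ t * ‖x - y j‖ + t * δ / 3 := by
        have := mul_le_mul_of_nonneg_left h1 ht.le
        linarith
      have : 0 ≤ t * ‖x - y j‖ := by positivity
      linarith
    have hcont : Measurable fun z : Torus q => ENNReal.ofReal (decayWeight t (x - z)) :=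
      (ENNReal.continuous_ofReal.comp
        ((continuous_decayWeight ht.le).comp (continuous_const.sub continuous_id))).measurable
    have htot : ENNReal.ofReal ((2 * (δ / 3)) ^ q * ∑ j, decayWeight t (x - y j)) ≤
        ENNReal.ofReal (2 ^ (q + 1) * (2 * 4 ^ q * (t ^ q)⁻¹)) := by
      rw [Finset.mul_sum, ENNReal.ofReal_sum_of_nonneg fun j _ =>
        mul_nonneg (by positivity) (decayWeight_nonneg ht.le _)]
      refine (Finset.sum_le_sum fun j _ => hball j).trans ?_
      rw [← tsum_fintype (L := .unconditional _),
        ← lintegral_iUnion (fun j => Metric.isClosed_closedBall.measurableSet) hdisj]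
      refine (setLIntegral_le_lintegral _ _).trans ?_
      simp_rw [ENNReal.ofReal_mul (show (0 : ℝ) ≤ 2 ^ (q + 1) by positivity)]
      rw [lintegral_const_mul _ hcont, lintegral_sub_left_eq_self
        (fun z : Torus q => ENNReal.ofReal (decayWeight t z)) x]
      gcongr
      exact lintegral_decayWeight_le ht
    rw [ENNReal.ofReal_le_ofReal_iff (by positivity)] at htot
    rw [← le_div_iff₀' (by positivity)] at htot
    refine htot.trans (le_of_eq ?_)
    rw [show (12 : ℝ) = 4 * 3 by norm_num, mul_pow 4 3 q, pow_succ, mul_pow 2 (δ / 3),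
      div_pow, inv_pow, mul_pow]
    field_simp
    ring
  have hC : (0 : ℝ) ≤ 4 * 12 ^ q := by positivity
  by_cases h : t * δ ≤ 1
  · refine (main t ht h).trans (mul_le_mul_of_nonneg_left ?_ hC)
    exact pow_le_pow_left₀ (by positivity) (by linarith) _
  · push Not at h
    have h1 : δ⁻¹ ≤ t := by rw [inv_le_iff_one_le_mul₀ hδ]; exact h.le
    have h2 := main δ⁻¹ (by positivity) (by rw [inv_mul_cancel₀ hδ.ne'])
    rw [inv_mul_cancel₀ hδ.ne', inv_one, one_pow, mul_one] at h2
    calc ∑ j, decayWeight t (x - y j) ≤ ∑ j, decayWeight δ⁻¹ (x - y j) :=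
          Finset.sum_le_sum fun j _ => decayWeight_anti (by positivity) h1 _
      _ ≤ 4 * 12 ^ q * 1 := by rw [mul_one]; exact h2
      _ ≤ _ := by
          refine mul_le_mul_of_nonneg_left (one_le_pow₀ ?_) hC
          have : 0 ≤ (t * δ)⁻¹ := by positivity
          linarith

/-- Off the diagonal the distance d is at least δ, hence 1 + d/δ ≤ 2d/δ, and the weight at scale t
is at most (2/(tδ))^(q+1) times the weight at scale 1/δ. This small factor is the source of the
diagonal dominance. -/
theorem sum_decayWeight_offDiag_le {M : ℕ} {y : Fin M → Torus q} {δ t : ℝ} (hδ : 0 < δ)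
    (hδ1 : δ ≤ 1) (ht : 0 < t) (hy : ∀ j k, j ≠ k → δ ≤ ‖y j - y k‖) (i : Fin M) :
    ∑ j, (if j = i then 0 else decayWeight t (y i - y j)) ≤
      (2 / (t * δ)) ^ (q + 1) * (4 * 12 ^ q * 2 ^ q) := by
  have h := sum_decayWeight_le hδ hδ1 (inv_pos.mpr hδ) hy (y i)
  rw [inv_mul_cancel₀ hδ.ne', inv_one, one_add_one_eq_two] at h
  refine le_trans ?_ (mul_le_mul_of_nonneg_left h (by positivity))
  rw [Finset.mul_sum]
  refine Finset.sum_le_sum fun j _ => ?_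
  have h0 : 0 ≤ (2 / (t * δ)) ^ (q + 1) * decayWeight δ⁻¹ (y i - y j) :=
    mul_nonneg (by positivity) (decayWeight_nonneg (by positivity) _)
  split_ifs with hji
  · exact h0
  · have hd := hy i j (Ne.symm hji)
    set d := ‖y i - y j‖ with hd'
    unfold decayWeight
    rw [← hd', ← div_eq_mul_inv, inv_le_comm₀ (by positivity) (by positivity), inv_div,
      div_le_iff₀ (by positivity), ← mul_pow]
    refine pow_le_pow_left₀ (by positivity) ?_ _
    have h1 : 1 ≤ δ⁻¹ * d := by rw [inv_mul_eq_div, one_le_div hδ]; exact hd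
    calc 1 + δ⁻¹ * d ≤ 2 * (δ⁻¹ * d) := by linarith
      _ = (t * d) * (2 / (t * δ)) := by field_simp
      _ ≤ _ := by
        refine mul_le_mul_of_nonneg_right ?_ (by positivity)
        linarith

/-- The norm on the torus is the maximum norm. The factor q is cruder than √q, but only its
dependence on q alone matters. -/
theorem euclDist_le (x y : Torus q) : euclDist x y ≤ q * ‖x - y‖ := by
  unfold euclDist
  refine Real.sqrt_le_iff.mpr ⟨by positivity, ?_⟩
  calc ∑ i, ‖x i - y i‖ ^ 2 ≤ ∑ _i : Fin q, ‖x - y‖ ^ 2 :=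
        Finset.sum_le_sum fun i _ => by
          have := norm_le_pi_norm (x - y) i
          exact pow_le_pow_left₀ (norm_nonneg _) this 2
    _ = q * ‖x - y‖ ^ 2 := by simp
    _ ≤ (q * ‖x - y‖) ^ 2 := by
      rw [mul_pow]
      refine mul_le_mul_of_nonneg_right ?_ (by positivity)
      exact_mod_cast Nat.le_self_pow two_ne_zero q

/-! ### Radial coefficients and the decay of their kernels -/

/-- The frequencies all of whose coordinates are at most `R` in absolute value. -/
noncomputable def frequencyBox (q R : ℕ) : Finset (Fin q → ℤ) :=
  Fintype.piFinset fun _ => Finset.Icc (-(R : ℤ)) R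

theorem mem_frequencyBox {R : ℕ} {k : Fin q → ℤ} : k ∈ frequencyBox q R ↔ ∀ i, |k i| ≤ R := by
  simp [frequencyBox, abs_le]

theorem card_frequencyBox (q R : ℕ) : (frequencyBox q R).card = (2 * R + 1) ^ q := by
  simp only [frequencyBox, Fintype.card_piFinset, Int.card_Icc, Finset.prod_const,
    Finset.card_univ, Fintype.card_fin]
  congr 1
  omega

theorem fwdDiff_iter_eq_zero_of_notMem {c : (Fin q → ℤ) → ℂ} {R U : ℕ}
    (hc : ∀ k ∉ frequencyBox q R, c k = 0) {v : Fin q → ℤ} (hv : ∀ i, |v i| ≤ U) (m : ℕ) :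
    ∀ k ∉ frequencyBox q (R + m * U), (fwdDiff v)^[m] c k = 0 := by
  induction m with
  | zero => simpa using hc
  | succ m ih =>
    intro k hk
    rw [Function.iterate_succ_apply', fwdDiff, ih, ih, sub_zero]
    · contrapose! hk
      rw [mem_frequencyBox] at hk ⊢
      exact fun i => (hk i).trans (by push_cast; nlinarith)
    · contrapose! hk
      rw [mem_frequencyBox] at hk ⊢
      intro i
      have h1 := hk i
      have h2 := hv i
      rw [Pi.add_apply] at h1
      rw [abs_le] at h1 h2 ⊢
      push_cast at h1 ⊢
      constructor <;> linarith

theorem freqNorm_sq (k : Fin q → ℤ) : freqNorm k ^ 2 = ∑ i, (k i : ℝ) ^ 2 :=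
  Real.sq_sqrt (Finset.sum_nonneg fun _ _ => sq_nonneg _)

theorem freqNorm_nonneg (k : Fin q → ℤ) : 0 ≤ freqNorm k := Real.sqrt_nonneg _

theorem abs_le_freqNorm (k : Fin q → ℤ) (i : Fin q) : |(k i : ℝ)| ≤ freqNorm k := by
  refine abs_le_of_sq_le_sq ?_ (freqNorm_nonneg k)
  rw [freqNorm_sq]
  exact Finset.single_le_sum (f := fun i => (k i : ℝ) ^ 2) (fun _ _ => sq_nonneg _)
    (Finset.mem_univ i)

/-- The coefficients `G (‖k‖² / N²)`. -/
noncomputable def radialCoeff (G : ℝ → ℝ) (N : ℝ) (k : Fin q → ℤ) : ℂ :=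
  (G (freqNorm k ^ 2 / N ^ 2) : ℂ)

theorem radialCoeff_eq_zero {G : ℝ → ℝ} (hG : ∀ x > 4, G x = 0) {N : ℕ} (hN : 0 < N)
    {k : Fin q → ℤ} (hk : k ∉ frequencyBox q (2 * N)) : radialCoeff G N k = 0 := by
  rw [mem_frequencyBox] at hk
  push Not at hk
  obtain ⟨i, hi⟩ := hk
  have hN' : (0 : ℝ) < N := by exact_mod_cast hN
  have h1 : 2 * (N : ℝ) < |(k i : ℝ)| := by exact_mod_cast hi
  have h2 := h1.trans_le (abs_le_freqNorm k i)
  rw [radialCoeff, hG, Complex.ofReal_zero]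
  rw [gt_iff_lt, lt_div_iff₀ (by positivity)]
  nlinarith

theorem support_radialCoeff_finite {G : ℝ → ℝ} (hG : ∀ x > 4, G x = 0) {N : ℕ} (hN : 0 < N) :
    (Function.support (radialCoeff G N : (Fin q → ℤ) → ℂ)).Finite :=
  (frequencyBox q (2 * N)).finite_toSet.subset fun _ hk => by
    by_contra h
    exact hk (radialCoeff_eq_zero hG hN h)

theorem fwdDiff_iter_line {c : (Fin q → ℤ) → ℂ} {v k : Fin q → ℤ} {w : ℝ → ℝ} {a δ : ℝ}
    (h : ∀ t : ℤ, c (k + t • v) = (w (a + t * δ) : ℂ)) (m : ℕ) (t : ℤ) :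
    (fwdDiff v)^[m] c (k + t • v) = (((fwdDiff δ)^[m] w (a + t * δ) : ℝ) : ℂ) := by
  induction m generalizing t with
  | zero => exact h t
  | succ m ih =>
    rw [Function.iterate_succ_apply', Function.iterate_succ_apply', fwdDiff, fwdDiff]
    have h1 : k + t • v + v = k + (t + 1) • v := by rw [add_smul, one_smul, add_assoc]
    have h2 : a + t * δ + δ = a + ((t + 1 : ℤ) : ℝ) * δ := by push_cast; ring
    rw [h1, h2, ih, ih]
    push_cast
    rfl

/-- The part of `‖k‖² / N²` which is constant on lines in direction `i`. -/
noncomputable def lineOffset (i : Fin q) (N : ℝ) (k : Fin q → ℤ) : NNReal :=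
  ⟨(∑ j ∈ Finset.univ.erase i, (k j : ℝ) ^ 2) / N ^ 2,
    div_nonneg (Finset.sum_nonneg fun _ _ => sq_nonneg _) (sq_nonneg _)⟩

/-- Along a line in direction i one has ‖k‖²/N² = c + t² with t = k_i/N and c fixed, so lattice
differences become one-variable differences of G(c + t²) with step u/N. -/
theorem fwdDiff_iter_radialCoeff (G : ℝ → ℝ) (N : ℝ) (i : Fin q) (u : ℤ) (m : ℕ)
    (k : Fin q → ℤ) :
    (fwdDiff (Pi.single i u))^[m] (radialCoeff G N) k =
      (((fwdDiff ((u : ℝ) / N))^[m] (fun t => G ((lineOffset i N k : ℝ) + t ^ 2))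
        ((k i : ℝ) / N) : ℝ) : ℂ) := by
  have h := fwdDiff_iter_line (c := radialCoeff G N) (v := Pi.single i u) (k := k)
    (w := fun t => G ((lineOffset i N k : ℝ) + t ^ 2)) (a := (k i : ℝ) / N) (δ := (u : ℝ) / N)
    (fun t => by
      unfold radialCoeff
      congr 2
      rw [freqNorm_sq, ← Finset.add_sum_erase _ _ (Finset.mem_univ i)]
      have h1 : ∑ j ∈ Finset.univ.erase i, (((k + t • (Pi.single i u : Fin q → ℤ)) j : ℤ) : ℝ) ^ 2 =
          ∑ j ∈ Finset.univ.erase i, (k j : ℝ) ^ 2 :=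
        Finset.sum_congr rfl fun j hj => by
          simp [Finset.ne_of_mem_erase hj]
      rw [h1]
      change _ = (∑ j ∈ Finset.univ.erase i, (k j : ℝ) ^ 2) / N ^ 2 + _
      simp only [Pi.add_apply, Pi.smul_apply, Pi.single_eq_same, smul_eq_mul, Int.cast_add,
        Int.cast_mul]
      rw [add_div, add_comm]
      congr 1
      rw [← div_pow]
      congr 1
      ring) m 0
  simpa using h

/-- Kernels with smooth radial coefficients are concentrated near the origin. -/
theorem exists_norm_trig_radialCoeff_le (hq : 1 ≤ q) (A : ℝ) :
    ∃ C, 0 < C ∧ ∀ G, CutoffShape G → SmoothBV (q + 1) A G → ∀ (n : ℕ) (x : Torus q),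
      ‖trig (radialCoeff G (2 ^ n)) x‖ ≤ C * (2 ^ n) ^ q * decayWeight (2 ^ n) x := by
  obtain ⟨B, hB⟩ := exists_smoothBV_comp_const_add_sq (q + 1) A
  have : Nonempty (Fin q) := ⟨⟨0, hq⟩⟩
  set C₀ : ℝ := 2 ^ q * (5 ^ q * |A| + 2 ^ (q + 1) * ((2 * q + 7) ^ q * |B|)) with hC₀
  refine ⟨C₀ + 1, by positivity, fun G hG hGA n x => ?_⟩
  have hA := hGA.nonneg
  have hB0 : 0 ≤ B := (hB 0 G hG hGA).nonneg
  rw [abs_of_nonneg hA, abs_of_nonneg hB0] at hC₀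
  have hN : 0 < 2 ^ n := by positivity
  set N : ℝ := 2 ^ n with hNdef
  have hNc : ((2 ^ n : ℕ) : ℝ) = N := by push_cast; rfl
  have hN0 : 0 < N := by positivity
  have hN1 : 1 ≤ N := one_le_pow₀ one_le_two
  set c : (Fin q → ℤ) → ℂ := radialCoeff G N with hc
  have hc0 : ∀ k ∉ frequencyBox q (2 * 2 ^ n), c k = 0 := fun k hk => by
    have := radialCoeff_eq_zero hG.2 hN hk
    rwa [hNc] at this
  have hfin : c.support.Finite := by
    have := support_radialCoeff_finite (q := q) hG.2 hN
    rwa [hNc] at this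
  -- The trivial bound: at most (4N + 1)^q ≤ (5N)^q frequencies, each with coefficient at most A.
  have h1 : ‖trig c x‖ ≤ N ^ q * (5 ^ q * A) := by
    refine (norm_trig_le hc0 x).trans ?_
    refine (Finset.sum_le_card_nsmul _ _ A fun k _ => ?_).trans ?_
    · simp only [hc, radialCoeff, Complex.norm_real, Real.norm_eq_abs]
      exact hGA.abs_le _
    · rw [card_frequencyBox, nsmul_eq_mul, ← mul_assoc (N ^ q), ← mul_pow]
      refine mul_le_mul_of_nonneg_right ?_ hA
      push_cast
      rw [← hNdef]
      exact pow_le_pow_left₀ (by positivity) (by linarith) _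
  -- Differences are taken in the direction of a largest coordinate of x. Each of the q + 1
  -- differences gains a factor 1/N, whereas |exp(−i x_i) − 1| is at least ‖x‖/2.
  obtain ⟨i, hi⟩ : ∃ i, ‖x i‖ = ‖x‖ := by
    obtain ⟨i, -, hi⟩ := Finset.exists_max_image Finset.univ (fun i => ‖x i‖)
      Finset.univ_nonempty
    exact ⟨i, le_antisymm (norm_le_pi_norm x i)
      ((pi_norm_le_iff_of_nonneg (norm_nonneg _)).mpr fun j => hi j (Finset.mem_univ j))⟩
  have h2 : ‖trig c x‖ * ‖x‖ ^ (q + 1) ≤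
      2 ^ (q + 1) * (((2 * q + 7) * N) ^ q * ((1 / N) ^ (q + 1) * B)) := by
    have e := trig_fwdDiff_iter hfin (Pi.single i 1) (q + 1) x
    have hchord : ‖x‖ / 2 ≤ ‖character (-Pi.single i 1) x - 1‖ := by
      rw [← Pi.single_neg, character_single]
      have hpi : ‖x i‖ ≤ Real.pi := by
        have := AddCircle.norm_le_half_period (2 * Real.pi) (x := x i) Real.two_pi_pos.ne'
        rw [abs_of_pos Real.two_pi_pos] at this
        linarith
      have h := norm_fourier_sub_one_ge (-1) (x i) (by simpa using hpi)
      rw [← hi]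
      refine le_trans ?_ h
      simp only [Int.cast_neg, Int.cast_one, abs_neg, abs_one, one_mul]
      rw [div_eq_inv_mul]
      refine mul_le_mul_of_nonneg_right ?_ (norm_nonneg _)
      rw [le_div_iff₀ Real.pi_pos]
      linarith [Real.pi_le_four]
    have hbound : ‖trig ((fwdDiff (Pi.single i 1))^[q + 1] c) x‖ ≤
        ((2 * q + 7) * N) ^ q * ((1 / N) ^ (q + 1) * B) := by
      have hz := fwdDiff_iter_eq_zero_of_notMem hc0 (v := Pi.single i 1) (U := 1) (fun j => by
        rcases eq_or_ne j i with rfl | h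
        · simp
        · simp [h]) (q + 1)
      refine (norm_trig_le hz x).trans ((Finset.sum_le_card_nsmul _ _ ((1 / N) ^ (q + 1) * B)
        fun k _ => ?_).trans ?_)
      · rw [hc, fwdDiff_iter_radialCoeff, Complex.norm_real, Real.norm_eq_abs]
        have := (hB (lineOffset i N k) G hG hGA).abs_fwdDiff_iter_le (δ := 1 / N) (by positivity)
          ((k i : ℝ) / N)
        simpa using this
      · rw [card_frequencyBox, nsmul_eq_mul]
        refine mul_le_mul_of_nonneg_right ?_ (by positivity)
        push_cast
        rw [← hNdef]
        refine pow_le_pow_left₀ (by positivity) ?_ _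
        have : (q : ℝ) ≤ q * N := le_mul_of_one_le_right (by positivity) hN1
        linarith
    rw [e, norm_mul, norm_pow] at hbound
    calc ‖trig c x‖ * ‖x‖ ^ (q + 1) = 2 ^ (q + 1) * ((‖x‖ / 2) ^ (q + 1) * ‖trig c x‖) := by
          rw [div_pow]; field_simp
      _ ≤ 2 ^ (q + 1) * (‖character (-Pi.single i 1) x - 1‖ ^ (q + 1) * ‖trig c x‖) := by
          gcongr
      _ ≤ _ := by gcongr
  have h3 : ‖trig c x‖ * (1 + N * ‖x‖) ^ (q + 1) ≤ C₀ * N ^ q := by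
    have h4 : (1 + N * ‖x‖) ^ (q + 1) ≤ 2 ^ q * (1 + N ^ (q + 1) * ‖x‖ ^ (q + 1)) := by
      have := add_pow_le (zero_le_one (α := ℝ)) (show 0 ≤ N * ‖x‖ by positivity) (q + 1)
      simpa [mul_pow] using this
    calc ‖trig c x‖ * (1 + N * ‖x‖) ^ (q + 1)
        ≤ ‖trig c x‖ * (2 ^ q * (1 + N ^ (q + 1) * ‖x‖ ^ (q + 1))) := by gcongr
      _ = 2 ^ q * (‖trig c x‖ + N ^ (q + 1) * (‖trig c x‖ * ‖x‖ ^ (q + 1))) := by ring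
      _ ≤ 2 ^ q * (N ^ q * (5 ^ q * A) + N ^ (q + 1) *
          (2 ^ (q + 1) * (((2 * q + 7) * N) ^ q * ((1 / N) ^ (q + 1) * B)))) := by gcongr
      _ = C₀ * N ^ q := by
          rw [hC₀, mul_pow _ N, one_div, inv_pow]
          field_simp
  unfold decayWeight
  rw [← div_eq_mul_inv, le_div_iff₀ (by positivity)]
  refine h3.trans ?_
  gcongr
  linarith

end Torus

/-! ### Schur's test and Young's inequality -/

/-- Hölder's inequality after splitting k = k^(1/ρ') k^(1/ρ); in effect Jensen's inequality for the
measure with density k. -/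
theorem ENNReal.lintegral_mul_rpow_le {Y : Type*} [MeasurableSpace Y] {μ : Measure Y}
    {k u : Y → ℝ≥0∞} (hk : AEMeasurable k μ) (hu : AEMeasurable u μ) {ρ : ℝ} (hρ : 1 ≤ ρ) :
    (∫⁻ y, k y * u y ∂μ) ^ ρ ≤ (∫⁻ y, k y ∂μ) ^ (ρ - 1) * ∫⁻ y, k y * u y ^ ρ ∂μ := by
  rcases hρ.eq_or_lt with rfl | hρ
  · simp
  · have hρ0 : 0 < ρ := by linarith
    have hc : (ρ.conjExponent).HolderConjugate ρ := (Real.HolderConjugate.conjExponent hρ).symm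
    have h := ENNReal.lintegral_mul_le_Lp_mul_Lq μ hc (f := fun y => k y ^ (1 / ρ.conjExponent))
      (g := fun y => k y ^ (1 / ρ) * u y) (hk.pow_const _) ((hk.pow_const _).mul hu)
    have e1 : ∀ y, k y ^ (1 / ρ.conjExponent) * (k y ^ (1 / ρ) * u y) = k y * u y := by
      intro y
      rw [← mul_assoc, ← ENNReal.rpow_add_of_nonneg _ _ (by simpa using hc.nonneg)
        (by positivity)]
      have := hc.inv_add_inv_eq_one
      rw [one_div, one_div, this, ENNReal.rpow_one]
    have e2 : ∀ y, (k y ^ (1 / ρ.conjExponent)) ^ ρ.conjExponent = k y := fun y => by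
      rw [← ENNReal.rpow_mul, one_div_mul_cancel hc.pos.ne', ENNReal.rpow_one]
    have e3 : ∀ y, (k y ^ (1 / ρ) * u y) ^ ρ = k y * u y ^ ρ := fun y => by
      rw [ENNReal.mul_rpow_of_nonneg _ _ hρ0.le, ← ENNReal.rpow_mul,
        one_div_mul_cancel hρ0.ne', ENNReal.rpow_one]
    simp only [Pi.mul_apply, e1, e2, e3] at h
    have h2 := ENNReal.rpow_le_rpow h hρ0.le
    rw [ENNReal.mul_rpow_of_nonneg _ _ hρ0.le, ← ENNReal.rpow_mul, ← ENNReal.rpow_mul,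
      one_div_mul_cancel hρ0.ne', ENNReal.rpow_one] at h2
    convert h2 using 3
    have := hc.inv_add_inv_eq_one
    rw [one_div, eq_sub_of_add_eq this, sub_mul, inv_mul_cancel₀ hρ0.ne', one_mul]

/-- **Schur's test**: an integral operator whose kernel has marginals bounded by `A` and `B` maps
`L^r` to `L^r` with norm at most `A ^ (1 / r) * B ^ (1 - 1 / r)`. -/
theorem MeasureTheory.eLpNorm_le_of_schur {X Y E F : Type*} [MeasurableSpace X] [MeasurableSpace Y]
    [NormedAddCommGroup E] [NormedAddCommGroup F] {ν : Measure X} {μ : Measure Y} [SFinite ν]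
    [SFinite μ] {k : X → Y → ℝ≥0∞} (hk : Measurable (Function.uncurry k)) {f : Y → E} {g : X → F}
    (hf : AEStronglyMeasurable f μ) (hg : ∀ x, ‖g x‖ₑ ≤ ∫⁻ y, k x y * ‖f y‖ₑ ∂μ) {A B : ℝ≥0∞}
    (hA : ∀ y, ∫⁻ x, k x y ∂ν ≤ A) (hB : ∀ x, ∫⁻ y, k x y ∂μ ≤ B) {r : ℝ≥0∞} (hr : 1 ≤ r) :
    eLpNorm g r ν ≤ A ^ (r⁻¹).toReal * B ^ (1 - (r⁻¹).toReal) * eLpNorm f r μ := by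
  have hkx : ∀ x, Measurable (k x) := fun x => hk.comp measurable_prodMk_left
  have hky : ∀ y, Measurable fun x => k x y := fun y => hk.comp measurable_prodMk_right
  rcases eq_or_ne r ∞ with rfl | hr'
  · simp only [ENNReal.inv_top, ENNReal.toReal_zero, ENNReal.rpow_zero, sub_zero,
      ENNReal.rpow_one, one_mul, eLpNorm_exponent_top]
    refine eLpNormEssSup_le_of_ae_enorm_bound (Filter.Eventually.of_forall fun x => ?_)
    calc ‖g x‖ₑ ≤ ∫⁻ y, k x y * ‖f y‖ₑ ∂μ := hg x
      _ ≤ ∫⁻ y, k x y * eLpNormEssSup f μ ∂μ := by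
          refine lintegral_mono_ae ?_
          filter_upwards [enorm_ae_le_eLpNormEssSup f μ] with y hy
          gcongr
      _ ≤ B * eLpNormEssSup f μ := by
          rw [lintegral_mul_const _ (hkx x)]
          gcongr
          exact hB x
  · have hr0 : r ≠ 0 := (zero_lt_one.trans_le hr).ne'
    have hρ : 1 ≤ r.toReal := by
      rw [← ENNReal.toReal_one]; exact ENNReal.toReal_mono hr' hr
    set ρ := r.toReal with hρdef
    have hρ0 : 0 < ρ := by linarith
    rw [eLpNorm_eq_lintegral_rpow_enorm_toReal hr0 hr', eLpNorm_eq_lintegral_rpow_enorm_toReal hr0 hr',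
      ← hρdef, ENNReal.toReal_inv, ← hρdef]
    have h1 : ∫⁻ x, ‖g x‖ₑ ^ ρ ∂ν ≤ B ^ (ρ - 1) * (A * ∫⁻ y, ‖f y‖ₑ ^ ρ ∂μ) := by
      calc ∫⁻ x, ‖g x‖ₑ ^ ρ ∂ν ≤ ∫⁻ x, B ^ (ρ - 1) * ∫⁻ y, k x y * ‖f y‖ₑ ^ ρ ∂μ ∂ν := by
            refine lintegral_mono fun x => ?_
            refine (ENNReal.rpow_le_rpow (hg x) hρ0.le).trans ?_
            refine (ENNReal.lintegral_mul_rpow_le (hkx x).aemeasurable hf.enorm hρ).trans ?_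
            gcongr
            exact hB x
        _ = B ^ (ρ - 1) * ∫⁻ x, ∫⁻ y, k x y * ‖f y‖ₑ ^ ρ ∂μ ∂ν := by
            refine lintegral_const_mul'' _ ?_
            exact (hk.aemeasurable.mul
              ((hf.enorm.pow_const ρ).comp_snd)).lintegral_prod_right'
        _ = B ^ (ρ - 1) * ∫⁻ y, ∫⁻ x, k x y * ‖f y‖ₑ ^ ρ ∂ν ∂μ := by
            rw [lintegral_lintegral_swap]
            exact hk.aemeasurable.mul ((hf.enorm.pow_const ρ).comp_snd)
        _ ≤ B ^ (ρ - 1) * ∫⁻ y, A * ‖f y‖ₑ ^ ρ ∂μ := by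
            gcongr with y
            rw [lintegral_mul_const _ (hky y)]
            gcongr
            exact hA y
        _ = _ := by rw [lintegral_const_mul'' _ (hf.enorm.pow_const ρ)]
    refine (ENNReal.rpow_le_rpow h1 (by positivity)).trans (le_of_eq ?_)
    rw [ENNReal.mul_rpow_of_nonneg _ _ (by positivity),
      ENNReal.mul_rpow_of_nonneg _ _ (by positivity), ← ENNReal.rpow_mul, one_div, sub_mul,
      mul_inv_cancel₀ hρ0.ne', one_mul]
    ring

/-- Coefficient vectors are treated as functions on a counting measure space, so that one form of
Schur's test covers synthesis, sampling and matrices alike. -/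
theorem eLpNorm_count_eq_norm_toLp {M : ℕ} {r : ℝ≥0∞} (hr : 1 ≤ r) (a : Fin M → ℝ) :
    eLpNorm a r Measure.count = ENNReal.ofReal ‖WithLp.toLp r a‖ := by
  rcases eq_or_ne r ∞ with rfl | hr'
  · rw [eLpNorm_exponent_top, eLpNormEssSup, essSup_count, PiLp.norm_eq_ciSup]
    rcases isEmpty_or_nonempty (Fin M) with h | h
    · simp
    · refine le_antisymm (iSup_le fun i => ?_) ?_
      · rw [← ofReal_norm]
        exact ENNReal.ofReal_le_ofReal
          (le_ciSup (f := fun i => ‖a i‖) (Set.finite_range _).bddAbove i)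
      · obtain ⟨i, hi⟩ := exists_eq_ciSup_of_finite (f := fun i => ‖a i‖)
        change ENNReal.ofReal (⨆ i, ‖a i‖) ≤ _
        rw [← hi, ofReal_norm]
        exact le_iSup (fun i => ‖a i‖ₑ) i
  · have hr0 : r ≠ 0 := (zero_lt_one.trans_le hr).ne'
    have hρ0 : 0 < r.toReal := ENNReal.toReal_pos hr0 hr'
    rw [eLpNorm_eq_lintegral_rpow_enorm_toReal hr0 hr', PiLp.norm_eq_sum hρ0, lintegral_count,
      tsum_fintype, ← ENNReal.ofReal_rpow_of_nonneg (Finset.sum_nonneg fun _ _ => by positivity)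
        (by positivity), ENNReal.ofReal_sum_of_nonneg fun _ _ => by positivity]
    congr 2 with i
    rw [← ENNReal.ofReal_rpow_of_nonneg (norm_nonneg _) hρ0.le, ofReal_norm]

namespace Torus

variable {q : ℕ}

theorem measurable_enorm_sub {φ : Torus q → ℂ} (hφ : Measurable φ) :
    Measurable (Function.uncurry fun x y : Torus q => ‖φ (x - y)‖ₑ) :=
  (hφ.comp (measurable_fst.sub measurable_snd)).enorm

/-- **Young's inequality** for the convolution with an integrable kernel. -/
theorem eLpNorm_integral_mul_sub_le {φ f : Torus q → ℂ} (hφ : Measurable φ)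
    (hf : AEStronglyMeasurable f volume) {r : ℝ≥0∞} (hr : 1 ≤ r) :
    eLpNorm (fun x => ∫ y, f y * φ (x - y)) r volume ≤
      (∫⁻ x, ‖φ x‖ₑ) * eLpNorm f r volume := by
  set I := ∫⁻ x, ‖φ x‖ₑ with hI
  have h := eLpNorm_le_of_schur (ν := (volume : Measure (Torus q))) (measurable_enorm_sub hφ) hf
    (g := fun x => ∫ y, f y * φ (x - y)) (A := I) (B := I) (fun x => ?_) (fun y => ?_)
    (fun x => ?_) hr
  · have hθ : (r⁻¹).toReal ≤ 1 := by
      rw [← ENNReal.toReal_one]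
      exact ENNReal.toReal_mono ENNReal.one_ne_top (ENNReal.inv_le_one.mpr hr)
    rwa [← ENNReal.rpow_add_of_nonneg _ _ ENNReal.toReal_nonneg (by linarith),
      add_sub_cancel, ENNReal.rpow_one] at h
  · refine (enorm_integral_le_lintegral_enorm _).trans (le_of_eq ?_)
    simp_rw [enorm_mul, mul_comm]
  · rw [lintegral_sub_right_eq_self (fun x : Torus q => ‖φ x‖ₑ) y]
  · rw [lintegral_sub_left_eq_self (fun x : Torus q => ‖φ x‖ₑ) x]

end Torus

/-! ### Uniform L¹ bounds for the filter kernels -/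

theorem Int.sum_Icc_add_one_sub (ν : ℤ → ℝ) (R : ℕ) :
    ∑ a ∈ Finset.Icc (-(R : ℤ)) R, (ν (a + 1) - ν a) = ν (R + 1) - ν (-R) := by
  rw [Int.Icc_eq_finset_map, Finset.sum_map]
  have h := Finset.sum_range_sub (fun n : ℕ => ν (n + -(R : ℤ))) ((R : ℤ) + 1 - -(R : ℤ)).toNat
  have h1 : ((((R : ℤ) + 1 - -(R : ℤ)).toNat : ℕ) : ℤ) + -(R : ℤ) = R + 1 := by omega
  simp only [h1, Nat.cast_zero, zero_add] at h
  rw [← h]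
  refine Finset.sum_congr rfl fun n _ => ?_
  simp only [Function.Embedding.trans_apply, Nat.castEmbedding_apply, addLeftEmbedding_apply]
  congr 2 <;> (push_cast; ring)

/-- A shift by U is a sum of U unit shifts, each of which telescopes to at most B. The bound does
not grow with R; this is the gain that bounded variation provides. -/
theorem Int.sum_Icc_add_sub_le {ν : ℤ → ℝ} {B : ℝ} (h0 : ∀ a, 0 ≤ ν a) (hB : ∀ a, ν a ≤ B)
    (R U : ℕ) : ∑ a ∈ Finset.Icc (-(R : ℤ)) R, (ν (a + U) - ν a) ≤ U * B := by
  induction U with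
  | zero => simp
  | succ U ih =>
    have h := Int.sum_Icc_add_one_sub (fun a => ν (a + U)) R
    have e : ∀ a : ℤ, ν (a + (U + 1 : ℕ)) - ν a =
        (ν (a + 1 + U) - ν (a + U)) + (ν (a + U) - ν a) := fun a => by
      push_cast
      rw [show a + ((U : ℤ) + 1) = a + 1 + U by ring]
      ring
    simp_rw [e]
    rw [Finset.sum_add_distrib, h]
    push_cast
    have := h0 (-R + U)
    have := hB (R + 1 + U)
    linarith

namespace IsLowPassFilter

variable {Q : ℕ} {h : ℝ → ℝ}

/-- The extension of a low-pass filter by `1` to the negative axis. -/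
theorem exists_smoothBV_extend (hh : IsLowPassFilter Q h) :
    CutoffShape (fun t => h (max t 0)) ∧ ∃ A, SmoothBV (Q - 1) A fun t => h (max t 0) := by
  set φ : ℝ → ℝ := fun t => h (max t 0) with hφ
  have hone : ∀ t < 1 / 2, φ t = 1 := fun t ht =>
    hh.eq_one _ (le_max_right _ _) (max_le ht.le (by norm_num))
  have hzero : ∀ t, 1 < t → φ t = 0 := fun t ht => hh.eq_zero _ (ht.le.trans (le_max_left _ _))
  have hshape : CutoffShape φ :=
    ⟨⟨1, fun t ht => hone t (by linarith)⟩, fun t ht => hzero t (by linarith)⟩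
  refine ⟨hshape, ?_⟩
  -- Since h = 1 on [0, 1/2], the extension creates no singularity at the origin.
  have hcd : ContDiff ℝ (Q - 1 : ℕ) φ := contDiff_iff_contDiffAt.mpr fun t => by
    by_cases ht : t < 1 / 2
    · refine (contDiffAt_const (c := (1 : ℝ))).congr_of_eventuallyEq ?_
      filter_upwards [gt_mem_nhds ht] with y hy using hone y hy
    · have ht0 : 0 < t := by push Not at ht; linarith
      have h1 : ContDiffAt ℝ (Q - 1 : ℕ) h t :=
        (hh.contDiffOn t ht0.le).contDiffAt (Ici_mem_nhds ht0)
      refine h1.congr_of_eventuallyEq ?_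
      filter_upwards [lt_mem_nhds ht0] with y hy
      simp only [hφ, max_eq_left hy.le]
  set D := iteratedDeriv (Q - 1) φ with hD
  have hloc : ∀ {c : ℝ} {s : Set ℝ}, IsOpen s → (∀ t ∈ s, φ t = c) → ∀ t ∈ s,
      D t = iteratedDeriv (Q - 1) (fun _ => c) t := by
    intro c s hs hc t ht
    exact Filter.EventuallyEq.iteratedDeriv_eq (Q - 1)
      (Filter.eventuallyEq_of_mem (hs.mem_nhds ht) hc)
  have hconst : ∀ (c a b : ℝ), iteratedDeriv (Q - 1) (fun _ => c) a =
      iteratedDeriv (Q - 1) (fun _ => c) b := fun c a b => by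
    rw [iteratedDeriv_const, iteratedDeriv_const]
  -- All the variation of the top derivative lies in [1/4, 2], where it is finite by absolute
  -- continuity; to the left and to the right φ is constant.
  have hD1 : eVariationOn D (Set.Iic (1 / 4)) = 0 := by
    refine eVariationOn.constant_on ?_
    rintro _ ⟨x, hx, rfl⟩ _ ⟨y, hy, rfl⟩
    have hx' : x < 1 / 2 := lt_of_le_of_lt hx (by norm_num)
    have hy' : y < 1 / 2 := lt_of_le_of_lt hy (by norm_num)
    rw [hloc isOpen_Iio hone x hx', hloc isOpen_Iio hone y hy']
    exact hconst _ _ _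
  have hD3 : eVariationOn D (Set.Ici 2) = 0 := by
    refine eVariationOn.constant_on ?_
    rintro _ ⟨x, hx, rfl⟩ _ ⟨y, hy, rfl⟩
    have hx' : 1 < x := lt_of_lt_of_le (by norm_num) hx
    have hy' : 1 < y := lt_of_lt_of_le (by norm_num) hy
    rw [hloc isOpen_Ioi hzero x hx', hloc isOpen_Ioi hzero y hy']
    exact hconst _ _ _
  have hD2 : eVariationOn D (Set.Icc (1 / 4) 2) ≠ ∞ := by
    have hbv := (hh.absolutelyContinuous 2 two_pos).boundedVariationOn
    rw [Set.uIcc_of_le (by norm_num : (0 : ℝ) ≤ 2)] at hbv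
    have heq : Set.EqOn D (iteratedDerivWithin (Q - 1) h (Set.Ici 0)) (Set.Icc (1 / 4) 2) := by
      intro t ht
      have ht0 : 0 < t := lt_of_lt_of_le (by norm_num) ht.1
      have e1 : D t = iteratedDeriv (Q - 1) h t :=
        Filter.EventuallyEq.iteratedDeriv_eq (Q - 1) (by
          filter_upwards [lt_mem_nhds ht0] with y hy
          simp only [hφ, max_eq_left hy.le])
      rw [e1, ← iteratedDerivWithin_univ, iteratedDerivWithin, iteratedDerivWithin]
      congr 1
      exact iteratedFDerivWithin_congr_set
        (Filter.eventuallyEq_of_mem (Ici_mem_nhds ht0)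
          (fun y hy => eq_iff_iff.mpr (iff_of_true hy trivial))) _ |>.symm
    rw [eVariationOn.eq_of_eqOn heq]
    exact ne_top_of_le_ne_top hbv (eVariationOn.mono _ (Set.Icc_subset_Icc_left (by norm_num)))
  have hfin : eVariationOn D Set.univ ≠ ∞ := by
    have e1 : Set.Icc (1 / 4 : ℝ) 2 ∪ Set.Ici 2 = Set.Ici (1 / 4) :=
      Set.Icc_union_Ici_eq_Ici (by norm_num)
    have e2 : Set.Iic (1 / 4 : ℝ) ∪ Set.Ici (1 / 4) = Set.univ := Set.Iic_union_Ici
    rw [← e2, eVariationOn.union D isGreatest_Iic isLeast_Ici, hD1, zero_add, ← e1,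
      eVariationOn.union D (isGreatest_Icc (by norm_num)) isLeast_Ici, hD3, add_zero]
    exact hD2
  exact exists_smoothBV hshape.eventuallyConstant hcd (VariationLE.of_eVariationOn hfin)

/-- Radial coefficients are written as functions of ‖k‖²/N², so the relevant profile is h(√u) rather
than h. -/
theorem exists_smoothBV_comp_sqrt (hh : IsLowPassFilter Q h) :
    CutoffShape (fun u => h (√u)) ∧ ∃ A, SmoothBV (Q - 1) A fun u => h (√u) := by
  obtain ⟨hs, A, hA⟩ := hh.exists_smoothBV_extend
  obtain ⟨B, hB⟩ := _root_.exists_smoothBV_comp_sqrt (Q - 1) A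
  refine ⟨⟨⟨1, fun u hu => hh.eq_one _ (Real.sqrt_nonneg _) ?_⟩, fun u hu =>
    hh.eq_zero _ (Real.one_le_sqrt.mpr (by linarith))⟩, B, ?_⟩
  · refine Real.sqrt_le_iff.mpr ⟨by norm_num, ?_⟩
    norm_num; linarith
  · have := hB _ hs hA
    simpa only [max_eq_left (Real.sqrt_nonneg _)] using this

end IsLowPassFilter

namespace Torus

variable {q : ℕ}

theorem filterKernel_eq_trig {h : ℝ → ℝ} {N : ℝ} (hN : 0 < N) :
    (filterKernel h N : Torus q → ℂ) = trig (radialCoeff (fun u => h (√u)) N) := by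
  ext x
  rw [filterKernel, if_pos hN, trig]
  refine tsum_congr fun k => ?_
  rw [radialCoeff, ← div_pow, Real.sqrt_sq (div_nonneg (freqNorm_nonneg k) hN.le)]

theorem lineOffset_piSplitAt_symm (i : Fin q) (N : ℝ) (a : ℤ) (b : {j // j ≠ i} → ℤ) :
    lineOffset i N ((Equiv.piSplitAt i fun _ => ℤ).symm (a, b)) =
      lineOffset i N ((Equiv.piSplitAt i fun _ => ℤ).symm (0, b)) := by
  unfold lineOffset
  congr 2
  refine Finset.sum_congr rfl fun j hj => ?_
  simp [Equiv.piSplitAt, Finset.ne_of_mem_erase hj]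

/-- The square sum of differences of order `n + 1` and step `2 ^ j` of radial coefficients whose
profile has a derivative of order `n` of bounded variation. -/
theorem exists_sum_fwdDiff_radialCoeff_sq_le (hq : 1 ≤ q) {n : ℕ} {A : ℝ} {G : ℝ → ℝ}
    (hG : CutoffShape G) (hA : SmoothBV n A G) :
    ∃ C, 0 ≤ C ∧ ∀ (J j : ℕ), j ≤ J → ∀ i : Fin q,
      ∑' k, ‖(fwdDiff (Pi.single i (2 ^ j)))^[n + 1] (radialCoeff G (2 ^ J)) k‖ₑ ^ 2 ≤
        ENNReal.ofReal (C * (2 ^ J) ^ q * (2 ^ j / 2 ^ J) ^ (2 * n + 1)) := by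
  obtain ⟨B, hB⟩ := exists_smoothBV_comp_const_add_sq n A
  have hB0 : 0 ≤ B := (hB 0 G hG hA).nonneg
  choose μ hμmono hμB hμ using fun c : NNReal => (hB c G hG hA).exists_monotone_fwdDiff_le
  refine ⟨(2 * (n + 1) + 5) ^ (q - 1) * (B * ((n + 1) * B)), by positivity, fun J j hj i => ?_⟩
  set N : ℝ := 2 ^ J with hN
  have hN0 : 0 < N := by positivity
  have hN1 : 1 ≤ N := one_le_pow₀ one_le_two
  have hjN : (2 : ℝ) ^ j ≤ N := pow_le_pow_right₀ one_le_two hj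
  set U : ℕ := (n + 1) * 2 ^ j with hU
  set R : ℕ := 2 * 2 ^ J + U with hR
  set c : (Fin q → ℤ) → ℂ := radialCoeff G N with hc
  set δ : ℝ := 2 ^ j / N with hδ
  have hδ0 : 0 ≤ δ := by positivity
  have hc0 : ∀ k ∉ frequencyBox q (2 * 2 ^ J), c k = 0 := fun k hk => by
    have := radialCoeff_eq_zero hG.2 (show 0 < 2 ^ J by positivity) hk
    push_cast at this
    exact this
  have hz : ∀ k ∉ frequencyBox q R, (fwdDiff (Pi.single i (2 ^ j)))^[n + 1] c k = 0 :=
    fwdDiff_iter_eq_zero_of_notMem hc0 (v := Pi.single i (2 ^ j)) (U := 2 ^ j) (fun l => by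
      rcases eq_or_ne l i with rfl | h
      · simp
      · simp [h]) (n + 1)
  rw [tsum_eq_sum (s := frequencyBox q R) fun k hk => by rw [hz k hk]; simp]
  set F : (Fin q → ℤ) → ℝ := fun k =>
    μ (lineOffset i N k) (((k i + U : ℤ) : ℝ) / N) - μ (lineOffset i N k) ((k i : ℝ) / N) with hF
  have hF0 : ∀ k, 0 ≤ F k := fun k => sub_nonneg.mpr (hμmono _ (by
    gcongr; linarith [Nat.cast_nonneg (α := ℤ) U]))
  -- In the square of the increment F, one factor is bounded by B and the other is kept, so that it
  -- can be summed along lines.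
  have hpt : ∀ k, ‖(fwdDiff (Pi.single i (2 ^ j)))^[n + 1] c k‖ₑ ^ 2 ≤
      ENNReal.ofReal (δ ^ (2 * n) * B * F k) := by
    intro k
    rw [← ofReal_norm, ← ENNReal.ofReal_pow (norm_nonneg _)]
    refine ENNReal.ofReal_le_ofReal ?_
    rw [hc, fwdDiff_iter_radialCoeff, Complex.norm_real, Real.norm_eq_abs]
    have h1 := hμ (lineOffset i N k) δ hδ0 ((k i : ℝ) / N)
    have e : (k i : ℝ) / N + (n + 1) * δ = ((k i + U : ℤ) : ℝ) / N := by
      rw [hδ, hU]; push_cast; ring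
    rw [e] at h1
    have h2 : F k ≤ B := by
      have := (hμB (lineOffset i N k) (((k i + U : ℤ) : ℝ) / N)).2
      have := (hμB (lineOffset i N k) ((k i : ℝ) / N)).1
      simp only [hF]; linarith
    push_cast
    rw [← hδ]
    calc _ ≤ (δ ^ n * F k) ^ 2 := pow_le_pow_left₀ (abs_nonneg _) h1 2
      _ = δ ^ (2 * n) * (F k * F k) := by ring
      _ ≤ δ ^ (2 * n) * (B * F k) := by gcongr; exact hF0 k
      _ = _ := by ring
  refine (Finset.sum_le_sum fun k _ => hpt k).trans ?_
  rw [← ENNReal.ofReal_sum_of_nonneg fun k _ =>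
    mul_nonneg (mul_nonneg (by positivity) hB0) (hF0 k), ← Finset.mul_sum]
  refine ENNReal.ofReal_le_ofReal ?_
  -- There are (2R + 1)^(q−1) lines in direction i. On each the offset is constant and the
  -- increments sum to at most U B; the ratio U/N is the extra power of 2^j/N.
  have hsum : ∑ k ∈ frequencyBox q R, F k ≤ (2 * R + 1) ^ (q - 1) * (U * B) := by
    classical
    let e := Equiv.piSplitAt i (fun _ : Fin q => ℤ)
    have h1 : ∑ k ∈ frequencyBox q R, F k =
        ∑ p ∈ Finset.Icc (-(R : ℤ)) R ×ˢ
          Fintype.piFinset (fun _ : {j // j ≠ i} => Finset.Icc (-(R : ℤ)) R), F (e.symm p) := by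
      refine Finset.sum_equiv e (fun k => ?_) (fun k _ => by rw [Equiv.symm_apply_apply])
      simp only [frequencyBox, Fintype.mem_piFinset, Finset.mem_product, e,
        Equiv.piSplitAt, Equiv.coe_fn_mk]
      constructor
      · exact fun h => ⟨h i, fun j => h j⟩
      · rintro ⟨h, h'⟩ j
        rcases eq_or_ne j i with rfl | hj
        · exact h
        · exact h' ⟨j, hj⟩
    rw [h1, Finset.sum_product_right]
    refine (Finset.sum_le_card_nsmul _ _ (U * B) fun b _ => ?_).trans (le_of_eq ?_)
    · set c₀ := lineOffset i N (e.symm (0, b)) with hc₀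
      have h2 := Int.sum_Icc_add_sub_le (ν := fun a : ℤ => μ c₀ ((a : ℝ) / N)) (B := B)
        (fun a => (hμB _ _).1) (fun a => (hμB _ _).2) R U
      refine le_trans (le_of_eq ?_) h2
      refine Finset.sum_congr rfl fun a _ => ?_
      simp only [hF]
      have h3 : (e.symm (a, b)) i = a := by simp [e, Equiv.piSplitAt]
      rw [lineOffset_piSplitAt_symm, h3]
    · rw [nsmul_eq_mul, Fintype.card_piFinset]
      congr 1
      have h3 : ((R : ℤ) + 1 + (R : ℤ)).toNat = 2 * R + 1 := by omega
      simp [Int.card_Icc, h3]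
  have hU' : (U : ℝ) = (n + 1) * 2 ^ j := by rw [hU]; push_cast; ring
  have hR' : 2 * (R : ℝ) + 1 ≤ (2 * (n + 1) + 5) * N := by
    rw [hR]; push_cast; rw [hU', ← hN]
    have : ((n : ℝ) + 1) * 2 ^ j ≤ (n + 1) * N := by gcongr
    linarith
  calc δ ^ (2 * n) * B * ∑ k ∈ frequencyBox q R, F k
      ≤ δ ^ (2 * n) * B * (((2 * (n + 1) + 5) * N) ^ (q - 1) * (((n + 1) * 2 ^ j) * B)) := by
        refine mul_le_mul_of_nonneg_left ?_ (by positivity)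
        rw [hU'] at hsum
        refine hsum.trans ?_
        gcongr
    _ = (2 * (n + 1) + 5) ^ (q - 1) * (B * ((n + 1) * B)) * (N ^ (q - 1) * N) *
          (δ ^ (2 * n) * (2 ^ j / N)) := by
        rw [mul_pow]; field_simp
    _ = _ := by
        rw [← pow_succ, Nat.sub_add_cancel hq, ← hδ, ← pow_succ]

theorem sq_setLIntegral_le {X : Type*} [MeasurableSpace X] {μ : Measure X} {s : Set X}
    {f : X → ℝ≥0∞} (hf : Measurable f) :
    (∫⁻ x in s, f x ∂μ) ^ 2 ≤ μ s * ∫⁻ x in s, f x ^ 2 ∂μ := by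
  have h := ENNReal.lintegral_mul_rpow_le (μ := μ.restrict s) (k := fun _ => 1)
    aemeasurable_const hf.aemeasurable one_le_two
  norm_num at h
  exact h

/-- The `L¹` norms of the kernels of a dilated radial multiplier are bounded. -/
theorem exists_lintegral_trig_radialCoeff_le (hq : 1 ≤ q) {n : ℕ} (hn : q ≤ 2 * n) {A : ℝ}
    {G : ℝ → ℝ} (hG : CutoffShape G) (hA : SmoothBV n A G) :
    ∃ C : ℝ, 0 ≤ C ∧ ∀ J : ℕ,
      ∫⁻ x : Torus q, ‖trig (radialCoeff G (2 ^ J)) x‖ₑ ≤ ENNReal.ofReal C := by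
  obtain ⟨C₁, hC₁, hdiff⟩ := exists_sum_fwdDiff_radialCoeff_sq_le hq hG hA
  have hA0 := hA.nonneg
  set C₂ : ℝ := (2 * Real.pi) ^ q * ((2 * Real.pi) ^ q * C₁) with hC₂
  set C₀ : ℝ := (2 * Real.pi) ^ q * ((2 * Real.pi) ^ q * (5 ^ q * A ^ 2)) with hC₀
  have hpi := Real.two_pi_pos
  set ρ : ℝ := √(1 / 2) with hρ
  have hρ0 : 0 ≤ ρ := Real.sqrt_nonneg _
  have hρ1 : ρ < 1 := by
    rw [hρ, Real.sqrt_lt' one_pos]; norm_num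
  refine ⟨√C₀ + q * (√C₂ * (1 - ρ)⁻¹), by
    have : 0 ≤ (1 - ρ)⁻¹ := inv_nonneg.mpr (by linarith)
    positivity, fun J => ?_⟩
  set N : ℝ := 2 ^ J with hN
  have hN0 : 0 < N := by positivity
  have hN1 : 1 ≤ N := one_le_pow₀ one_le_two
  set c : (Fin q → ℤ) → ℂ := radialCoeff G N with hc
  have hc0 : ∀ k ∉ frequencyBox q (2 * 2 ^ J), c k = 0 := fun k hk => by
    have := radialCoeff_eq_zero hG.2 (show 0 < 2 ^ J by positivity) hk
    push_cast at this
    exact this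
  have hfin : c.support.Finite := by
    have := support_radialCoeff_finite (q := q) hG.2 (show 0 < 2 ^ J by positivity)
    push_cast at this
    exact this
  have hmeas : Measurable fun x : Torus q => ‖trig c x‖ₑ := (continuous_trig hfin).measurable.enorm
  -- On the piece with indices j and i, ‖x‖ is at most π/2^j and coordinate i exceeds half of that.
  -- These pieces for j < J, together with a cube of radius π/2^J, cover the torus.
  set S : ℕ → Fin q → Set (Torus q) := fun j i =>
    {x | ‖x‖ ≤ Real.pi / 2 ^ j ∧ Real.pi / 2 ^ (j + 1) < ‖x i‖} with hS
  have hSmeas : ∀ j i, MeasurableSet (S j i) := fun j i =>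
    (isClosed_le continuous_norm continuous_const).measurableSet.inter
      (isOpen_lt continuous_const (continuous_apply i).norm).measurableSet
  set S₀ : Set (Torus q) := Metric.closedBall 0 (Real.pi / 2 ^ J) with hS₀
  have hcentre : ∫⁻ x in S₀, ‖trig c x‖ₑ ≤ ENNReal.ofReal (√C₀) := by
    rw [← ENNReal.pow_le_pow_left_iff two_ne_zero, ← ENNReal.ofReal_pow (Real.sqrt_nonneg _),
      Real.sq_sqrt (by positivity)]
    refine (sq_setLIntegral_le hmeas).trans ?_
    have h1 : ∫⁻ x in S₀, ‖trig c x‖ₑ ^ 2 ≤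
        ENNReal.ofReal ((2 * Real.pi) ^ q * ((5 * N) ^ q * A ^ 2)) := by
      refine (setLIntegral_le_lintegral _ _).trans ?_
      rw [lintegral_trig_sq hfin, ENNReal.ofReal_mul (p := (2 * Real.pi) ^ q) (by positivity),
        ENNReal.ofReal_pow hpi.le]
      gcongr
      rw [tsum_eq_sum (s := frequencyBox q (2 * 2 ^ J)) fun k hk => by rw [hc0 k hk]; simp]
      refine (Finset.sum_le_card_nsmul _ _ (ENNReal.ofReal (A ^ 2)) fun k _ => ?_).trans ?_
      · rw [← ofReal_norm, ← ENNReal.ofReal_pow (norm_nonneg _)]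
        refine ENNReal.ofReal_le_ofReal (pow_le_pow_left₀ (norm_nonneg _) ?_ 2)
        rw [hc, radialCoeff, Complex.norm_real, Real.norm_eq_abs]
        exact hA.abs_le _
      · rw [card_frequencyBox, nsmul_eq_mul, ← ENNReal.ofReal_natCast,
          ← ENNReal.ofReal_mul (Nat.cast_nonneg _)]
        refine ENNReal.ofReal_le_ofReal (mul_le_mul_of_nonneg_right ?_ (sq_nonneg A))
        push_cast
        exact pow_le_pow_left₀ (by positivity) (by linarith) _
    refine (mul_le_mul' (volume_closedBall_le _ (by positivity)) h1).trans ?_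
    rw [← ENNReal.ofReal_mul (by positivity)]
    refine ENNReal.ofReal_le_ofReal (le_of_eq ?_)
    rw [hC₀, ← hN, mul_div_assoc', div_pow, mul_pow 5 N]
    field_simp
  have hannulus : ∀ j < J, ∀ i, ∫⁻ x in S j i, ‖trig c x‖ₑ ≤
      ENNReal.ofReal (√C₂ * ρ ^ (J - j)) := by
    intro j hj i
    set δ : ℝ := 2 ^ j / N with hδ
    have hδ0 : 0 < δ := by positivity
    have hδ1 : δ ≤ 1 := by
      rw [hδ, div_le_one hN0]; exact pow_le_pow_right₀ one_le_two hj.le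
    have hδρ : ρ ^ (J - j) = √δ := by
      rw [eq_comm, Real.sqrt_eq_iff_mul_self_eq hδ0.le (by positivity), ← mul_pow, hρ,
        Real.mul_self_sqrt (by norm_num), hδ, hN, one_div, inv_pow, ← one_div,
        div_eq_div_iff (by positivity) (by positivity), one_mul, ← pow_add,
        Nat.add_sub_cancel' hj.le]
    set D := (fwdDiff (Pi.single i (2 ^ j)))^[n + 1] c with hD
    have hDfin : D.support.Finite := support_fwdDiff_iter_finite hfin _ _
    -- With step 2^j the phase 2^j |x_i| lies between π/2 and π, so |exp(−i 2^j x_i) − 1| ≥ 1 and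
    -- differencing does not decrease the modulus.
    have hle : ∀ x ∈ S j i, ‖trig c x‖ₑ ≤ ‖trig D x‖ₑ := by
      intro x hx
      rw [← ofReal_norm, ← ofReal_norm]
      refine ENNReal.ofReal_le_ofReal ?_
      rw [hD, trig_fwdDiff_iter hfin, norm_mul, norm_pow]
      refine le_mul_of_one_le_left (norm_nonneg _) (one_le_pow₀ ?_)
      have h2 : |((-(2 ^ j : ℤ) : ℤ) : ℝ)| = 2 ^ j := by
        push_cast; rw [abs_neg, abs_of_pos (by positivity)]
      have hxi : ‖x i‖ ≤ Real.pi / 2 ^ j := (norm_le_pi_norm x i).trans hx.1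
      rw [le_div_iff₀ (by positivity)] at hxi
      have h3 := norm_fourier_sub_one_ge (-(2 ^ j)) (x i) (by rw [h2]; linarith)
      rw [h2] at h3
      rw [← Pi.single_neg, character_single]
      refine le_trans ?_ h3
      have h4 := hx.2
      rw [div_lt_iff₀ (by positivity), pow_succ] at h4
      rw [div_mul_eq_mul_div, le_div_iff₀ Real.pi_pos]
      linarith
    rw [← ENNReal.pow_le_pow_left_iff two_ne_zero, ← ENNReal.ofReal_pow (by positivity),
      hδρ, mul_pow, Real.sq_sqrt (by positivity), Real.sq_sqrt hδ0.le]
    have h1 : ∫⁻ x in S j i, ‖trig D x‖ₑ ^ 2 ≤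
        ENNReal.ofReal ((2 * Real.pi) ^ q * (C₁ * N ^ q * δ ^ (2 * n + 1))) := by
      refine (setLIntegral_le_lintegral _ _).trans ?_
      rw [lintegral_trig_sq hDfin, ENNReal.ofReal_mul (p := (2 * Real.pi) ^ q) (by positivity),
        ENNReal.ofReal_pow hpi.le]
      gcongr
      exact hdiff J j hj.le i
    have hvol : volume (S j i) ≤ ENNReal.ofReal ((2 * (Real.pi / 2 ^ j)) ^ q) :=
      (measure_mono fun x hx => by
        rw [mem_closedBall_zero_iff]; exact hx.1).trans (volume_closedBall_le 0 (by positivity))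
    calc (∫⁻ x in S j i, ‖trig c x‖ₑ) ^ 2 ≤ (∫⁻ x in S j i, ‖trig D x‖ₑ) ^ 2 := by
          gcongr 1
          exact setLIntegral_mono' (hSmeas j i) hle
      _ ≤ volume (S j i) * ∫⁻ x in S j i, ‖trig D x‖ₑ ^ 2 :=
          sq_setLIntegral_le (continuous_trig hDfin).measurable.enorm
      _ ≤ ENNReal.ofReal ((2 * (Real.pi / 2 ^ j)) ^ q) *
          ENNReal.ofReal ((2 * Real.pi) ^ q * (C₁ * N ^ q * δ ^ (2 * n + 1))) := by
          gcongr
      _ ≤ ENNReal.ofReal (C₂ * δ) := by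
          rw [← ENNReal.ofReal_mul (by positivity)]
          refine ENNReal.ofReal_le_ofReal ?_
          -- Here q ≤ 2n enters. The volume 2^(−jq) times N^q cancels δ^q, and the one power of δ
          -- left over makes the sum over annuli geometric with ratio √(1/2).
          have h5 : δ ^ (2 * n + 1) ≤ δ ^ (q + 1) := pow_le_pow_of_le_one hδ0.le hδ1 (by omega)
          calc _ ≤ (2 * (Real.pi / 2 ^ j)) ^ q *
                ((2 * Real.pi) ^ q * (C₁ * N ^ q * δ ^ (q + 1))) := by gcongr
            _ = C₂ * δ := by
              rw [hC₂, hδ, mul_div_assoc', div_pow, pow_succ, div_pow]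
              field_simp
  have hcover : ∀ x : Torus q, ‖trig c x‖ₑ ≤ S₀.indicator (fun x => ‖trig c x‖ₑ) x +
      ∑ j ∈ Finset.range J, ∑ i, (S j i).indicator (fun x => ‖trig c x‖ₑ) x := by
    intro x
    by_cases hx : x ∈ S₀
    · rw [Set.indicator_of_mem hx]; exact le_self_add
    · have hnx : Real.pi / 2 ^ J < ‖x‖ := by simpa [hS₀] using hx
      have hle : ‖x‖ ≤ Real.pi := (pi_norm_le_iff_of_nonneg Real.pi_pos.le).mpr fun i => by
        have := AddCircle.norm_le_half_period (2 * Real.pi) (x := x i) Real.two_pi_pos.ne'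
        rw [abs_of_pos Real.two_pi_pos] at this
        linarith
      classical
      have hex : ∃ j : ℕ, Real.pi / 2 ^ j < ‖x‖ := ⟨J, hnx⟩
      set j := Nat.find hex with hj
      have h1 : Real.pi / 2 ^ j < ‖x‖ := Nat.find_spec hex
      have hjJ : j ≤ J := Nat.find_min' hex hnx
      have hj0 : j ≠ 0 := fun h0 => by
        rw [h0, pow_zero, div_one] at h1; linarith
      have h2 : ‖x‖ ≤ Real.pi / 2 ^ (j - 1) := not_lt.mp (Nat.find_min hex (by omega))
      have : Nonempty (Fin q) := ⟨⟨0, hq⟩⟩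
      obtain ⟨i, -, hi⟩ := Finset.exists_max_image Finset.univ (fun i => ‖x i‖)
        Finset.univ_nonempty
      have hxi : ‖x i‖ = ‖x‖ := le_antisymm (norm_le_pi_norm x i)
        ((pi_norm_le_iff_of_nonneg (norm_nonneg _)).mpr fun j => hi j (Finset.mem_univ j))
      have hmem : x ∈ S (j - 1) i := ⟨h2, by rw [hxi, Nat.sub_add_cancel (by omega)]; exact h1⟩
      refine le_trans ?_ le_add_self
      refine le_trans ?_ (Finset.single_le_sum (f := fun j =>
        ∑ i, (S j i).indicator (fun x => ‖trig c x‖ₑ) x) (fun _ _ => zero_le)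
        (Finset.mem_range.mpr (show j - 1 < J by omega)))
      refine le_trans ?_ (Finset.single_le_sum (f := fun i =>
        (S (j - 1) i).indicator (fun x => ‖trig c x‖ₑ) x) (fun _ _ => zero_le)
        (Finset.mem_univ i))
      rw [Set.indicator_of_mem hmem]
  refine (lintegral_mono hcover).trans ?_
  rw [lintegral_add_left (hmeas.indicator Metric.isClosed_closedBall.measurableSet),
    lintegral_finsetSum _ fun j _ => Finset.measurable_fun_sum _ fun i _ =>
      hmeas.indicator (hSmeas j i),
    lintegral_indicator Metric.isClosed_closedBall.measurableSet,
    ENNReal.ofReal_add (Real.sqrt_nonneg _) (by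
      have : 0 ≤ (1 - ρ)⁻¹ := inv_nonneg.mpr (by linarith)
      positivity)]
  refine add_le_add hcentre ?_
  calc ∑ j ∈ Finset.range J, ∫⁻ x, ∑ i, (S j i).indicator (fun x => ‖trig c x‖ₑ) x
      ≤ ∑ j ∈ Finset.range J, ENNReal.ofReal (q * (√C₂ * ρ ^ (J - j))) := by
        refine Finset.sum_le_sum fun j hj => ?_
        rw [lintegral_finsetSum _ fun i _ => hmeas.indicator (hSmeas j i)]
        refine (Finset.sum_le_card_nsmul _ _ (ENNReal.ofReal (√C₂ * ρ ^ (J - j)))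
          fun i _ => ?_).trans (le_of_eq ?_)
        · rw [lintegral_indicator (hSmeas j i)]
          exact hannulus j (Finset.mem_range.mp hj) i
        · rw [nsmul_eq_mul, ENNReal.ofReal_mul (Nat.cast_nonneg q), ENNReal.ofReal_natCast]
          simp
    _ = ENNReal.ofReal (q * (√C₂ * ∑ j ∈ Finset.range J, ρ ^ (J - j))) := by
        rw [← ENNReal.ofReal_sum_of_nonneg fun j _ => by positivity, Finset.mul_sum,
          Finset.mul_sum]
    _ ≤ _ := by
        refine ENNReal.ofReal_le_ofReal ?_
        gcongr
        rw [← tsum_geometric_of_lt_one hρ0 hρ1]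
        have h1 : ∑ j ∈ Finset.range J, ρ ^ (J - j) = ∑ j ∈ Finset.range J, ρ ^ (j + 1) := by
          rw [← Finset.sum_range_reflect]
          refine Finset.sum_congr rfl fun j hj => ?_
          have := Finset.mem_range.mp hj
          congr 1
          omega
        rw [h1]
        refine le_trans (Finset.sum_le_sum fun j _ =>
          pow_le_pow_of_le_one hρ0 hρ1.le (Nat.le_succ j)) ?_
        exact (summable_geometric_of_lt_one hρ0 hρ1).sum_le_tsum _ fun _ _ => by positivity

/-- For integers, q + 1 < 2Q means q ≤ 2(Q − 1), exactly the smoothness that the annulus argument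
requires. Dyadic scales suffice because N* is chosen as a power of two. -/
theorem exists_lintegral_filterKernel_le (hq : 1 ≤ q) {Q : ℕ} (hQ : ((q : ℝ) + 1) / 2 < Q)
    {h : ℝ → ℝ} (hh : IsLowPassFilter Q h) :
    ∃ C : ℝ, 0 ≤ C ∧ ∀ J : ℕ,
      ∫⁻ x : Torus q, ‖filterKernel h (2 ^ J) x‖ₑ ≤ ENNReal.ofReal C := by
  obtain ⟨hs, A, hA⟩ := hh.exists_smoothBV_comp_sqrt
  have h1 : q + 1 < 2 * Q := by
    rw [div_lt_iff₀ two_pos] at hQ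
    exact_mod_cast (by linarith : (q : ℝ) + 1 < 2 * Q)
  obtain ⟨C, hC, h⟩ := exists_lintegral_trig_radialCoeff_le (q := q) hq (n := Q - 1) (by omega) hs hA
  exact ⟨C, hC, fun J => by rw [filterKernel_eq_trig (by positivity)]; exact h J⟩

end Torus

/-! ### Smooth dyadic decomposition of the multiplier -/

/-- A smooth function equal to `1` on `(-∞, 1/2]` and to `0` on `[1, ∞)`. -/
noncomputable def smoothCutoff (t : ℝ) : ℝ := Real.smoothTransition (2 - 2 * t)

theorem smoothCutoff_of_le {t : ℝ} (ht : t ≤ 1 / 2) : smoothCutoff t = 1 :=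
  Real.smoothTransition.one_of_one_le (by linarith)

theorem smoothCutoff_of_ge {t : ℝ} (ht : 1 ≤ t) : smoothCutoff t = 0 :=
  Real.smoothTransition.zero_of_nonpos (by linarith)

theorem smoothCutoff_nonneg (t : ℝ) : 0 ≤ smoothCutoff t := Real.smoothTransition.nonneg _

theorem contDiff_smoothCutoff {n : ℕ∞} : ContDiff ℝ n smoothCutoff :=
  Real.smoothTransition.contDiff.comp (contDiff_const.sub (contDiff_const.mul contDiff_id))

theorem cutoffShape_smoothCutoff : CutoffShape smoothCutoff :=
  ⟨⟨1, fun _ hx => smoothCutoff_of_le (by linarith)⟩, fun _ hx => smoothCutoff_of_ge (by linarith)⟩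

/-- The difference of two consecutive dyadic dilates of `smoothCutoff`. -/
noncomputable def smoothBand (t : ℝ) : ℝ := smoothCutoff (t / 4) - smoothCutoff t

theorem smoothBand_of_le {t : ℝ} (ht : t ≤ 1 / 2) : smoothBand t = 0 := by
  rw [smoothBand, smoothCutoff_of_le ht, smoothCutoff_of_le (by linarith), sub_self]

theorem smoothBand_of_ge {t : ℝ} (ht : 4 ≤ t) : smoothBand t = 0 := by
  rw [smoothBand, smoothCutoff_of_ge (by linarith), smoothCutoff_of_ge (by linarith), sub_self]

theorem contDiff_smoothBand {n : ℕ∞} : ContDiff ℝ n smoothBand :=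
  (contDiff_smoothCutoff.comp (contDiff_id.div_const 4)).sub contDiff_smoothCutoff

theorem cutoffShape_smoothBand : CutoffShape smoothBand :=
  ⟨⟨0, fun _ hx => smoothBand_of_le (by linarith)⟩, fun _ hx => smoothBand_of_ge hx.le⟩

namespace Torus

variable {q : ℕ}

/-- The coefficients `(1 + ‖k‖²)^{σ/2}` cut off at frequency `2 ^ n`. -/
noncomputable def lowCoeff (σ : ℝ) (n : ℕ) (k : Fin q → ℤ) : ℂ :=
  ((smoothCutoff (freqNorm k ^ 2 / (2 ^ n) ^ 2) * (freqNorm k ^ 2 + 1) ^ (σ / 2) : ℝ) : ℂ)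

/-- The coefficients `(1 + ‖k‖²)^{σ/2}` localized to frequencies of order `2 ^ n`. -/
noncomputable def bandCoeff (σ : ℝ) (n : ℕ) (k : Fin q → ℤ) : ℂ :=
  ((smoothBand (freqNorm k ^ 2 / (2 ^ n) ^ 2) * (freqNorm k ^ 2 + 1) ^ (σ / 2) : ℝ) : ℂ)

theorem support_mul_radialCoeff_finite {G : ℝ → ℝ} (hG : ∀ x > 4, G x = 0) (n : ℕ)
    {F : (Fin q → ℤ) → ℝ} :
    (Function.support fun k : Fin q → ℤ =>
      ((G (freqNorm k ^ 2 / (2 ^ n) ^ 2) * F k : ℝ) : ℂ)).Finite := by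
  have h := support_radialCoeff_finite (q := q) hG (show 0 < 2 ^ n by positivity)
  refine h.subset fun k hk hk' => hk ?_
  simp only [radialCoeff, Complex.ofReal_eq_zero] at hk'
  push_cast at hk'
  simp only [hk', zero_mul, Complex.ofReal_zero]

theorem support_lowCoeff_finite (σ : ℝ) (n : ℕ) :
    (Function.support (lowCoeff σ n : (Fin q → ℤ) → ℂ)).Finite :=
  support_mul_radialCoeff_finite cutoffShape_smoothCutoff.2 n

theorem support_bandCoeff_finite (σ : ℝ) (n : ℕ) :
    (Function.support (bandCoeff σ n : (Fin q → ℤ) → ℂ)).Finite :=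
  support_mul_radialCoeff_finite cutoffShape_smoothBand.2 n

theorem lowCoeff_succ (σ : ℝ) (n : ℕ) (k : Fin q → ℤ) :
    lowCoeff σ (n + 1) k = lowCoeff σ n k + bandCoeff σ n k := by
  unfold lowCoeff bandCoeff smoothBand
  have h : ((2 : ℝ) ^ (n + 1)) ^ 2 = (2 ^ n) ^ 2 * 4 := by ring
  rw [← Complex.ofReal_add, ← add_mul, add_sub_cancel, div_div, h]

theorem one_le_freqNorm_sq {k : Fin q → ℤ} (hk : k ≠ 0) : 1 ≤ freqNorm k ^ 2 := by
  obtain ⟨i, hi⟩ := Function.ne_iff.mp hk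
  have h1 : 1 ≤ |(k i : ℝ)| := by exact_mod_cast Int.one_le_abs hi
  have := h1.trans (abs_le_freqNorm k i)
  nlinarith

theorem freqNorm_zero : freqNorm (0 : Fin q → ℤ) = 0 := by simp [freqNorm]

theorem lowCoeff_zero (σ : ℝ) (k : Fin q → ℤ) : lowCoeff σ 0 k = if k = 0 then 1 else 0 := by
  unfold lowCoeff
  split_ifs with h
  · subst h
    rw [freqNorm_zero, smoothCutoff_of_le (by norm_num)]
    norm_num
  · rw [smoothCutoff_of_ge (by simpa using one_le_freqNorm_sq h)]
    simp

theorem lowCoeff_of_le {σ : ℝ} {n : ℕ} {k : Fin q → ℤ}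
    (h : freqNorm k ^ 2 / (2 ^ n) ^ 2 ≤ 1 / 2) :
    lowCoeff σ n k = (((freqNorm k ^ 2 + 1) ^ (σ / 2) : ℝ) : ℂ) := by
  rw [lowCoeff, smoothCutoff_of_le h, one_mul]

theorem eventually_lowCoeff_eq (σ : ℝ) (k : Fin q → ℤ) :
    ∀ᶠ n in Filter.atTop, lowCoeff σ n k = (((freqNorm k ^ 2 + 1) ^ (σ / 2) : ℝ) : ℂ) := by
  obtain ⟨N, hN⟩ := pow_unbounded_of_one_lt (2 * freqNorm k ^ 2) (one_lt_two (α := ℝ))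
  filter_upwards [Filter.eventually_ge_atTop N] with n hn
  refine lowCoeff_of_le ?_
  have h1 : (2 : ℝ) ^ N ≤ 2 ^ n := pow_le_pow_right₀ one_le_two hn
  have h2 : (1 : ℝ) ≤ 2 ^ n := one_le_pow₀ one_le_two
  rw [div_le_iff₀ (by positivity)]
  nlinarith

theorem trig_lowCoeff_succ (σ : ℝ) (n : ℕ) (x : Torus q) :
    trig (lowCoeff σ (n + 1)) x = trig (lowCoeff σ n) x + trig (bandCoeff σ n) x := by
  unfold trig
  rw [← (summable_trig (support_lowCoeff_finite σ n) x).tsum_add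
    (summable_trig (support_bandCoeff_finite σ n) x)]
  simp_rw [lowCoeff_succ, add_mul]

theorem trig_lowCoeff_zero (σ : ℝ) (x : Torus q) : trig (lowCoeff σ 0) x = 1 := by
  unfold trig
  rw [tsum_eq_single 0 fun k hk => by rw [lowCoeff_zero, if_neg hk, zero_mul], lowCoeff_zero,
    if_pos rfl, character_zero, one_mul]

theorem trig_lowCoeff_add (σ : ℝ) (n J : ℕ) (x : Torus q) :
    trig (lowCoeff σ (n + J)) x =
      trig (lowCoeff σ n) x + ∑ j ∈ Finset.range J, trig (bandCoeff σ (n + j)) x := by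
  induction J with
  | zero => simp
  | succ J ih => rw [← add_assoc, trig_lowCoeff_succ, ih, Finset.sum_range_succ, add_assoc]

/-- With N = 2^n and u = ‖k‖²/N², one has (‖k‖² + 1)^(σ/2) = N^σ (u + N^(−2))^(σ/2). On the band 1/2
< u < 4 the argument u + N^(−2) stays in [1/16, 16], so the power may be replaced by a smooth
compactly supported κ. -/
theorem bandCoeff_eq (σ : ℝ) {κ : ℝ → ℝ} (hκ : ∀ x, 1 / 16 ≤ x → x ≤ 16 → κ x = x ^ (σ / 2))
    (n : ℕ) (k : Fin q → ℤ) :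
    bandCoeff σ n k = ((((2 : ℝ) ^ n) ^ σ : ℝ) : ℂ) *
      radialCoeff (fun u => smoothBand u * κ (u + ((2 ^ n) ^ 2)⁻¹)) (2 ^ n) k := by
  unfold bandCoeff radialCoeff
  rw [← Complex.ofReal_mul]
  congr 1
  set N : ℝ := 2 ^ n with hN
  have hN1 : 1 ≤ N := one_le_pow₀ one_le_two
  have hN0 : 0 < N := by positivity
  set u := freqNorm k ^ 2 / N ^ 2 with hu
  simp only
  by_cases h1 : u ≤ 1 / 2
  · rw [smoothBand_of_le h1]; ring
  by_cases h2 : 4 ≤ u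
  · rw [smoothBand_of_ge h2]; ring
  push Not at h1 h2
  have h3 : (N ^ 2)⁻¹ ≤ 1 := inv_le_one_of_one_le₀ (one_le_pow₀ hN1)
  have h4 : 0 < (N ^ 2)⁻¹ := by positivity
  rw [hκ _ (by linarith) (by linarith)]
  have h5 : freqNorm k ^ 2 + 1 = N ^ 2 * (u + (N ^ 2)⁻¹) := by
    rw [hu]; field_simp
  have h6 : (N ^ 2) ^ (σ / 2) = N ^ σ := by
    rw [← Real.rpow_natCast_mul hN0.le]; congr 1; push_cast; ring
  rw [h5, Real.mul_rpow (by positivity) (by positivity), h6]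
  ring

/-- The profiles for different n differ only by a translation of κ, which leaves the smoothness
bounds unchanged; hence one constant serves all n. -/
theorem exists_norm_trig_bandCoeff_le (hq : 1 ≤ q) (σ : ℝ) :
    ∃ C, 0 < C ∧ ∀ (n : ℕ) (x : Torus q), ‖trig (bandCoeff σ n) x‖ ≤
      C * ((2 : ℝ) ^ n) ^ σ * (2 ^ n) ^ q * decayWeight (2 ^ n) x := by
  obtain ⟨κ, hκ1, hκ2, hκ3⟩ := exists_contDiff_eqOn (F := fun x => x ^ (σ / 2)) (n := ⊤)
    (fun x hx => Real.contDiffAt_rpow_const_of_ne hx.ne')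
  obtain ⟨A, hA⟩ := exists_smoothBV_of_contDiff_succ (n := q + 1) hκ2
    (hκ1.of_le (by exact_mod_cast le_top))
  obtain ⟨B, hB⟩ := exists_smoothBV_of_contDiff_succ (n := q + 1)
    cutoffShape_smoothBand.eventuallyConstant
    ((contDiff_smoothBand (n := ⊤)).of_le (by exact_mod_cast le_top))
  obtain ⟨C, hC0, hC⟩ := exists_norm_trig_radialCoeff_le hq (2 ^ (q + 1 + 1) * (B * A))
  refine ⟨C, hC0, fun n x => ?_⟩
  have h1 : trig (bandCoeff σ n) x = ((((2 : ℝ) ^ n) ^ σ : ℝ) : ℂ) *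
      trig (radialCoeff (fun u => smoothBand u * κ (u + ((2 ^ n) ^ 2)⁻¹)) (2 ^ n)) x := by
    rw [← trig_const_mul]
    exact congrArg (fun c => trig c x) (funext fun k => bandCoeff_eq σ hκ3 n k)
  rw [h1, norm_mul, Complex.norm_real, Real.norm_of_nonneg (by positivity)]
  have h2 := hC (fun u => smoothBand u * κ (u + ((2 ^ n) ^ 2)⁻¹))
    ⟨⟨0, fun u hu => by simp only [smoothBand_of_le (show u ≤ 1 / 2 by linarith), zero_mul]⟩,
      fun u hu => by simp only [smoothBand_of_ge (le_of_lt hu), zero_mul]⟩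
    (hB.mul (hA.comp_add_const _)) n x
  calc _ ≤ ((2 : ℝ) ^ n) ^ σ * (C * (2 ^ n) ^ q * decayWeight (2 ^ n) x) := by gcongr
    _ = _ := by ring

theorem exists_norm_trig_smoothCutoff_le (hq : 1 ≤ q) :
    ∃ C, 0 < C ∧ ∀ (n : ℕ) (x : Torus q), ‖trig (lowCoeff 0 n) x‖ ≤
      C * (2 ^ n) ^ q * decayWeight (2 ^ n) x := by
  obtain ⟨B, hB⟩ := exists_smoothBV_of_contDiff_succ (n := q + 1)
    cutoffShape_smoothCutoff.eventuallyConstant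
    ((contDiff_smoothCutoff (n := ⊤)).of_le (by exact_mod_cast le_top))
  obtain ⟨C, hC0, hC⟩ := exists_norm_trig_radialCoeff_le hq B
  refine ⟨C, hC0, fun n x => ?_⟩
  have h1 : (lowCoeff 0 n : (Fin q → ℤ) → ℂ) = radialCoeff smoothCutoff (2 ^ n) := by
    ext k
    rw [lowCoeff, radialCoeff, zero_div, Real.rpow_zero, mul_one]
  rw [h1]
  exact hC _ cutoffShape_smoothCutoff hB n x

/-- At the origin all terms are nonnegative, so it suffices to count frequencies where the cutoff
equals 1. Coordinates up to N/(2q) qualify, since then ‖k‖² ≤ N²/(4q) ≤ N²/2. This bounds the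
diagonal of the sampling matrix from below. -/
theorem norm_trig_lowCoeff_zero_at_zero_ge (hq : 1 ≤ q) (n : ℕ) :
    ((2 : ℝ) ^ n) ^ q / (2 * q) ^ q ≤ ‖trig (lowCoeff 0 n) (0 : Torus q)‖ := by
  have hfin := support_lowCoeff_finite (q := q) 0 n
  have hq' : (1 : ℝ) ≤ q := by exact_mod_cast hq
  set N : ℝ := 2 ^ n with hN
  have hN0 : 0 < N := by positivity
  set R : ℕ := ⌊N / (2 * q)⌋₊ with hR
  have hR1 : (R : ℝ) ≤ N / (2 * q) := Nat.floor_le (by positivity)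
  have hR2 : N / (2 * q) < R + 1 := Nat.lt_floor_add_one _
  have hone : ∀ k ∈ frequencyBox q R, (lowCoeff 0 n k : ℂ) = 1 := by
    intro k hk
    rw [mem_frequencyBox] at hk
    rw [lowCoeff_of_le, zero_div, Real.rpow_zero, Complex.ofReal_one]
    rw [← hN, div_le_iff₀ (by positivity), freqNorm_sq]
    calc ∑ i, (k i : ℝ) ^ 2 ≤ ∑ _i : Fin q, (N / (2 * q)) ^ 2 :=
          Finset.sum_le_sum fun i _ => by
            rw [← sq_abs]
            have : |(k i : ℝ)| ≤ R := by exact_mod_cast hk i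
            exact pow_le_pow_left₀ (abs_nonneg _) (this.trans hR1) 2
      _ = q * (N / (2 * q)) ^ 2 := by simp
      _ = N ^ 2 / (4 * q) := by field_simp; norm_num
      _ ≤ 1 / 2 * N ^ 2 := by
          rw [div_le_iff₀ (by positivity)]
          nlinarith [sq_nonneg N]
  have hreal : trig (lowCoeff 0 n) (0 : Torus q) =
      ((∑ k ∈ hfin.toFinset, smoothCutoff (freqNorm k ^ 2 / N ^ 2) : ℝ) : ℂ) := by
    rw [trig_eq_sum_toFinset hfin, Complex.ofReal_sum]
    refine Finset.sum_congr rfl fun k _ => ?_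
    rw [character_at_zero, mul_one, lowCoeff, zero_div, Real.rpow_zero, mul_one]
  have hsub : frequencyBox q R ⊆ hfin.toFinset := fun k hk => by
    rw [Set.Finite.mem_toFinset, Function.mem_support, hone k hk]
    exact one_ne_zero
  rw [hreal, Complex.norm_real, Real.norm_of_nonneg
    (Finset.sum_nonneg fun _ _ => smoothCutoff_nonneg _)]
  calc N ^ q / (2 * q) ^ q = (N / (2 * q)) ^ q := by rw [div_pow]
    _ ≤ ((2 * R + 1 : ℕ) : ℝ) ^ q := by
        refine pow_le_pow_left₀ (by positivity) ?_ _
        push_cast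
        have : (0 : ℝ) ≤ R := Nat.cast_nonneg R
        linarith
    _ = ∑ k ∈ frequencyBox q R, smoothCutoff (freqNorm k ^ 2 / N ^ 2) := by
        rw [Finset.sum_congr rfl (g := fun _ => (1 : ℝ)), Finset.sum_const, card_frequencyBox]
        · simp
        · intro k hk
          have := hone k hk
          rw [lowCoeff, zero_div, Real.rpow_zero, mul_one] at this
          exact Complex.ofReal_eq_one.mp this
    _ ≤ _ := Finset.sum_le_sum_of_subset_of_nonneg hsub fun _ _ _ => smoothCutoff_nonneg _

/-! ### Synthesis and sampling with localized kernels -/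

theorem lintegral_enorm_le_of_decay {φ : Torus q → ℂ} {C t : ℝ} (hC : 0 ≤ C) (ht : 0 < t)
    (h : ∀ x, ‖φ x‖ ≤ C * t ^ q * decayWeight t x) :
    ∫⁻ x, ‖φ x‖ₑ ≤ ENNReal.ofReal (C * (2 * 4 ^ q)) := by
  calc ∫⁻ x, ‖φ x‖ₑ ≤ ∫⁻ x : Torus q, ENNReal.ofReal (C * t ^ q) *
        ENNReal.ofReal (decayWeight t x) := lintegral_mono fun x => by
          rw [← ofReal_norm, ← ENNReal.ofReal_mul (by positivity)]
          exact ENNReal.ofReal_le_ofReal (h x)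
    _ = ENNReal.ofReal (C * t ^ q) * ∫⁻ x : Torus q, ENNReal.ofReal (decayWeight t x) :=
        lintegral_const_mul _ (continuous_decayWeight ht.le).measurable.ennreal_ofReal
    _ ≤ ENNReal.ofReal (C * t ^ q) * ENNReal.ofReal (2 * 4 ^ q * (t ^ q)⁻¹) := by
        gcongr
        exact lintegral_decayWeight_le ht
    _ = _ := by
        rw [← ENNReal.ofReal_mul (by positivity)]
        congr 1
        field_simp

theorem sum_norm_sub_le_of_decay {φ : Torus q → ℂ} {C t δ : ℝ} (hC : 0 ≤ C) (ht : 0 < t)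
    (h : ∀ x, ‖φ x‖ ≤ C * t ^ q * decayWeight t x) {M : ℕ} {y : Fin M → Torus q} (hδ : 0 < δ)
    (hδ1 : δ ≤ 1) (hy : ∀ j k, j ≠ k → δ ≤ ‖y j - y k‖) (x : Torus q) :
    ∑ j, ‖φ (x - y j)‖ ≤ C * (4 * 12 ^ q) * (t + δ⁻¹) ^ q := by
  calc ∑ j, ‖φ (x - y j)‖ ≤ ∑ j, C * t ^ q * decayWeight t (x - y j) :=
        Finset.sum_le_sum fun j _ => h _
    _ = C * t ^ q * ∑ j, decayWeight t (x - y j) := by rw [Finset.mul_sum]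
    _ ≤ C * t ^ q * (4 * 12 ^ q * (1 + (t * δ)⁻¹) ^ q) := by
        gcongr
        exact sum_decayWeight_le hδ hδ1 ht hy x
    _ = C * (4 * 12 ^ q) * (t * (1 + (t * δ)⁻¹)) ^ q := by rw [mul_pow]; ring
    _ = _ := by
        congr 2
        field_simp

theorem sum_enorm_eq_ofReal {ι : Type*} (s : Finset ι) (f : ι → ℂ) :
    ∑ i ∈ s, ‖f i‖ₑ = ENNReal.ofReal (∑ i ∈ s, ‖f i‖) := by
  rw [ENNReal.ofReal_sum_of_nonneg fun _ _ => norm_nonneg _]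
  simp_rw [ofReal_norm]

theorem inv_toReal_le_one {r : ℝ≥0∞} (hr : 1 ≤ r) : (r⁻¹).toReal ≤ 1 := by
  rw [← ENNReal.toReal_one]
  exact ENNReal.toReal_mono ENNReal.one_ne_top (ENNReal.inv_le_one.mpr hr)

theorem ofReal_rpow_mul_rpow {A B : ℝ} (hA : 0 ≤ A) (hB : 0 ≤ B) {r : ℝ≥0∞} (hr : 1 ≤ r) :
    ENNReal.ofReal A ^ (r⁻¹).toReal * ENNReal.ofReal B ^ (1 - (r⁻¹).toReal) =
      ENNReal.ofReal (A ^ (r⁻¹).toReal * B ^ (1 - (r⁻¹).toReal)) := by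
  have := inv_toReal_le_one hr
  rw [ENNReal.ofReal_mul (by positivity),
    ENNReal.ofReal_rpow_of_nonneg hA ENNReal.toReal_nonneg,
    ENNReal.ofReal_rpow_of_nonneg hB (by linarith)]

/-- Linear combinations of translates of a localized kernel. -/
theorem eLpNorm_translateSum_le {φ : Torus q → ℂ} (hφ : Measurable φ) {A B : ℝ} (hA : 0 ≤ A)
    (hB : 0 ≤ B) {M : ℕ} {y : Fin M → Torus q} (hφA : ∫⁻ x, ‖φ x‖ₑ ≤ ENNReal.ofReal A)
    (hφB : ∀ x, ∑ j, ‖φ (x - y j)‖ ≤ B) {r : ℝ≥0∞} (hr : 1 ≤ r) (a : Fin M → ℝ) :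
    eLpNorm (translateSum φ a y) r volume ≤
      ENNReal.ofReal (A ^ (r⁻¹).toReal * B ^ (1 - (r⁻¹).toReal)) *
        eLpNorm a r Measure.count := by
  rw [← ofReal_rpow_mul_rpow hA hB hr]
  refine eLpNorm_le_of_schur (k := fun x j => ‖φ (x - y j)‖ₑ) ?_
    (measurable_of_countable a).aestronglyMeasurable (fun x => ?_) (fun j => ?_) (fun x => ?_) hr
  · exact measurable_from_prod_countable_left fun j => (hφ.comp (measurable_id.sub_const (y j))).enorm
  · rw [lintegral_count, tsum_fintype, translateSum]
    refine (enorm_sum_le _ _).trans (Finset.sum_le_sum fun j _ => ?_)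
    rw [enorm_mul, mul_comm, ← ofReal_norm (a j : ℂ), Complex.norm_real, ofReal_norm]
  · rw [lintegral_sub_right_eq_self (fun x : Torus q => ‖φ x‖ₑ) (y j)]
    exact hφA
  · rw [lintegral_count, tsum_fintype, sum_enorm_eq_ofReal]
    exact ENNReal.ofReal_le_ofReal (hφB x)

/-- Sampling a convolution with a localized kernel. -/
theorem eLpNorm_sampling_le {φ : Torus q → ℂ} (hφ : Measurable φ) {A B : ℝ} (hA : 0 ≤ A)
    (hB : 0 ≤ B) {M : ℕ} {y : Fin M → Torus q} (hφA : ∫⁻ x, ‖φ x‖ₑ ≤ ENNReal.ofReal A)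
    (hφB : ∀ x, ∑ j, ‖φ (y j - x)‖ ≤ B) {r : ℝ≥0∞} (hr : 1 ≤ r) {f : Torus q → ℂ}
    (hf : AEStronglyMeasurable f volume) :
    eLpNorm (fun j => ∫ x, f x * φ (y j - x)) r Measure.count ≤
      ENNReal.ofReal (B ^ (r⁻¹).toReal * A ^ (1 - (r⁻¹).toReal)) * eLpNorm f r volume := by
  rw [← ofReal_rpow_mul_rpow hB hA hr]
  refine eLpNorm_le_of_schur (k := fun j x => ‖φ (y j - x)‖ₑ) ?_ hf (fun j => ?_) (fun x => ?_)
    (fun j => ?_) hr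
  · exact measurable_from_prod_countable_right fun j =>
      (hφ.comp (measurable_id.const_sub (y j))).enorm
  · refine (enorm_integral_le_lintegral_enorm _).trans (le_of_eq ?_)
    simp_rw [enorm_mul, mul_comm]
  · rw [lintegral_count, tsum_fintype, sum_enorm_eq_ofReal]
    exact ENNReal.ofReal_le_ofReal (hφB x)
  · rw [lintegral_sub_left_eq_self (fun x : Torus q => ‖φ x‖ₑ) (y j)]
    exact hφA

/-- Symmetric matrices with small row sums. -/
theorem eLpNorm_matrix_le {M : ℕ} {E : Fin M → Fin M → ℂ} {B : ℝ}
    (hrow : ∀ i, ∑ j, ‖E i j‖ ≤ B) (hcol : ∀ j, ∑ i, ‖E i j‖ ≤ B) {r : ℝ≥0∞} (hr : 1 ≤ r)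
    (a : Fin M → ℝ) :
    eLpNorm (fun i => ∑ j, (a j : ℂ) * E i j) r Measure.count ≤
      ENNReal.ofReal B * eLpNorm a r Measure.count := by
  have hθ := inv_toReal_le_one hr
  have h : ENNReal.ofReal B = ENNReal.ofReal B ^ (r⁻¹).toReal *
      ENNReal.ofReal B ^ (1 - (r⁻¹).toReal) := by
    rw [← ENNReal.rpow_add_of_nonneg _ _ ENNReal.toReal_nonneg (by linarith),
      add_sub_cancel, ENNReal.rpow_one]
  rw [h]
  refine eLpNorm_le_of_schur (k := fun i j => ‖E i j‖ₑ) (measurable_of_countable _)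
    (measurable_of_countable a).aestronglyMeasurable (fun i => ?_) (fun j => ?_) (fun i => ?_) hr
  · rw [lintegral_count, tsum_fintype]
    refine (enorm_sum_le _ _).trans (Finset.sum_le_sum fun j _ => ?_)
    rw [enorm_mul, mul_comm, ← ofReal_norm (a j : ℂ), Complex.norm_real, ofReal_norm]
  · rw [lintegral_count, tsum_fintype, sum_enorm_eq_ofReal]
    exact ENNReal.ofReal_le_ofReal (hcol j)
  · rw [lintegral_count, tsum_fintype, sum_enorm_eq_ofReal]
    exact ENNReal.ofReal_le_ofReal (hrow i)

theorem volume_singleton (hq : 1 ≤ q) (x : Torus q) : volume {x} = 0 := by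
  rw [← Metric.closedBall_zero]
  refine le_antisymm ((volume_closedBall_le x le_rfl).trans ?_) (zero_le)
  rw [mul_zero, zero_pow (by omega), ENNReal.ofReal_zero]

theorem ae_ne (hq : 1 ≤ q) (y : Torus q) : ∀ᵐ x : Torus q, x ≠ y := by
  rw [ae_iff]
  simpa using volume_singleton hq y

/-! ### The Sobolev kernel and its high-frequency tail -/

/-- The Sobolev kernel of order `s`, as a sum of dyadic blocks. -/
noncomputable def sobolevKernel (s : ℝ) (x : Torus q) : ℂ := 1 + ∑' j, trig (bandCoeff (-s) j) x

theorem rpow_dyadic (e : ℝ) (j : ℕ) : ((2 : ℝ) ^ j) ^ e = ((2 : ℝ) ^ e) ^ j :=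
  (Real.rpow_pow_comm zero_le_two e j).symm

/-- Away from the origin the decay of order q + 1 beats the amplitude 2^(jq) by a factor 2^(−j). -/
theorem summable_trig_bandCoeff (hq : 1 ≤ q) {s : ℝ} (hs : 0 < s) {x : Torus q} (hx : x ≠ 0) :
    Summable fun j => trig (bandCoeff (-s) j) x := by
  obtain ⟨C, hC, h⟩ := exists_norm_trig_bandCoeff_le hq (-s)
  have hx0 : 0 < ‖x‖ := norm_pos_iff.mpr hx
  refine Summable.of_norm_bounded (g := fun j => C * (‖x‖ ^ (q + 1))⁻¹ * (1 / 2) ^ j)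
    (summable_geometric_two.mul_left _) fun j => (h j x).trans ?_
  have h1 : ((2 : ℝ) ^ j) ^ (-s) ≤ 1 :=
    Real.rpow_le_one_of_one_le_of_nonpos (one_le_pow₀ one_le_two) (by linarith)
  have h2 : decayWeight (2 ^ j) x ≤ (((2 : ℝ) ^ j * ‖x‖) ^ (q + 1))⁻¹ := by
    unfold decayWeight
    refine inv_anti₀ (by positivity) (pow_le_pow_left₀ (by positivity) (by linarith) _)
  calc C * ((2 : ℝ) ^ j) ^ (-s) * (2 ^ j) ^ q * decayWeight (2 ^ j) x
      ≤ C * 1 * (2 ^ j) ^ q * (((2 : ℝ) ^ j * ‖x‖) ^ (q + 1))⁻¹ := by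
        gcongr
        exact decayWeight_nonneg (by positivity) x
    _ = _ := by
      rw [mul_pow, pow_succ (2 ^ j), one_div, inv_pow]
      field_simp

theorem hasSum_sobolevKernel_sub (hq : 1 ≤ q) {s : ℝ} (hs : 0 < s) {x : Torus q} (hx : x ≠ 0)
    (n : ℕ) : HasSum (fun j => trig (bandCoeff (-s) (n + j)) x)
      (sobolevKernel s x - trig (lowCoeff (-s) n) x) := by
  have h := (summable_trig_bandCoeff hq hs hx).hasSum
  rw [← hasSum_nat_add_iff' n] at h
  have h1 := trig_lowCoeff_add (-s) 0 n x
  rw [zero_add, trig_lowCoeff_zero] at h1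
  simp only [zero_add] at h1
  rw [h1, sobolevKernel, add_sub_add_left_eq_sub]
  simpa only [add_comm n] using h

theorem tendsto_sobolevKernel (hq : 1 ≤ q) {s : ℝ} (hs : 0 < s) {x : Torus q} (hx : x ≠ 0) :
    Filter.Tendsto (fun n => trig (lowCoeff (-s) n) x) Filter.atTop (nhds (sobolevKernel s x)) := by
  have h := ((hasSum_sobolevKernel_sub hq hs hx 0).tendsto_sum_nat).const_add 1
  rw [trig_lowCoeff_zero, add_sub_cancel] at h
  refine h.congr fun n => ?_
  have h1 := trig_lowCoeff_add (-s) 0 n x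
  rw [zero_add, trig_lowCoeff_zero] at h1
  exact h1.symm

theorem aestronglyMeasurable_sobolevKernel (hq : 1 ≤ q) {s : ℝ} (hs : 0 < s) :
    AEStronglyMeasurable (sobolevKernel s : Torus q → ℂ) volume :=
  aestronglyMeasurable_of_tendsto_ae Filter.atTop
    (fun n => (continuous_trig (support_lowCoeff_finite (-s) n)).aestronglyMeasurable)
    ((ae_ne hq 0).mono fun _ hx => tendsto_sobolevKernel hq hs hx)

/-- The high-frequency part of a linear combination of translates of the Sobolev kernel. -/
theorem exists_eLpNorm_translateSum_sub_le (hq : 1 ≤ q) {r : ℝ≥0∞} (hr : 1 ≤ r) {s : ℝ}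
    (hs : (q : ℝ) * (1 - (r⁻¹).toReal) < s) (D : ℝ) (hD : 0 ≤ D) :
    ∃ C, 0 ≤ C ∧ ∀ (n M : ℕ) (y : Fin M → Torus q) (δ : ℝ), 0 < δ → δ ≤ 1 → δ⁻¹ ≤ D * 2 ^ n →
      (∀ j k, j ≠ k → δ ≤ ‖y j - y k‖) → ∀ a : Fin M → ℝ,
      eLpNorm (translateSum (fun x => sobolevKernel s x - trig (lowCoeff (-s) n) x) a y) r volume ≤
        ENNReal.ofReal (C * ((2 : ℝ) ^ n) ^ (-(s - q * (1 - (r⁻¹).toReal)))) *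
          eLpNorm a r Measure.count := by
  set θ := (r⁻¹).toReal with hθ
  have hθ0 : 0 ≤ θ := ENNReal.toReal_nonneg
  have hθ1 : θ ≤ 1 := inv_toReal_le_one hr
  set e := s - q * (1 - θ) with he
  have he0 : 0 < e := by linarith
  have hs0 : 0 < s := lt_of_le_of_lt (mul_nonneg (Nat.cast_nonneg q) (by linarith)) hs
  obtain ⟨C₀, hC₀, hband⟩ := exists_norm_trig_bandCoeff_le hq (-s)
  set C₁ := C₀ * (2 * 4 ^ q) with hC₁
  set C₂ := C₀ * (4 * 12 ^ q) * (1 + D) ^ q with hC₂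
  set C₃ := C₁ ^ θ * C₂ ^ (1 - θ) with hC₃
  set β : ℝ := 2 ^ (-e) with hβ
  have hβ0 : 0 < β := by positivity
  have hβ1 : β < 1 := Real.rpow_lt_one_of_one_lt_of_neg one_lt_two (by linarith)
  refine ⟨C₃ * (1 - β)⁻¹, by have := sub_pos.mpr hβ1; positivity,
    fun n M y δ hδ hδ1 hδn hy a => ?_⟩
  -- The band has L¹ norm at most C₁N^(−s) and node sums at most C₂N^(q−s), the latter because 1/δ ≤
  -- D N. Interpolation with weights θ and 1 − θ gives N^(−e) = β^(n+j).
  have hpart : ∀ j, eLpNorm (translateSum (trig (bandCoeff (-s) (n + j))) a y) r volume ≤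
      ENNReal.ofReal (C₃ * β ^ (n + j)) * eLpNorm a r Measure.count := by
    intro j
    set N : ℝ := 2 ^ (n + j) with hN
    have hN0 : 0 < N := by positivity
    have hnN : (2 : ℝ) ^ n ≤ N := pow_le_pow_right₀ one_le_two (Nat.le_add_right n j)
    set u : ℝ := N ^ (-s) with hu
    have hu0 : 0 < u := by positivity
    refine (eLpNorm_translateSum_le (A := C₁ * u) (B := C₂ * u * N ^ q)
      (continuous_trig (support_bandCoeff_finite _ _)).measurable (by positivity) (by positivity)
      ?_ (fun x => ?_) hr a).trans (le_of_eq ?_)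
    · refine (lintegral_enorm_le_of_decay (C := C₀ * u) (by positivity) hN0
        (hband (n + j))).trans (le_of_eq ?_)
      rw [hC₁]; ring_nf
    · refine (sum_norm_sub_le_of_decay (C := C₀ * u) (by positivity) hN0 (hband (n + j)) hδ hδ1 hy
        x).trans ?_
      have h1 : N + δ⁻¹ ≤ (1 + D) * N := by
        have := mul_le_mul_of_nonneg_left hnN hD
        linarith
      calc C₀ * u * (4 * 12 ^ q) * (N + δ⁻¹) ^ q
          ≤ C₀ * u * (4 * 12 ^ q) * ((1 + D) * N) ^ q := by gcongr
        _ = _ := by rw [mul_pow, hC₂]; ring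
    · congr 2
      rw [← hθ, Real.mul_rpow (x := C₁) (by positivity) hu0.le,
        Real.mul_rpow (x := C₂ * u) (by positivity) (by positivity),
        Real.mul_rpow (x := C₂) (by positivity) hu0.le, hC₃]
      have h1 : u ^ θ * (u ^ (1 - θ) * (N ^ q) ^ (1 - θ)) = β ^ (n + j) := by
        rw [← mul_assoc, ← Real.rpow_add hu0, add_sub_cancel, Real.rpow_one, hu,
          ← Real.rpow_natCast_mul hN0.le, ← Real.rpow_add hN0, hβ, ← rpow_dyadic]
        congr 1
        rw [he]; ring
      rw [← h1]; ring
  have hfin : ∀ J, eLpNorm (fun x => ∑ j ∈ Finset.range J,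
      translateSum (trig (bandCoeff (-s) (n + j))) a y x) r volume ≤
      ENNReal.ofReal (C₃ * (1 - β)⁻¹ * ((2 : ℝ) ^ n) ^ (-e)) * eLpNorm a r Measure.count := by
    intro J
    have hmeas : ∀ j ∈ Finset.range J, AEStronglyMeasurable
        (translateSum (trig (bandCoeff (-s) (n + j))) a y) volume := fun j _ => by
      refine Continuous.aestronglyMeasurable ?_
      exact continuous_finsetSum _ fun i _ => continuous_const.mul
        ((continuous_trig (support_bandCoeff_finite _ _)).comp (continuous_id.sub continuous_const))
    have h1 := eLpNorm_sum_le hmeas hr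
    have h2 : (∑ j ∈ Finset.range J, translateSum (trig (bandCoeff (-s) (n + j))) a y) =
        fun x => ∑ j ∈ Finset.range J, translateSum (trig (bandCoeff (-s) (n + j))) a y x := by
      ext x; simp
    rw [h2] at h1
    refine h1.trans ((Finset.sum_le_sum fun j _ => hpart j).trans ?_)
    rw [← Finset.sum_mul, ← ENNReal.ofReal_sum_of_nonneg fun j _ => by positivity]
    gcongr
    rw [rpow_dyadic, ← hβ]
    calc ∑ j ∈ Finset.range J, C₃ * β ^ (n + j)
        = C₃ * β ^ n * ∑ j ∈ Finset.range J, β ^ j := by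
          rw [Finset.mul_sum]
          exact Finset.sum_congr rfl fun j _ => by rw [pow_add]; ring
      _ ≤ C₃ * β ^ n * (1 - β)⁻¹ := by
          gcongr
          rw [← tsum_geometric_of_lt_one hβ0.le hβ1]
          exact (summable_geometric_of_lt_one hβ0.le hβ1).sum_le_tsum _ fun _ _ => by positivity
      _ = _ := by ring
  -- Fatou's lemma passes from partial sums to the series, which converges off the finite, hence
  -- null, set of nodes.
  refine (Lp.eLpNorm_lim_le_liminf_eLpNorm (f := fun J x => ∑ j ∈ Finset.range J,
    translateSum (trig (bandCoeff (-s) (n + j))) a y x) (fun J => ?_) _ ?_).trans ?_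
  · refine Continuous.aestronglyMeasurable ?_
    exact continuous_finsetSum _ fun j _ => continuous_finsetSum _ fun i _ => continuous_const.mul
        ((continuous_trig (support_bandCoeff_finite _ _)).comp (continuous_id.sub continuous_const))
  · have hne : ∀ᵐ x : Torus q, ∀ i, x ≠ y i := ae_all_iff.mpr fun i => ae_ne hq (y i)
    filter_upwards [hne] with x hx
    have h1 := tendsto_finsetSum (f := fun i J => (a i : ℂ) *
        ∑ j ∈ Finset.range J, trig (bandCoeff (-s) (n + j)) (x - y i)) Finset.univ fun i _ =>
      ((hasSum_sobolevKernel_sub hq hs0 (sub_ne_zero.mpr (hx i)) n).tendsto_sum_nat.const_mul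
        (a i : ℂ))
    refine h1.congr fun J => ?_
    simp only [translateSum, Finset.mul_sum]
    rw [Finset.sum_comm]
  · exact Filter.liminf_le_of_le (h := fun b hb => by
      obtain ⟨J, hJ⟩ := hb.exists
      exact hJ.trans (hfin J))

theorem memLp_sobolevKernel (hq : 1 ≤ q) {r : ℝ≥0∞} (hr : 1 ≤ r) {s : ℝ}
    (hs : (q : ℝ) * (1 - (r⁻¹).toReal) < s) : MemLp (sobolevKernel s : Torus q → ℂ) r volume := by
  have hθ1 := inv_toReal_le_one hr
  have hs0 : 0 < s := lt_of_le_of_lt (mul_nonneg (Nat.cast_nonneg q) (by linarith)) hs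
  obtain ⟨C, -, hC⟩ := exists_eLpNorm_translateSum_sub_le hq hr hs 1 zero_le_one
  -- A single node at the origin with coefficient 1 and n = 0: the tail is then the kernel minus the
  -- constant 1, and the separation condition is void.
  have h1 := hC 0 1 (fun _ => 0) 1 one_pos le_rfl (by norm_num)
    (fun j k h => absurd (Subsingleton.elim j k) h) (fun _ => 1)
  have h2 : translateSum (fun x : Torus q => sobolevKernel s x - trig (lowCoeff (-s) 0) x)
      (fun _ : Fin 1 => (1 : ℝ)) (fun _ => 0) = fun x => sobolevKernel s x - 1 := by
    ext x; simp [translateSum, trig_lowCoeff_zero]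
  rw [h2, eLpNorm_count_eq_norm_toLp hr] at h1
  have h3 : MemLp (fun x : Torus q => sobolevKernel s x - 1) r volume :=
    ⟨(aestronglyMeasurable_sobolevKernel hq hs0).sub aestronglyMeasurable_const,
      h1.trans_lt (ENNReal.mul_lt_top ENNReal.ofReal_lt_top ENNReal.ofReal_lt_top)⟩
  have h4 := h3.add (memLp_const (1 : ℂ))
  have h5 : (fun x : Torus q => sobolevKernel s x - 1) + (fun _ => (1 : ℂ)) = sobolevKernel s := by
    ext x
    simp
  rwa [h5] at h4

theorem fourierCoefficient_sub {f g : Torus q → ℂ} (hf : Integrable f) (hg : Integrable g)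
    (k : Fin q → ℤ) : fourierCoefficient (fun x => f x - g x) k =
      fourierCoefficient f k - fourierCoefficient g k := by
  unfold fourierCoefficient
  simp_rw [sub_mul]
  rw [integral_sub (integrable_mul_character hf _) (integrable_mul_character hg _), mul_sub]

theorem integrable_sobolevKernel (hq : 1 ≤ q) {s : ℝ} (hs : 0 < s) :
    Integrable (sobolevKernel s : Torus q → ℂ) :=
  (memLp_sobolevKernel hq le_rfl (by simpa using hs)).integrable le_rfl

/-- The L¹ norms of the bands decay like 2^(−js), so the series is integrated termwise. The partial
sums of the coefficients at k telescope to `lowCoeff`, which is eventually the full multiplier. -/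
theorem isSobolevKernel_sobolevKernel (hq : 1 ≤ q) {s : ℝ} (hs : 0 < s) :
    IsSobolevKernel s (sobolevKernel s : Torus q → ℂ) := by
  refine ⟨integrable_sobolevKernel hq hs, fun k => ?_⟩
  have hK := integrable_sobolevKernel (q := q) hq hs
  obtain ⟨C, hC, hband⟩ := exists_norm_trig_bandCoeff_le hq (-s)
  set β : ℝ := 2 ^ (-s) with hβ
  have hβ0 : 0 < β := by positivity
  have hβ1 : β < 1 := Real.rpow_lt_one_of_one_lt_of_neg one_lt_two (by linarith)
  have hint : ∀ j, Integrable fun x : Torus q => trig (bandCoeff (-s) j) x * character (-k) x :=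
    fun j => integrable_mul_character (integrable_trig (support_bandCoeff_finite _ _)) _
  have hsum : Summable fun j =>
      ∫ x : Torus q, ‖trig (bandCoeff (-s) j) x * character (-k) x‖ := by
    refine Summable.of_nonneg_of_le (fun j => integral_nonneg fun x => norm_nonneg _)
      (fun j => ?_) ((summable_geometric_of_lt_one hβ0.le hβ1).mul_left (C * (2 * 4 ^ q)))
    simp_rw [norm_mul, norm_character, mul_one]
    rw [integral_norm_eq_lintegral_enorm
      (continuous_trig (support_bandCoeff_finite _ _)).aestronglyMeasurable]
    refine ENNReal.toReal_le_of_le_ofReal (by positivity) ?_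
    refine (lintegral_enorm_le_of_decay (C := C * ((2 : ℝ) ^ j) ^ (-s)) (by positivity)
      (by positivity) (hband j)).trans (le_of_eq ?_)
    rw [rpow_dyadic, ← hβ]
    ring_nf
  have h1 := (hasSum_integral_of_summable_integral_norm hint hsum).mul_left
    (((2 * Real.pi : ℝ) : ℂ)⁻¹ ^ q)
  have h2 : ∀ j, ((2 * Real.pi : ℝ) : ℂ)⁻¹ ^ q *
      ∫ x : Torus q, trig (bandCoeff (-s) j) x * character (-k) x = bandCoeff (-s) j k :=
    fun j => fourierCoefficient_trig (support_bandCoeff_finite _ _) k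
  have h3 : ((2 * Real.pi : ℝ) : ℂ)⁻¹ ^ q *
      ∫ x : Torus q, ∑' j, trig (bandCoeff (-s) j) x * character (-k) x =
      fourierCoefficient (fun x => sobolevKernel s x - trig (lowCoeff (-s) 0) x) k := by
    unfold fourierCoefficient
    congr 2
    ext x
    rw [tsum_mul_right]
    simp only [sobolevKernel, trig_lowCoeff_zero, add_sub_cancel_left]
  simp_rw [h2, h3] at h1
  rw [fourierCoefficient_sub hK (integrable_trig (support_lowCoeff_finite _ _)),
    fourierCoefficient_trig (support_lowCoeff_finite _ _)] at h1
  have h4 : ∀ J, lowCoeff (-s) J k = lowCoeff (-s) 0 k +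
      ∑ j ∈ Finset.range J, bandCoeff (-s) j k := by
    intro J
    induction J with
    | zero => simp
    | succ J ih => rw [lowCoeff_succ, ih, Finset.sum_range_succ, add_assoc]
  have h5 := h1.tendsto_sum_nat.const_add (lowCoeff (-s) 0 k)
  rw [add_sub_cancel] at h5
  refine tendsto_nhds_unique h5 (tendsto_const_nhds.congr' ?_)
  filter_upwards [eventually_lowCoeff_eq (-s) k] with J hJ
  rw [← h4, hJ]

theorem IsSobolevKernel.ae_eq {s : ℝ} {K K' : Torus q → ℂ} (hK : IsSobolevKernel s K)
    (hK' : IsSobolevKernel s K') : K =ᵐ[volume] K' := by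
  have h := ae_eq_zero_of_fourierCoefficient_eq_zero (hK.integrable.sub hK'.integrable) fun k => by
    have := fourierCoefficient_sub hK.integrable hK'.integrable k
    rw [hK.fourierCoefficient_eq, hK'.fourierCoefficient_eq, sub_self] at this
    exact this
  filter_upwards [h] with x hx using sub_eq_zero.mp hx

theorem translateSum_congr_ae {K K' : Torus q → ℂ} (h : K =ᵐ[volume] K') {M : ℕ}
    (a : Fin M → ℝ) (y : Fin M → Torus q) :
    translateSum K a y =ᵐ[volume] translateSum K' a y := by
  have h1 : ∀ᵐ x : Torus q, ∀ j, K (x - y j) = K' (x - y j) := ae_all_iff.mpr fun j =>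
    (measurePreserving_sub_right volume (y j)).quasiMeasurePreserving.ae h
  filter_upwards [h1] with x hx
  simp only [translateSum, hx]

theorem memLp_translateSum {K : Torus q → ℂ} {r : ℝ≥0∞} (hK : MemLp K r volume) {M : ℕ}
    (a : Fin M → ℝ) (y : Fin M → Torus q) : MemLp (translateSum K a y) r volume :=
  memLp_finsetSum _ fun j _ =>
    (hK.comp_measurePreserving (measurePreserving_sub_right volume (y j))).const_mul _

theorem integrable_mul_trig_sub {f : Torus q → ℂ} (hf : Integrable f) {c : (Fin q → ℤ) → ℂ}
    (hc : c.support.Finite) (x : Torus q) : Integrable fun y => f y * trig c (x - y) := by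
  obtain ⟨B, hB⟩ := (isCompact_univ (X := Torus q)).exists_bound_of_continuousOn
    (continuous_trig hc).continuousOn
  exact hf.mul_bdd (c := B) ((continuous_trig hc).comp
    (continuous_const.sub continuous_id)).aestronglyMeasurable
    (Filter.Eventually.of_forall fun y => hB _ trivial)

/-- Convolution commutes with translation, so it acts on the kernel alone. It serves both to undo
the multiplier of K and to show that the filter reproduces low frequencies. -/
theorem integral_translateSum_mul_trig {K : Torus q → ℂ} (hK : Integrable K) {c : (Fin q → ℤ) → ℂ}
    (hc : c.support.Finite) {M : ℕ} (a : Fin M → ℝ) (y : Fin M → Torus q) (z : Torus q) :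
    ∫ x, translateSum K a y x * trig c (z - x) = ((2 * Real.pi : ℝ) : ℂ) ^ q *
      translateSum (trig fun k => c k * fourierCoefficient K k) a y z := by
  have hterm : ∀ j x, (a j : ℂ) * K (x - y j) * trig c (z - x) =
      (a j : ℂ) * (fun u => K u * trig c (z - y j - u)) (x - y j) := fun j x => by
    simp only
    rw [mul_assoc, sub_sub_sub_cancel_right]
  simp_rw [translateSum, Finset.sum_mul, hterm]
  rw [integral_finsetSum _ fun j _ => ((integrable_mul_trig_sub hK hc (z - y j)).comp_sub_right (y j)).const_mul _,
    Finset.mul_sum]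
  refine Finset.sum_congr rfl fun j _ => ?_
  rw [integral_const_mul, integral_sub_right_eq_self (fun u => K u * trig c (z - y j - u)) (y j),
    integral_mul_trig_sub hK hc]
  ring

/-! ### The coefficient inequality -/

/-- Bounds for the truncated inverse of convolution with the kernel. The bands now grow like 2^(ls),
so their geometric sum is dominated by the last one. -/
theorem exists_lowCoeff_bounds (hq : 1 ≤ q) {s : ℝ} (hs : 0 < s) {D : ℝ} (hD : 0 ≤ D) :
    ∃ C, 0 ≤ C ∧ ∀ n : ℕ,
      ∫⁻ x : Torus q, ‖trig (lowCoeff s n) x‖ₑ ≤ ENNReal.ofReal (C * ((2 : ℝ) ^ n) ^ s) ∧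
      ∀ (M : ℕ) (y : Fin M → Torus q) (δ : ℝ), 0 < δ → δ ≤ 1 → δ⁻¹ ≤ D * 2 ^ n →
        (∀ j k, j ≠ k → δ ≤ ‖y j - y k‖) → ∀ x,
        ∑ j, ‖trig (lowCoeff s n) (y j - x)‖ ≤ C * ((2 : ℝ) ^ n) ^ s * (2 ^ n) ^ q := by
  obtain ⟨C₀, hC₀, hband⟩ := exists_norm_trig_bandCoeff_le hq s
  set b : ℝ := 2 ^ s with hb
  have hb1 : 1 < b := Real.one_lt_rpow one_lt_two hs
  have hb0 : 0 < b := by linarith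
  have hgeom : ∀ n : ℕ, ∑ l ∈ Finset.range n, b ^ l ≤ (b - 1)⁻¹ * b ^ n := fun n => by
    rw [geom_sum_eq hb1.ne', div_eq_inv_mul]
    have := inv_nonneg.mpr (sub_nonneg.mpr hb1.le)
    gcongr
    linarith
  have hb' : 0 ≤ (b - 1)⁻¹ := inv_nonneg.mpr (sub_nonneg.mpr hb1.le)
  set E : ℝ := (1 + Real.pi) ^ (q + 1) + C₀ * (b - 1)⁻¹ with hE
  have hpi := Real.pi_pos
  have hE0 : 0 ≤ E := by positivity
  -- The constant term counts as a kernel localized at scale 1, because ‖x‖ ≤ π on the whole torus.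
  have hone : ∀ x : Torus q, ‖(1 : ℂ)‖ ≤ (1 + Real.pi) ^ (q + 1) * 1 ^ q * decayWeight 1 x := by
    intro x
    unfold decayWeight
    rw [norm_one, one_pow, mul_one, one_mul, ← div_eq_mul_inv, one_le_div (by positivity)]
    refine pow_le_pow_left₀ (by positivity) ?_ _
    have hle : ‖x‖ ≤ Real.pi := (pi_norm_le_iff_of_nonneg hpi.le).mpr fun i => by
      have := AddCircle.norm_le_half_period (2 * Real.pi) (x := x i) Real.two_pi_pos.ne'
      rw [abs_of_pos Real.two_pi_pos] at this
      linarith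
    linarith
  have hexp : ∀ (n : ℕ) (x : Torus q), trig (lowCoeff s n) x =
      1 + ∑ l ∈ Finset.range n, trig (bandCoeff s l) x := fun n x => by
    have := trig_lowCoeff_add s 0 n x
    simpa only [zero_add, trig_lowCoeff_zero] using this
  refine ⟨E * (2 * 4 ^ q) + E * (4 * 12 ^ q * (1 + D) ^ q), by positivity, fun n => ⟨?_, ?_⟩⟩
  · calc ∫⁻ x : Torus q, ‖trig (lowCoeff s n) x‖ₑ
        ≤ ∫⁻ x : Torus q, (‖(1 : ℂ)‖ₑ + ∑ l ∈ Finset.range n, ‖trig (bandCoeff s l) x‖ₑ) := by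
          refine lintegral_mono fun x => ?_
          rw [hexp]
          exact (enorm_add_le _ _).trans (by gcongr; exact enorm_sum_le _ _)
      _ = (∫⁻ _x : Torus q, ‖(1 : ℂ)‖ₑ) +
          ∑ l ∈ Finset.range n, ∫⁻ x : Torus q, ‖trig (bandCoeff s l) x‖ₑ := by
          rw [lintegral_add_left measurable_const, lintegral_finsetSum _ fun l _ =>
            (continuous_trig (support_bandCoeff_finite _ _)).measurable.enorm]
      _ ≤ ENNReal.ofReal ((1 + Real.pi) ^ (q + 1) * (2 * 4 ^ q)) +
          ∑ l ∈ Finset.range n, ENNReal.ofReal (C₀ * b ^ l * (2 * 4 ^ q)) := by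
          refine add_le_add (lintegral_enorm_le_of_decay (by positivity) one_pos hone)
            (Finset.sum_le_sum fun l _ => ?_)
          refine lintegral_enorm_le_of_decay (t := 2 ^ l) (by positivity) (by positivity) ?_
          intro x
          have := hband l x
          rwa [rpow_dyadic] at this
      _ = ENNReal.ofReal (((1 + Real.pi) ^ (q + 1) + C₀ * ∑ l ∈ Finset.range n, b ^ l) *
          (2 * 4 ^ q)) := by
          rw [← ENNReal.ofReal_sum_of_nonneg fun l _ => by positivity,
            ← ENNReal.ofReal_add (by positivity) (Finset.sum_nonneg fun l _ => by positivity)]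
          congr 1
          rw [add_mul, Finset.mul_sum, Finset.sum_mul]
      _ ≤ _ := by
          refine ENNReal.ofReal_le_ofReal ?_
          rw [rpow_dyadic, ← hb]
          have h1 := hgeom n
          have h2 : 1 ≤ b ^ n := one_le_pow₀ hb1.le
          calc ((1 + Real.pi) ^ (q + 1) + C₀ * ∑ l ∈ Finset.range n, b ^ l) * (2 * 4 ^ q)
              ≤ ((1 + Real.pi) ^ (q + 1) * b ^ n + C₀ * ((b - 1)⁻¹ * b ^ n)) * (2 * 4 ^ q) := by
                gcongr
                exact le_mul_of_one_le_right (by positivity) h2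
            _ = E * (2 * 4 ^ q) * b ^ n := by rw [hE]; ring
            _ ≤ _ := by
                gcongr
                exact le_add_of_nonneg_right (by positivity)
  · intro M y δ hδ hδ1 hδn hy x
    have hN1 : (1 : ℝ) ≤ 2 ^ n := one_le_pow₀ one_le_two
    have hsum : ∀ {φ : Torus q → ℂ} {C t : ℝ}, 0 ≤ C → 0 < t → t ≤ 2 ^ n →
        (∀ x, ‖φ x‖ ≤ C * t ^ q * decayWeight t x) →
        ∑ j, ‖φ (y j - x)‖ ≤ C * (4 * 12 ^ q * (1 + D) ^ q * (2 ^ n) ^ q) := by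
      intro φ C t hC ht htn hφ
      have h1 := sum_norm_sub_le_of_decay (φ := fun u => φ (-u)) hC ht (fun u => by
        have := hφ (-u)
        rwa [decayWeight_neg] at this) hδ hδ1 hy x
      simp only [neg_sub] at h1
      refine h1.trans ?_
      have h2 : t + δ⁻¹ ≤ (1 + D) * 2 ^ n := by linarith
      calc C * (4 * 12 ^ q) * (t + δ⁻¹) ^ q ≤ C * (4 * 12 ^ q) * ((1 + D) * 2 ^ n) ^ q := by
            gcongr
        _ = _ := by rw [mul_pow]; ring
    calc ∑ j, ‖trig (lowCoeff s n) (y j - x)‖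
        ≤ ∑ j, (‖(1 : ℂ)‖ + ∑ l ∈ Finset.range n, ‖trig (bandCoeff s l) (y j - x)‖) := by
          refine Finset.sum_le_sum fun j _ => ?_
          rw [hexp]
          exact (norm_add_le _ _).trans (by gcongr; exact norm_sum_le _ _)
      _ = ∑ _j : Fin M, ‖(1 : ℂ)‖ +
          ∑ l ∈ Finset.range n, ∑ j, ‖trig (bandCoeff s l) (y j - x)‖ := by
          rw [Finset.sum_add_distrib, Finset.sum_comm]
      _ ≤ (1 + Real.pi) ^ (q + 1) * (4 * 12 ^ q * (1 + D) ^ q * (2 ^ n) ^ q) +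
          ∑ l ∈ Finset.range n, C₀ * b ^ l * (4 * 12 ^ q * (1 + D) ^ q * (2 ^ n) ^ q) := by
          refine add_le_add (hsum (φ := fun _ => 1) (by positivity) one_pos hN1 hone)
            (Finset.sum_le_sum fun l hl => ?_)
          refine hsum (t := 2 ^ l) (by positivity) (by positivity)
            (pow_le_pow_right₀ one_le_two (Finset.mem_range.mp hl).le) ?_
          intro x
          have := hband l x
          rwa [rpow_dyadic] at this
      _ = ((1 + Real.pi) ^ (q + 1) + C₀ * ∑ l ∈ Finset.range n, b ^ l) *
          (4 * 12 ^ q * (1 + D) ^ q * (2 ^ n) ^ q) := by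
          rw [add_mul, Finset.mul_sum, Finset.sum_mul]
      _ ≤ ((1 + Real.pi) ^ (q + 1) * b ^ n + C₀ * ((b - 1)⁻¹ * b ^ n)) *
          (4 * 12 ^ q * (1 + D) ^ q * (2 ^ n) ^ q) := by
          have h1 := hgeom n
          have h2 : 1 ≤ b ^ n := one_le_pow₀ hb1.le
          gcongr
          exact le_mul_of_one_le_right (by positivity) h2
      _ = E * (4 * 12 ^ q * (1 + D) ^ q) * b ^ n * (2 ^ n) ^ q := by rw [hE]; ring
      _ ≤ _ := by
          rw [rpow_dyadic, ← hb]
          gcongr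
          exact le_add_of_nonneg_left (by positivity)

theorem lowCoeff_mul_eq {s : ℝ} (n : ℕ) (k : Fin q → ℤ) :
    lowCoeff s n k * (((freqNorm k ^ 2 + 1) ^ (-s / 2) : ℝ) : ℂ) = lowCoeff 0 n k := by
  rw [lowCoeff, lowCoeff, ← Complex.ofReal_mul, mul_assoc, ← Real.rpow_add (by positivity),
    ← add_div, add_neg_cancel]

theorem exists_offDiag_le (hq : 1 ≤ q) : ∃ A : ℝ, 1 ≤ A ∧ ∀ (n M : ℕ) (y : Fin M → Torus q) (δ : ℝ),
    0 < δ → δ ≤ 1 → A ≤ δ * 2 ^ n → (∀ j k, j ≠ k → δ ≤ ‖y j - y k‖) → ∀ i,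
    ∑ j, ‖if j = i then 0 else trig (lowCoeff 0 n) (y i - y j)‖ ≤
        ((2 : ℝ) ^ n) ^ q / (2 * q) ^ q / 2 ∧
      ∑ j, ‖if i = j then 0 else trig (lowCoeff 0 n) (y j - y i)‖ ≤
        ((2 : ℝ) ^ n) ^ q / (2 * q) ^ q / 2 := by
  obtain ⟨C, hC, hdecay⟩ := exists_norm_trig_smoothCutoff_le hq
  have hq0 : (0 : ℝ) < q := by exact_mod_cast hq
  set E : ℝ := 4 * 12 ^ q * 2 ^ q with hE
  -- The summand 2 gives 2/A ≤ 1, hence (2/A)^(q+1) ≤ 2/A; the other summand makes the off-diagonal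
  -- sum at most half the lower bound for the diagonal entry.
  refine ⟨2 + 4 * C * E * (2 * q) ^ q, ?_, fun n M y δ hδ hδ1 hA hy i => ?_⟩
  · have : 0 ≤ 4 * C * E * (2 * q) ^ q := by positivity
    linarith
  set A := 2 + 4 * C * E * (2 * q) ^ q with hA'
  have hA2 : 2 ≤ A := le_add_of_nonneg_right (by positivity)
  have hN : (0 : ℝ) < 2 ^ n := by positivity
  -- Row and column sums are handled together: the weight is even, so the sign of each difference of
  -- nodes is irrelevant.
  have key : ∀ w : Fin M → Torus q, (∀ j, j ≠ i → w j = y i - y j ∨ w j = y j - y i) →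
      ∑ j, ‖if j = i then 0 else trig (lowCoeff 0 n) (w j)‖ ≤
        ((2 : ℝ) ^ n) ^ q / (2 * q) ^ q / 2 := by
    intro w hw
    calc ∑ j, ‖if j = i then 0 else trig (lowCoeff 0 n) (w j)‖
        ≤ ∑ j, C * (2 ^ n) ^ q * (if j = i then 0 else decayWeight (2 ^ n) (y i - y j)) := by
          refine Finset.sum_le_sum fun j _ => ?_
          split_ifs with hji
          · simp
          · refine (hdecay n _).trans (le_of_eq ?_)
            rcases hw j hji with h | h
            · rw [h]
            · rw [h, ← neg_sub, decayWeight_neg]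
      _ ≤ C * (2 ^ n) ^ q * ((2 / (2 ^ n * δ)) ^ (q + 1) * E) := by
          rw [← Finset.mul_sum]
          exact mul_le_mul_of_nonneg_left (sum_decayWeight_offDiag_le hδ hδ1 hN hy i)
            (by positivity)
      _ ≤ C * (2 ^ n) ^ q * (2 / A * E) := by
          have h1 : 2 / (2 ^ n * δ) ≤ 2 / A := by
            rw [mul_comm]
            gcongr
          have h2 : 2 / A ≤ 1 := (div_le_one (by linarith)).mpr hA2
          have h3 : (2 / (2 ^ n * δ)) ^ (q + 1) ≤ 2 / A :=
            (pow_le_of_le_one (by positivity) (h1.trans h2) (Nat.succ_ne_zero q)).trans h1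
          gcongr
      _ ≤ ((2 : ℝ) ^ n) ^ q / (2 * q) ^ q / 2 := by
          rw [div_div, le_div_iff₀ (by positivity)]
          have h1 : 4 * C * E * (2 * q) ^ q ≤ A := le_add_of_nonneg_left (by norm_num)
          calc C * (2 ^ n) ^ q * (2 / A * E) * ((2 * q) ^ q * 2)
              = (2 ^ n) ^ q * (4 * C * E * (2 * q) ^ q / A) := by ring
            _ ≤ (2 ^ n) ^ q * 1 := by
                gcongr
                exact (div_le_one (by linarith)).mpr h1
            _ = _ := mul_one _
  refine ⟨key _ fun j _ => Or.inl rfl, ?_⟩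
  simp_rw [eq_comm (a := i)]
  exact key _ fun j _ => Or.inr rfl

/-- Convolving with the order-s multiplier and sampling at the nodes yields the matrix Φ(y_i − y_j)
applied to a. Diagonal dominance inverts it, while the sampling estimate bounds the result by the
norm of the translate sum. -/
theorem exists_eLpNorm_coefficients_le (hq : 1 ≤ q) {r : ℝ≥0∞} (hr : 1 ≤ r) {s : ℝ} (hs : 0 < s) :
    ∃ A C : ℝ, 1 ≤ A ∧ 0 ≤ C ∧ ∀ (n M : ℕ) (y : Fin M → Torus q) (δ : ℝ), 0 < δ → δ ≤ 1 →
      A ≤ δ * 2 ^ n → (∀ j k, j ≠ k → δ ≤ ‖y j - y k‖) →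
      ∀ K : Torus q → ℂ, IsSobolevKernel s K → ∀ a : Fin M → ℝ,
      eLpNorm a r Measure.count ≤
        ENNReal.ofReal (C * ((2 : ℝ) ^ n) ^ (s - q * (1 - (r⁻¹).toReal))) *
          eLpNorm (translateSum K a y) r volume := by
  obtain ⟨A, hA1, hoff⟩ := exists_offDiag_le hq
  obtain ⟨C, hC, hlow⟩ := exists_lowCoeff_bounds (q := q) hq hs zero_le_one
  have hq0 : (0 : ℝ) < q := by exact_mod_cast hq
  refine ⟨A, 2 * (2 * q) ^ q * C, hA1, by positivity, fun n M y δ hδ hδ1 hA hy K hK a => ?_⟩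
  set θ := (r⁻¹).toReal with hθ
  have hN : (0 : ℝ) < 2 ^ n := by positivity
  set L : ℝ := ((2 : ℝ) ^ n) ^ q / (2 * q) ^ q with hL
  have hL0 : 0 < L := by positivity
  obtain ⟨hint, hsum⟩ := hlow n
  have hδn : δ⁻¹ ≤ 1 * 2 ^ n := by
    rw [inv_le_iff_one_le_mul₀ hδ]
    linarith
  set Φ : Torus q → ℂ := trig (lowCoeff 0 n) with hΦ
  set Y := eLpNorm (translateSum K a y) r volume with hY
  set X := eLpNorm a r Measure.count with hX
  have hXfin : X ≠ ∞ := by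
    rw [hX, eLpNorm_count_eq_norm_toLp hr]
    exact ENNReal.ofReal_ne_top
  have hGm : AEStronglyMeasurable (translateSum K a y) volume :=
    (memLp_translateSum (memLp_one_iff_integrable.mpr hK.integrable) a y).aestronglyMeasurable
  -- The convolution is (2π)^q times the translate sum of Φ; the factor exceeds 1 and is dropped.
  have hS : eLpNorm (fun i => translateSum Φ a y (y i)) r Measure.count ≤
      ENNReal.ofReal ((C * ((2 : ℝ) ^ n) ^ s * (2 ^ n) ^ q) ^ θ *
        (C * ((2 : ℝ) ^ n) ^ s) ^ (1 - θ)) * Y := by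
    refine le_trans ?_ (eLpNorm_sampling_le (continuous_trig (support_lowCoeff_finite s n)).measurable
      (by positivity) (by positivity) hint (hsum M y δ hδ hδ1 hδn hy) hr hGm)
    refine eLpNorm_mono fun i => ?_
    rw [integral_translateSum_mul_trig hK.integrable (support_lowCoeff_finite s n)]
    simp_rw [hK.fourierCoefficient_eq, lowCoeff_mul_eq]
    rw [norm_mul, norm_pow, Complex.norm_real, Real.norm_of_nonneg Real.two_pi_pos.le]
    exact le_mul_of_one_le_left (norm_nonneg _)
      (one_le_pow₀ (by linarith [Real.pi_gt_three]))
  set E : Fin M → Fin M → ℂ := fun i j => if j = i then 0 else Φ (y i - y j) with hE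
  have hEa : eLpNorm (fun i => ∑ j, (a j : ℂ) * E i j) r Measure.count ≤
      ENNReal.ofReal (L / 2) * X :=
    eLpNorm_matrix_le (fun i => (hoff n M y δ hδ hδ1 hA hy i).1)
      (fun j => (hoff n M y δ hδ hδ1 hA hy j).2) hr a
  have hdiag : ENNReal.ofReal L * X ≤ eLpNorm (fun i => (a i : ℂ) * Φ 0) r Measure.count := by
    have h1 : (fun i => (a i : ℂ) * Φ 0) = Φ 0 • fun i => (a i : ℂ) := by
      ext i
      rw [Pi.smul_apply, smul_eq_mul, mul_comm]
    have h2 : eLpNorm (fun i => (a i : ℂ)) r Measure.count = X :=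
      eLpNorm_congr_norm_ae (Filter.Eventually.of_forall fun i => by simp)
    rw [h1, eLpNorm_const_smul, h2, ← ofReal_norm]
    gcongr
    exact norm_trig_lowCoeff_zero_at_zero_ge hq n
  have hsplit : (fun i => (a i : ℂ) * Φ 0) =
      (fun i => translateSum Φ a y (y i)) - fun i => ∑ j, (a j : ℂ) * E i j := by
    ext i
    rw [Pi.sub_apply, translateSum, ← Finset.sum_sub_distrib, Finset.sum_eq_single i]
    · simp [hE]
    · intro j _ hji
      simp [hE, hji]
    · simp
  have hmain : ENNReal.ofReal L * X ≤
      eLpNorm (fun i => translateSum Φ a y (y i)) r Measure.count + ENNReal.ofReal (L / 2) * X := by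
    refine hdiag.trans ?_
    rw [hsplit]
    refine (eLpNorm_sub_le (measurable_of_countable _).aestronglyMeasurable
      (measurable_of_countable _).aestronglyMeasurable hr).trans ?_
    gcongr
  -- The off-diagonal part is absorbed in the diagonal one; cancellation is legitimate because the
  -- norm of a finite vector is finite.
  have hhalf : ENNReal.ofReal (L / 2) * X ≤
      eLpNorm (fun i => translateSum Φ a y (y i)) r Measure.count := by
    have h1 : ENNReal.ofReal L = ENNReal.ofReal (L / 2) + ENNReal.ofReal (L / 2) := by
      rw [← ENNReal.ofReal_add (by positivity) (by positivity), add_halves]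
    rw [h1, add_mul] at hmain
    exact (ENNReal.add_le_add_iff_right (ENNReal.mul_ne_top ENNReal.ofReal_ne_top hXfin)).mp hmain
  have hLi : ENNReal.ofReal (2 / L) * (ENNReal.ofReal (L / 2) * X) = X := by
    rw [← mul_assoc, ← ENNReal.ofReal_mul (by positivity)]
    have : 2 / L * (L / 2) = 1 := by field_simp
    rw [this, ENNReal.ofReal_one, one_mul]
  rw [← hLi]
  refine (mul_le_mul_right (hhalf.trans hS) _).trans (le_of_eq ?_)
  rw [← mul_assoc, ← ENNReal.ofReal_mul (by positivity)]
  congr 2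
  -- With N = 2^n, interpolation gives N^(s + qθ), and division by L, of order N^q, leaves the
  -- exponent s − q(1 − θ).
  have h1 : (C * ((2 : ℝ) ^ n) ^ s * (2 ^ n) ^ q) ^ θ * (C * ((2 : ℝ) ^ n) ^ s) ^ (1 - θ) =
      C * ((2 : ℝ) ^ n) ^ (s + q * θ) := by
    rw [Real.mul_rpow (by positivity) (by positivity), mul_right_comm,
      ← Real.rpow_add_of_nonneg (by positivity) ENNReal.toReal_nonneg
        (by linarith [inv_toReal_le_one hr]), add_sub_cancel, Real.rpow_one,
      Real.rpow_add hN, Real.rpow_mul hN.le, Real.rpow_natCast]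
    ring
  have h2 : ((2 : ℝ) ^ n) ^ (s + q * θ) = ((2 : ℝ) ^ n) ^ (s - q * (1 - θ)) * (2 ^ n) ^ q := by
    rw [← Real.rpow_natCast ((2 : ℝ) ^ n) q, ← Real.rpow_add hN]
    congr 1
    ring
  rw [h1, h2, hL]
  field_simp

/-! ### Approximation by the filter operator -/

/-- The cutoff at level n vanishes for ‖k‖ ≥ 2^n, whereas the filter at 2^(n+1) equals 1 for ‖k‖ ≤
2^n. This doubling is the origin of the exponent n + 1. -/
theorem radialCoeff_mul_lowCoeff {Q : ℕ} {h : ℝ → ℝ} (hh : IsLowPassFilter Q h) (σ : ℝ) (n : ℕ)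
    (k : Fin q → ℤ) :
    radialCoeff (fun u => h (√u)) (2 ^ (n + 1)) k * lowCoeff σ n k = lowCoeff σ n k := by
  rcases le_or_gt 1 (freqNorm k ^ 2 / (2 ^ n) ^ 2) with h1 | h1
  · rw [lowCoeff, smoothCutoff_of_ge h1, zero_mul, Complex.ofReal_zero, mul_zero]
  · have h2 : √(freqNorm k ^ 2 / (2 ^ (n + 1)) ^ 2) ≤ 1 / 2 := by
      refine Real.sqrt_le_iff.mpr ⟨by norm_num, ?_⟩
      have : freqNorm k ^ 2 / (2 ^ (n + 1)) ^ 2 = freqNorm k ^ 2 / (2 ^ n) ^ 2 * (1 / 2) ^ 2 := by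
        rw [pow_succ (2 : ℝ) n]
        field_simp
      rw [this]
      nlinarith
    rw [radialCoeff, hh.eq_one _ (Real.sqrt_nonneg _) h2, Complex.ofReal_one, one_mul]

/-- The filter reproduces the part of the sum with frequencies below 2^n, so its error on the whole
sum is its error on the tail T, at most 1 + B times the norm of T. -/
theorem exists_eLpNorm_sub_filterOp_le (hq : 1 ≤ q) {r : ℝ≥0∞} (hr : 1 ≤ r) {s : ℝ}
    (hs : (q : ℝ) * (1 - (r⁻¹).toReal) < s) {Q : ℕ} (hQ : ((q : ℝ) + 1) / 2 < Q) {h : ℝ → ℝ}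
    (hh : IsLowPassFilter Q h) :
    ∃ C : ℝ, 0 ≤ C ∧ ∀ (n M : ℕ) (y : Fin M → Torus q) (δ : ℝ), 0 < δ → δ ≤ 1 → 1 ≤ δ * 2 ^ n →
      (∀ j k, j ≠ k → δ ≤ ‖y j - y k‖) →
      ∀ K : Torus q → ℂ, IsSobolevKernel s K → ∀ a : Fin M → ℝ,
      eLpNorm (fun x => translateSum K a y x - filterOp h (2 ^ (n + 1)) (translateSum K a y) x)
          r volume ≤
        ENNReal.ofReal (C * ((2 : ℝ) ^ n) ^ (-(s - q * (1 - (r⁻¹).toReal)))) *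
          eLpNorm a r Measure.count := by
  obtain ⟨B, hB, hker⟩ := exists_lintegral_filterKernel_le hq hQ hh
  obtain ⟨C, hC, hdiff⟩ := exists_eLpNorm_translateSum_sub_le hq hr hs 1 zero_le_one
  refine ⟨(1 + B) * C, by positivity, fun n M y δ hδ hδ1 hδn hy K hK a => ?_⟩
  have hs0 : 0 < s := lt_of_le_of_lt
    (mul_nonneg (Nat.cast_nonneg q) (by linarith [inv_toReal_le_one hr])) hs
  set c : (Fin q → ℤ) → ℂ := radialCoeff (fun u => h (√u)) (2 ^ (n + 1)) with hc
  have hcfin : c.support.Finite := by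
    have h1 := support_radialCoeff_finite (q := q) hh.exists_smoothBV_comp_sqrt.1.2
      (N := 2 ^ (n + 1)) (by positivity)
    rwa [Nat.cast_pow, Nat.cast_ofNat] at h1
  have hkereq : (filterKernel h (2 ^ (n + 1)) : Torus q → ℂ) = trig c :=
    filterKernel_eq_trig (by positivity)
  set P : Torus q → ℂ := trig (lowCoeff (-s) n) with hP
  have hPfin := support_lowCoeff_finite (q := q) (-s) n
  have hPint : Integrable P := integrable_trig hPfin
  have hHint : Integrable (fun x => K x - P x) := hK.integrable.sub hPint
  set T : Torus q → ℂ := translateSum (fun x => K x - P x) a y with hT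
  have hsplit : ∀ x, translateSum K a y x = T x + translateSum P a y x := fun x => by
    simp only [hT, translateSum, ← Finset.sum_add_distrib, ← mul_add, sub_add_cancel]
  have hpi : ((2 * Real.pi : ℝ) : ℂ) ≠ 0 := by exact_mod_cast Real.two_pi_pos.ne'
  have hTint : Integrable T :=
    memLp_one_iff_integrable.mp (memLp_translateSum (memLp_one_iff_integrable.mpr hHint) a y)
  have hPaint : Integrable (translateSum P a y) :=
    memLp_one_iff_integrable.mp (memLp_translateSum (memLp_one_iff_integrable.mpr hPint) a y)
  have hfix : ∀ x, ∫ z, translateSum P a y z * trig c (x - z) =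
      ((2 * Real.pi : ℝ) : ℂ) ^ q * translateSum P a y x := fun x => by
    rw [integral_translateSum_mul_trig hPint hcfin]
    simp_rw [hP, fourierCoefficient_trig hPfin, hc, radialCoeff_mul_lowCoeff hh]
  have hres : ∀ x, translateSum K a y x - filterOp h (2 ^ (n + 1)) (translateSum K a y) x =
      T x - filterOp h (2 ^ (n + 1)) T x := fun x => by
    unfold filterOp
    rw [hkereq]
    simp_rw [hsplit, add_mul]
    rw [integral_add (integrable_mul_trig_sub hTint hcfin x)
      (integrable_mul_trig_sub hPaint hcfin x), hfix, mul_add, ← mul_assoc, ← mul_pow,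
      inv_mul_cancel₀ hpi, one_pow, one_mul, add_sub_add_right_eq_sub]
  simp_rw [hres]
  have hσ : eLpNorm (filterOp h (2 ^ (n + 1)) T) r volume ≤
      ENNReal.ofReal B * eLpNorm T r volume := by
    refine le_trans ?_ ((eLpNorm_integral_mul_sub_le (continuous_trig hcfin).measurable
      hTint.aestronglyMeasurable hr).trans ?_)
    · refine eLpNorm_mono fun x => ?_
      rw [filterOp, hkereq, norm_mul, norm_pow, norm_inv, Complex.norm_real,
        Real.norm_of_nonneg Real.two_pi_pos.le]
      exact mul_le_of_le_one_left (norm_nonneg _) (pow_le_one₀ (by positivity)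
        (inv_le_one_of_one_le₀ (by linarith [Real.pi_gt_three])))
    · rw [← hkereq]
      gcongr
      exact hker (n + 1)
  have hσm : AEStronglyMeasurable (filterOp h (2 ^ (n + 1)) T) volume := by
    have h1 : filterOp h (2 ^ (n + 1)) T = fun x => ((2 * Real.pi : ℝ) : ℂ)⁻¹ ^ q *
        (((2 * Real.pi : ℝ) : ℂ) ^ q * trig (fun k => c k * fourierCoefficient T k) x) := by
      ext x
      rw [filterOp, hkereq, integral_mul_trig_sub hTint hcfin]
    rw [h1]
    have h2 : (Function.support fun k => c k * fourierCoefficient T k).Finite :=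
      hcfin.subset (Function.support_mul_subset_left _ _)
    exact (continuous_const.mul (continuous_const.mul (continuous_trig h2))).aestronglyMeasurable
  have hTle : eLpNorm T r volume ≤
      ENNReal.ofReal (C * ((2 : ℝ) ^ n) ^ (-(s - q * (1 - (r⁻¹).toReal)))) *
        eLpNorm a r Measure.count := by
    have h1 : (fun x => K x - P x) =ᵐ[volume] fun x => sobolevKernel s x - P x := by
      filter_upwards [hK.ae_eq (isSobolevKernel_sobolevKernel hq hs0)] with x hx
      rw [hx]
    rw [hT, eLpNorm_congr_ae (translateSum_congr_ae h1 a y)]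
    refine hdiff n M y δ hδ hδ1 ?_ hy a
    rw [inv_le_iff_one_le_mul₀ hδ]
    linarith
  calc eLpNorm (fun x => T x - filterOp h (2 ^ (n + 1)) T x) r volume
      ≤ eLpNorm T r volume + eLpNorm (filterOp h (2 ^ (n + 1)) T) r volume :=
        eLpNorm_sub_le hTint.aestronglyMeasurable hσm hr
    _ ≤ eLpNorm T r volume + ENNReal.ofReal B * eLpNorm T r volume := by gcongr
    _ = ENNReal.ofReal (1 + B) * eLpNorm T r volume := by
        rw [ENNReal.ofReal_add zero_le_one hB, ENNReal.ofReal_one, add_mul, one_mul]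
    _ ≤ ENNReal.ofReal (1 + B) * (ENNReal.ofReal (C * ((2 : ℝ) ^ n) ^
          (-(s - q * (1 - (r⁻¹).toReal)))) * eLpNorm a r Measure.count) := by gcongr
    _ = _ := by
        rw [← mul_assoc, ← ENNReal.ofReal_mul (by positivity), mul_assoc]

/-! ### Merging of nodes and choice of the scales -/

/-- Repeated nodes can be merged by adding up their coefficients. -/
theorem exists_injective_translateSum_eq {M : ℕ} (a : Fin M → ℝ) (y : Fin M → Torus q) :
    ∃ (M' : ℕ) (a' : Fin M' → ℝ) (y' : Fin M' → Torus q), Function.Injective y' ∧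
      (∀ j, ∃ i, y i = y' j) ∧ ∀ K : Torus q → ℂ, translateSum K a' y' = translateSum K a y := by
  classical
  set S := Finset.univ.image y with hS
  refine ⟨S.card, fun j => ∑ i with y i = S.equivFin.symm j, a i,
    fun j => (S.equivFin.symm j : Torus q), Subtype.val_injective.comp S.equivFin.symm.injective,
    fun j => ?_, fun K => ?_⟩
  · obtain ⟨i, -, hi⟩ := Finset.mem_image.mp (S.equivFin.symm j).2
    exact ⟨i, hi⟩
  · ext x
    unfold translateSum
    rw [Equiv.sum_comp S.equivFin.symm
      (fun z : S => ((∑ i with y i = z, a i : ℝ) : ℂ) * K (x - z)),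
      Finset.sum_coe_sort S (fun z => ((∑ i with y i = z, a i : ℝ) : ℂ) * K (x - z)),
      ← Finset.sum_fiberwise_of_maps_to (fun i _ => Finset.mem_image_of_mem y (Finset.mem_univ i))]
    refine Finset.sum_congr rfl fun z _ => ?_
    rw [Complex.ofReal_sum, Finset.sum_mul]
    refine Finset.sum_congr rfl fun i hi => ?_
    rw [(Finset.mem_filter.mp hi).2]

theorem le_norm_sub_of_le_euclDist (hq : 1 ≤ q) {m : ℕ} (hm : 1 ≤ m) {x y : Torus q}
    (h : 1 / (m : ℝ) ≤ euclDist x y) : ((m : ℝ) * q)⁻¹ ≤ ‖x - y‖ := by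
  have hq0 : (0 : ℝ) < q := by exact_mod_cast hq
  have hm0 : (0 : ℝ) < m := by exact_mod_cast hm
  have h1 := h.trans (euclDist_le x y)
  rw [div_le_iff₀ hm0] at h1
  rw [inv_le_iff_one_le_mul₀ (by positivity)]
  linarith

end Torus

theorem exists_le_two_pow_le {t : ℝ} (ht : 1 ≤ t) : ∃ n : ℕ, t ≤ 2 ^ n ∧ (2 : ℝ) ^ n ≤ 2 * t := by
  obtain ⟨n, h1, h2⟩ := exists_nat_pow_near ht one_lt_two
  exact ⟨n + 1, h2.le, by rw [pow_succ]; linarith⟩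

open Torus in
theorem theorem4p4 (q : ℕ) (hq : 1 ≤ q) (p p' : ℝ≥0∞) (hp : 1 ≤ p)
    (hpp' : ENNReal.HolderConjugate p p') (s : ℝ) (hs : (q : ℝ) * (p⁻¹).toReal < s)
    (Q : ℕ) (hQ : ((q : ℝ) + 1) / 2 < Q) (h : ℝ → ℝ) (hh : IsLowPassFilter Q h) :
    (∃ K : Torus q → ℂ, Torus.IsSobolevKernel s K ∧ MemLp K p' volume) ∧
    ∃ c₁ c₂ c : ℝ, 0 < c₁ ∧ 0 < c₂ ∧ 0 < c ∧
      ∀ m : ℕ, 1 ≤ m →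
        ∃ N : ℕ, c₁ * m ≤ N ∧ (N : ℝ) ≤ c₂ * m ∧
          ∀ K : Torus q → ℂ, Torus.IsSobolevKernel s K →
          ∀ (M : ℕ) (y : Fin M → Torus q),
            (∀ j k, y j ≠ y k → 1 / (m : ℝ) ≤ Torus.euclDist (y j) (y k)) →
          ∀ a : Fin M → ℝ,
            MemLp (translateSum K a y) p' volume ∧
            eLpNorm (fun x => translateSum K a y x - Torus.filterOp h N (translateSum K a y) x)
                p' volume
              ≤ 2⁻¹ * eLpNorm (translateSum K a y) p' volume ∧
            (Function.Injective y →
              ENNReal.ofReal ‖WithLp.toLp p' a‖ ≤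
                ENNReal.ofReal (c * (m : ℝ) ^ (s - (q : ℝ) * (p⁻¹).toReal)) *
                  eLpNorm (translateSum K a y) p' volume) := by
  have hr : 1 ≤ p' := hpp'.symm.one_le
  have hθ : (p⁻¹).toReal = 1 - (p'⁻¹).toReal := by
    have h1 := congrArg ENNReal.toReal hpp'.inv_add_inv_eq_one
    rw [ENNReal.toReal_add (ENNReal.inv_ne_top.mpr (zero_lt_one.trans_le hp).ne')
      (ENNReal.inv_ne_top.mpr (zero_lt_one.trans_le hr).ne'), ENNReal.toReal_one] at h1
    linarith
  rw [hθ] at hs ⊢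
  have hs0 : 0 < s := lt_of_le_of_lt
    (mul_nonneg (Nat.cast_nonneg q) (by linarith [inv_toReal_le_one hr])) hs
  have hK₀ := isSobolevKernel_sobolevKernel (q := q) hq hs0
  have hK₀' := memLp_sobolevKernel (q := q) hq hr hs
  refine ⟨⟨_, hK₀, hK₀'⟩, ?_⟩
  obtain ⟨A, C₁, hA, hC₁, hlower⟩ := exists_eLpNorm_coefficients_le hq hr hs0
  obtain ⟨C₂, hC₂, hfilter⟩ := exists_eLpNorm_sub_filterOp_le hq hr hs hQ hh
  set e : ℝ := s - q * (1 - (p'⁻¹).toReal) with he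
  have he0 : 0 < e := sub_pos.mpr hs
  have hq1 : (1 : ℝ) ≤ q := by exact_mod_cast hq
  -- The filter works l octaves above the level of the coefficient inequality; l depends only on the
  -- constants, so N* stays comparable to m.
  obtain ⟨l, hl⟩ : ∃ l : ℕ, C₁ * C₂ * ((2 : ℝ) ^ l) ^ (-e) ≤ 1 / 2 := by
    have h1 : (2 : ℝ) ^ (-e) < 1 := Real.rpow_lt_one_of_one_lt_of_neg one_lt_two (by linarith)
    have h2 := (tendsto_pow_atTop_nhds_zero_of_lt_one (by positivity) h1).const_mul (C₁ * C₂)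
    rw [mul_zero] at h2
    obtain ⟨l, hl⟩ := (h2.eventually_le_const (by norm_num : (0 : ℝ) < 1 / 2)).exists
    exact ⟨l, by rwa [rpow_dyadic]⟩
  -- With A q m ≤ 2^n ≤ 2 A q m, the choice N = 2^(n+l+1) lies between these multiples of m. The
  -- final + 1 ensures positivity, since C₁ is only known to be nonnegative.
  refine ⟨A * q * 2 ^ (l + 1), 2 * (A * q) * 2 ^ (l + 1), C₁ * (2 * A * q) ^ e + 1, by positivity,
    by positivity, by positivity, fun m hm => ?_⟩
  have hm1 : (1 : ℝ) ≤ m := by exact_mod_cast hm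
  have hAqm : 1 ≤ A * q * m := one_le_mul_of_one_le_of_one_le
    (one_le_mul_of_one_le_of_one_le hA hq1) hm1
  obtain ⟨n, hn1, hn2⟩ := exists_le_two_pow_le hAqm
  refine ⟨2 ^ (n + l + 1), ?_, ?_, fun K hK M y hy a => ?_⟩
  · push_cast
    rw [add_assoc, pow_add (2 : ℝ) n, mul_right_comm]
    gcongr
  · push_cast
    rw [add_assoc, pow_add (2 : ℝ) n, mul_right_comm]
    gcongr
    linarith
  have hδ : (0 : ℝ) < ((m : ℝ) * q)⁻¹ := by positivity
  have hδ1 : ((m : ℝ) * q)⁻¹ ≤ 1 :=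
    inv_le_one_of_one_le₀ (one_le_mul_of_one_le_of_one_le hm1 hq1)
  have hAδ : A ≤ ((m : ℝ) * q)⁻¹ * 2 ^ n := by
    rw [inv_mul_eq_div, le_div_iff₀ (by positivity)]
    linarith
  have hsep : ∀ {M' : ℕ} {y' : Fin M' → Torus q}, Function.Injective y' →
      (∀ j, ∃ i, y i = y' j) → ∀ j k, j ≠ k → ((m : ℝ) * q)⁻¹ ≤ ‖y' j - y' k‖ := by
    intro M' y' hinj hsub j k hjk
    obtain ⟨i, hi⟩ := hsub j
    obtain ⟨i', hi'⟩ := hsub k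
    have h1 := hy i i'
    rw [hi, hi'] at h1
    exact le_norm_sub_of_le_euclDist hq hm (h1 (hinj.ne hjk))
  refine ⟨memLp_translateSum ((memLp_congr_ae (hK.ae_eq hK₀)).mpr hK₀') a y, ?_, fun hinj => ?_⟩
  · obtain ⟨M', a', y', hinj, hsub, heq⟩ := exists_injective_translateSum_eq a y
    rw [← heq K]
    push_cast
    have hnl : (1 : ℝ) ≤ ((m : ℝ) * q)⁻¹ * 2 ^ (n + l) := by
      refine hA.trans (hAδ.trans ?_)
      gcongr
      · exact one_le_two
      · exact Nat.le_add_right n l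
    refine (hfilter (n + l) M' y' _ hδ hδ1 hnl (hsep hinj hsub) K hK a').trans ?_
    refine (mul_le_mul_right (hlower n M' y' _ hδ hδ1 hAδ (hsep hinj hsub) K hK a') _).trans ?_
    rw [← mul_assoc, ← ENNReal.ofReal_mul (by positivity)]
    gcongr
    -- The powers of 2^n cancel exactly, because both estimates have the sharp exponent e; only the
    -- l extra octaves remain.
    have h1 : C₂ * ((2 : ℝ) ^ (n + l)) ^ (-e) * (C₁ * ((2 : ℝ) ^ n) ^ e) =
        C₁ * C₂ * ((2 : ℝ) ^ l) ^ (-e) := by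
      rw [pow_add, Real.mul_rpow (by positivity) (by positivity)]
      have h2 : ((2 : ℝ) ^ n) ^ (-e) * ((2 : ℝ) ^ n) ^ e = 1 := by
        rw [← Real.rpow_add (by positivity), neg_add_cancel, Real.rpow_zero]
      linear_combination C₁ * C₂ * ((2 : ℝ) ^ l) ^ (-e) * h2
    rw [h1]
    refine (ENNReal.ofReal_le_ofReal hl).trans (le_of_eq ?_)
    rw [one_div, ENNReal.ofReal_inv_of_pos two_pos, ENNReal.ofReal_ofNat]
  · rw [← eLpNorm_count_eq_norm_toLp hr]
    refine (hlower n M y _ hδ hδ1 hAδ (hsep hinj fun j => ⟨j, rfl⟩) K hK a).trans ?_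
    refine mul_le_mul_left (ENNReal.ofReal_le_ofReal ?_) _
    calc C₁ * ((2 : ℝ) ^ n) ^ e ≤ C₁ * (2 * A * q * m) ^ e := by
          gcongr
          linarith
      _ = C₁ * (2 * A * q) ^ e * m ^ e := by
          rw [Real.mul_rpow (by positivity) (by positivity), mul_assoc C₁]
      _ ≤ (C₁ * (2 * A * q) ^ e + 1) * m ^ e := by
          gcongr
          exact le_add_of_nonneg_right zero_le_one
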